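/- Let $M$ be a smooth manifold (finite-dimensional, Hausdorff, $\sigma$-compact, without boundary), $n\ge 1$, $V\to M$ and $A_1,\dots,A_n\to M$ smooth vector bundles of finite rank, and for each $i$ let $(D_i,V,A_i,M)$ be a double vector bundle with core $C_i$. Write $\underline D=D_1[1]\oplus\dots\oplus D_n[n]\to V$, $\underline A=A_1[1]\oplus\dots\oplus A_n[n]\to M$ and $\underline C=C_1[1]\oplus\dots\oplus C_n[n]\to M$. A section of $D_i\to V$ is linear over $a\in\Gamma(A_i)$ if it is a vector bundle morphism from $V\to M$ to $D_i\to A_i$ over $a\colon M\to A_i$; it is a core section if it has the form $v_m\mapsto 0_{v_m}+_{A_i}c(m)$ with $c\in\Gamma(C_i)$. A split Lie $n$-algebroid structure on $\underline E=E_1[1]\oplus\dots\oplus E_n[n]\to N$ is given by a vector bundle map $\rho\colon E_1\to TN$ (the anchor) and $\mathbb R$-multilinear, graded alternating brackets $[\![\cdot,\dots,\cdot]\!]_k$ on $\Gamma(\underline E)$, $1\le k\le n+1$, mapping $\Gamma(E_{i_1})\times\dots\times\Gamma(E_{i_k})$ to $\Gamma(E_{i_1+\dots+i_k-1})$, which are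 $C^\infty(N)$-linear in each entry for $k\ne 2$, satisfy the Leibniz rule with respect to $\rho$ for $k=2$, and satisfy the strong homotopy Jacobi identities $$\sum_{i+j=k+1}(-1)^{i(j-1)}\sum_{\sigma\in \mathrm{Sh}_{i,k-i}}\mathrm{Ksgn}(\sigma)\,[\![[\![e_{\sigma(1)},\dots,e_{\sigma(i)}]\!]_i,e_{\sigma(i+1)},\dots,e_{\sigma(k)}]\!]_j=0,$$ where a section of $E_i$ counts with degree $i-1$ in the graded signs. Suppose that $(\underline D,V,\underline A,M)$ is a VB-Lie $n$-algebroid: $\underline D\to V$ is a split Lie $n$-algebroid such that the anchor $\rho_D\colon D_1\to TV$ is a morphism of double vector bundles from $(D_1,V,A_1,M)$ to $(TV,V,TM,M)$ over $\mathrm{id}_V$, the maps $D_i\to D_{i-1}$ given by the $1$-bracket are morphisms of double vector bundles over $\mathrm{id}_V$, brackets of linear sections are linear, brackets of linear sections with exactly one core section are core sections, and brackets of linear and core sections with at least two core sections vanish. The Lie $n$-algebroid structure on $\underline A$ induced by that of $\underline D$ is the one whose anchor $\rho_A$ is covered by $\rho_D$ and for which $[\![d_1,\dots,d_k]\!]_{\underline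 D}$ is linear over $[\![a_1,\dots,a_k]\!]_{\underline A}$ whenever each $d_p$ is linear over $a_p$. **Theorem.** For every $i$ there are smooth vector bundles $C_i\to M$ (the core of $D_i$) and $\widehat A_i\to M$, where the fibre of $\widehat A_i$ over $m$ is the space of linear maps from $V_m$ to a fibre of $D_i\to A_i$ over a point of $(A_i)_m$ that are sections of $D_i\to V$ over $V_m$, and where $\Gamma(\widehat A_i)$ is the space $\Gamma^l_V(D_i)$ of linear sections. The induced Lie $n$-algebroid structure on $\underline A\to M$ exists. The graded vector bundle $\underline{\widehat A}=\widehat A_1[1]\oplus\dots\oplus\widehat A_n[n]\to M$ is a split Lie $n$-algebroid with the brackets of $\underline D$ restricted to linear sections, $$[\![d_1,\dots,d_k]\!]_{\underline{\widehat A}}=[\![d_1,\dots,d_k]\!]_{\underline D},\qquad d_1,\dots,d_k\in\Gamma^l_V(\underline D)=\Gamma(\underline{\widehat A}),$$ and with anchor sending a linear section $d$ of $D_1$ to the vector field on $M$ to which the linear vector field $\rho_D(d)$ on $V$ projects. Moreover, $\underline{\mathrm{Hom}}(V,\underline C)=\bigoplus_{i=1}^n\mathrm{Hom}(V,C_i)[i]$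 carries a Lie $n$-algebroid structure over $M$ such that, degree by degree, $$0\longrightarrow \underline{\mathrm{Hom}}(V,\underline C)\longrightarrow\underline{\widehat A}\longrightarrow\underline A\longrightarrow 0$$ is a short exact sequence of vector bundles over $M$ whose maps are morphisms of Lie $n$-algebroids over $\mathrm{id}_M$ (compatible with the anchors and all brackets). Here the first map sends $\psi\in\mathrm{Hom}(V_m,(C_i)_m)$ to $v\mapsto 0_v+_{A_i}\psi(v)$, and the second sends a linear map $V_m\to D_i$ over $a\in(A_i)_m$ to $a$. -/

import Mathlib

open Bundle Manifold
open scoped ContDiff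

universe u

noncomputable section

/-! ## Smooth vector bundles of finite rank -/

section Bundles

variable {E H : Type*} [NormedAddCommGroup E] [NormedSpace ℝ E] [TopologicalSpace H]

/-- A smooth real vector bundle of finite rank over the manifold `M`. -/
structure SmoothVB (I : ModelWithCorners ℝ E H) (M : Type u) [TopologicalSpace M]
    [ChartedSpace H M] where
  /-- the model fibre -/
  F : Type u
  /-- the fibres -/
  Fib : M → Type u
  [instNormed : NormedAddCommGroup F]
  [instNormedSpace : NormedSpace ℝ F]
  [instFinite : FiniteDimensional ℝ F]
  [instTopTot : TopologicalSpace (TotalSpace F Fib)]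
  [instAddCommGroup : ∀ x, AddCommGroup (Fib x)]
  [instModule : ∀ x, Module ℝ (Fib x)]
  [instTopFib : ∀ x, TopologicalSpace (Fib x)]
  [instTopAddGroup : ∀ x, IsTopologicalAddGroup (Fib x)]
  [instContSMul : ∀ x, ContinuousSMul ℝ (Fib x)]
  [instFiberBundle : FiberBundle F Fib]
  [instVectorBundle : VectorBundle ℝ F Fib]
  [instSmooth : ContMDiffVectorBundle ∞ F Fib I]

attribute [instance] SmoothVB.instNormed SmoothVB.instNormedSpace SmoothVB.instFinite
  SmoothVB.instTopTot SmoothVB.instAddCommGroup SmoothVB.instModule SmoothVB.instTopFib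
  SmoothVB.instTopAddGroup SmoothVB.instContSMul SmoothVB.instFiberBundle
  SmoothVB.instVectorBundle SmoothVB.instSmooth

variable {I : ModelWithCorners ℝ E H} {M : Type u} [TopologicalSpace M] [ChartedSpace H M]

/-- The total space of a vector bundle. -/
abbrev SmoothVB.Tot (A : SmoothVB I M) : Type u := TotalSpace A.F A.Fib

/-- The model with corners of the total space. -/
abbrev SmoothVB.J (A : SmoothVB I M) : ModelWithCorners ℝ (E × A.F) (ModelProd H A.F) :=
  I.prod 𝓘(ℝ, A.F)

/-- The space `Γ(A)` of smooth sections. -/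
abbrev SmoothVB.Sec (A : SmoothVB I M) : Type u := ContMDiffSection I A.F ∞ A.Fib

/-- Multiplication of a section by a smooth function. -/
def SmoothVB.fsmul {A : SmoothVB I M} (f : C^∞⟮I, M; ℝ⟯) (s : A.Sec) : A.Sec :=
  ⟨fun x => f x • s x, ContMDiff.smul_section f.contMDiff s.contMDiff⟩

/-- The zero vector over `p`, as a point of the total space. -/
def SmoothVB.zeroAt (A : SmoothVB I M) (p : M) : A.Tot := ⟨p, 0⟩

/-- Scalar multiplication on the total space. -/
def SmoothVB.scale (A : SmoothVB I M) (t : ℝ) (x : A.Tot) : A.Tot := ⟨x.proj, t • x.2⟩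

/-- `A.IsSum x y z`: the points `x, y` lie in the same fibre of `A`, and `z = x + y` there. -/
def SmoothVB.IsSum (A : SmoothVB I M) (x y z : A.Tot) : Prop :=
  ∃ (p : M) (a b : A.Fib p), x = ⟨p, a⟩ ∧ y = ⟨p, b⟩ ∧ z = ⟨p, a + b⟩

/-- A smooth vector bundle morphism over the identity of the base. -/
structure VBHom (A B : SmoothVB I M) where
  /-- the linear maps on the fibres -/
  toFun : ∀ x, A.Fib x →ₗ[ℝ] B.Fib x
  smooth : ContMDiff A.J B.J ∞ (fun p : A.Tot => (⟨p.proj, toFun p.proj p.2⟩ : B.Tot))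

/-- The map on the total spaces induced by a morphism. -/
def VBHom.totMap {A B : SmoothVB I M} (φ : VBHom A B) (p : A.Tot) : B.Tot :=
  ⟨p.proj, φ.toFun p.proj p.2⟩

/-- The map on sections induced by a morphism. -/
def VBHom.mapSec {A B : SmoothVB I M} (φ : VBHom A B) (s : A.Sec) : B.Sec :=
  ⟨fun x => φ.toFun x (s x), φ.smooth.comp s.contMDiff⟩

/-- The bundle `Hom(A, B) = A* ⊗ B`. -/
def homVB (A B : SmoothVB I M) : SmoothVB I M where
  F := A.F →L[ℝ] B.F
  Fib := fun x => A.Fib x →L[ℝ] B.Fib x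

/-- The direct sum `A ⊕ B`. -/
def sumVB (A B : SmoothVB I M) : SmoothVB I M where
  F := A.F × B.F
  Fib := fun x => A.Fib x × B.Fib x
  instTopTot := FiberBundle.Prod.topologicalSpace A.F A.Fib B.F B.Fib
  instFiberBundle := FiberBundle.prod A.F A.Fib B.F B.Fib
  instVectorBundle := VectorBundle.prod ℝ A.F A.Fib B.F B.Fib
  instSmooth := Bundle.Prod.contMDiffVectorBundle (F₁ := A.F) (E₁ := A.Fib) (F₂ := B.F)
    (E₂ := B.Fib) (n := ∞) (IB := I)

variable [IsManifold I ∞ M]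

/-- A smooth vector bundle morphism `A → TM` over the identity of `M`. -/
structure AnchorMap (A : SmoothVB I M) where
  /-- the linear maps on the fibres -/
  toFun : ∀ x, A.Fib x →ₗ[ℝ] TangentSpace I x
  smooth : ContMDiff A.J I.tangent ∞
    (fun p : A.Tot => (⟨p.proj, toFun p.proj p.2⟩ : TangentBundle I M))

/-- The map on the total spaces induced by an anchor map. -/
def AnchorMap.totMap {A : SmoothVB I M} (ρ : AnchorMap A) (p : A.Tot) : TangentBundle I M :=
  ⟨p.proj, ρ.toFun p.proj p.2⟩

/-- The function `ρ(a) f`: the derivative of `f` along the vector field `ρ(a)`. -/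
def AnchorMap.deriv {A : SmoothVB I M} (ρ : AnchorMap A) (a : A.Sec) (f : C^∞⟮I, M; ℝ⟯)
    (x : M) : ℝ :=
  mfderiv I 𝓘(ℝ, ℝ) f x (ρ.toFun x (a x))

end Bundles

/-! ## Split Lie `n`-algebroids -/

section LieN

variable {E H : Type*} [NormedAddCommGroup E] [NormedSpace ℝ E] [TopologicalSpace H]
  {I : ModelWithCorners ℝ E H} {M : Type u} [TopologicalSpace M] [ChartedSpace H M] {n : ℕ}

/-- Sections of the graded vector bundle `A₁[1] ⊕ ... ⊕ Aₙ[n]`.  The index `i : Fin n` stands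
for the summand `A_{i+1}[i+1]`. -/
abbrev GSec (A : Fin n → SmoothVB I M) : Type u := ∀ i, (A i).Sec

/-- Multiplication of a graded section by a smooth function. -/
def GSec.fsmul {A : Fin n → SmoothVB I M} (f : C^∞⟮I, M; ℝ⟯) (a : GSec A) : GSec A :=
  fun i => SmoothVB.fsmul f (a i)

/-- The homogeneous graded sections given by sections `s p` of the summands `deg p`. -/
def GSec.hom {A : Fin n → SmoothVB I M} {k : ℕ} (deg : Fin k → Fin n)
    (s : ∀ p, (A (deg p)).Sec) : Fin k → GSec A :=
  fun p => Pi.single (deg p) (s p)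

/-- The graded signature: `a₁ ∧ ... ∧ aₖ = Ksgn · a_{σ(1)} ∧ ... ∧ a_{σ(k)}`, where
`a_p ∧ a_q = - (-1)^{d_p d_q} a_q ∧ a_p`.  Every inversion of `σ` contributes one such sign. -/
def ksgn {k : ℕ} (σ : Equiv.Perm (Fin k)) (d : Fin k → ℕ) : ℤ :=
  ∏ p, ∏ q, if p < q ∧ σ q < σ p then -(-1) ^ (d (σ p) * d (σ q)) else 1

/-- `σ` is an `(i, k - i)`-shuffle: it is increasing on the first `i` and on the last `k - i`
positions. -/
def IsShuffle {k : ℕ} (i : ℕ) (σ : Equiv.Perm (Fin k)) : Prop :=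
  ∀ p q : Fin k, p < q → (q.val < i ∨ i ≤ p.val) → σ p < σ q

instance {k : ℕ} (i : ℕ) (σ : Equiv.Perm (Fin k)) : Decidable (IsShuffle i σ) := by
  unfold IsShuffle; infer_instance

variable [IsManifold I ∞ M] [NeZero n]

/-- A split Lie `n`-algebroid structure on `A₁[1] ⊕ ... ⊕ Aₙ[n] → M`, in terms of the anchor
`ρ : A₁ → TM` and the multibrackets.  A bracket of sections of `A_{i₁}, ..., A_{iₖ}` is a section
of `A_{i₁ + ... + iₖ - 1}`, so that only the `k`-brackets with `1 ≤ k ≤ n + 1` can be non-zero.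
In signs, a section of `A_i` counts with the parity of `i - 1`. -/
structure LieNAlgebroid (A : Fin n → SmoothVB I M) where
  /-- the anchor -/
  anchor : AnchorMap (A 0)
  /-- the `k`-bracket -/
  br : ∀ k : ℕ, MultilinearMap ℝ (fun _ : Fin k => GSec A) (GSec A)
  degree : ∀ (k : ℕ) (deg : Fin k → Fin n) (s : ∀ p, (A (deg p)).Sec) (j : Fin n),
    ∑ p, ((deg p).val + 1) ≠ (j.val + 1) + 1 → br k (GSec.hom deg s) j = 0
  leibniz : ∀ (a b : GSec A) (f : C^∞⟮I, M; ℝ⟯) (i : Fin n) (x : M),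
    br 2 ![a, GSec.fsmul f b] i x = f x • br 2 ![a, b] i x + anchor.deriv (a 0) f x • b i x
  linear : ∀ k : ℕ, k ≠ 2 → ∀ (a : Fin k → GSec A) (p : Fin k) (f : C^∞⟮I, M; ℝ⟯),
    br k (Function.update a p (GSec.fsmul f (a p))) = GSec.fsmul f (br k a)
  skew : ∀ (k : ℕ) (deg : Fin k → Fin n) (s : ∀ p, (A (deg p)).Sec) (σ : Equiv.Perm (Fin k)),
    br k (fun p => GSec.hom deg s (σ p)) =
      ksgn σ (fun p => (deg p).val) • br k (GSec.hom deg s)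
  /-- the strong homotopy Jacobi identity; the inner bracket has arity `i = r + 1`, the outer
  bracket has arity `j = k - i + 1`, and the sign is `(-1)^{i (j - 1)}` -/
  jacobi : ∀ (k : ℕ) (deg : Fin k → Fin n) (s : ∀ p, (A (deg p)).Sec),
    ∑ r : Fin k, (-1 : ℤ) ^ ((r.val + 1) * (k - (r.val + 1))) •
      ∑ σ : Equiv.Perm (Fin k) with IsShuffle (r.val + 1) σ,
        ksgn σ (fun p => (deg p).val) •
          br ((k - (r.val + 1)) + 1)
            (Fin.cons
              (br (r.val + 1)
                (fun p => GSec.hom deg s (σ ⟨p.val, by have := p.isLt; have := r.isLt; omega⟩)))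
              (fun q => GSec.hom deg s (σ ⟨r.val + 1 + q.val, by have := q.isLt; omega⟩))) = 0

/-- A family of vector bundle morphisms `A_i → B_i` over the identity of `M` which is compatible
with the anchors and with all multibrackets, i.e. the (linear) morphism of split graded manifolds
it defines is a morphism of Lie `n`-algebroids. -/
structure IsLieNMorphism {A B : Fin n → SmoothVB I M} (LA : LieNAlgebroid A)
    (LB : LieNAlgebroid B) (φ : ∀ i, VBHom (A i) (B i)) : Prop where
  anchor : ∀ (x : M) (a : (A 0).Fib x), LB.anchor.toFun x ((φ 0).toFun x a) = LA.anchor.toFun x a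
  bracket : ∀ (k : ℕ) (a : Fin k → GSec A) (i : Fin n),
    (φ i).mapSec (LA.br k a i) = LB.br k (fun p l => (φ l).mapSec (a p l)) i

end LieN

/-! ## Double vector bundles -/

section Double

variable {E H : Type*} [NormedAddCommGroup E] [NormedSpace ℝ E] [TopologicalSpace H]
  {I : ModelWithCorners ℝ E H} {M : Type u} [TopologicalSpace M] [ChartedSpace H M]

/-- A fibrewise linear map between the total spaces of two vector bundles (possibly over
different bases). -/
structure IsFibreLinear {E₁ H₁ E₂ H₂ : Type*} [NormedAddCommGroup E₁] [NormedSpace ℝ E₁]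
    [TopologicalSpace H₁] [NormedAddCommGroup E₂] [NormedSpace ℝ E₂] [TopologicalSpace H₂]
    {I₁ : ModelWithCorners ℝ E₁ H₁} {I₂ : ModelWithCorners ℝ E₂ H₂} {M₁ M₂ : Type u}
    [TopologicalSpace M₁] [ChartedSpace H₁ M₁] [TopologicalSpace M₂] [ChartedSpace H₂ M₂]
    (A : SmoothVB I₁ M₁) (B : SmoothVB I₂ M₂) (φ : A.Tot → B.Tot) : Prop where
  add : ∀ x y z, A.IsSum x y z → B.IsSum (φ x) (φ y) (φ z)
  smul : ∀ t x, φ (A.scale t x) = B.scale t (φ x)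

/-- A double vector bundle `(D, V, A, M)`.  The manifold `D` is the total space of a vector bundle
`overV` over `V` and, through the diffeomorphism `e`, of a vector bundle `overA` over `A`; the
square of projections commutes, and the structure maps of `D → V` are vector bundle morphisms over
those of `A → M`. -/
structure DoubleVB (V A : SmoothVB I M) where
  /-- the vector bundle `D → V` -/
  overV : SmoothVB V.J V.Tot
  /-- the vector bundle `D → A` -/
  overA : SmoothVB A.J A.Tot
  /-- the identification of the two total spaces -/
  e : Diffeomorph overV.J overA.J overV.Tot overA.Tot ∞
  comm : ∀ d : overV.Tot, (e d).proj.proj = d.proj.proj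
  /-- the projection `D → V` is linear over `A → M` -/
  proj_linear : IsFibreLinear overA V (fun d => (e.symm d).proj)
  /-- the addition of `D → V` covers the addition of `A → M`, scalar multiplication likewise -/
  cover : IsFibreLinear overV A (fun d => (e d).proj)
  /-- the addition of `D → V` is additive with respect to `D → A` -/
  interchange : ∀ x₁ y₁ z₁ x₂ y₂ z₂ x₃ y₃ z₃ : overV.Tot,
    overV.IsSum x₁ y₁ z₁ → overV.IsSum x₂ y₂ z₂ → overV.IsSum x₃ y₃ z₃ →
    overA.IsSum (e x₁) (e x₂) (e x₃) → overA.IsSum (e y₁) (e y₂) (e y₃) →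
      overA.IsSum (e z₁) (e z₂) (e z₃)
  /-- the addition of `D → V` commutes with the scalar multiplication of `D → A` -/
  add_scale : ∀ (t : ℝ) (x y z : overV.Tot), overV.IsSum x y z →
    overV.IsSum (e.symm (overA.scale t (e x))) (e.symm (overA.scale t (e y)))
      (e.symm (overA.scale t (e z)))
  /-- the scalar multiplication of `D → V` is linear with respect to `D → A` -/
  scale_linear : ∀ t : ℝ, IsFibreLinear overA overA (fun d => e (overV.scale t (e.symm d)))

namespace DoubleVB

variable {V A : SmoothVB I M} (D : DoubleVB V A)

/-- The manifold `D`. -/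
abbrev Tot : Type u := D.overV.Tot

/-- The projection `D → A`. -/
def projA (d : D.Tot) : A.Tot := (D.e d).proj

/-- Addition in the fibres of `D → A`. -/
def IsSumA (x y z : D.Tot) : Prop := D.overA.IsSum (D.e x) (D.e y) (D.e z)

/-- Scalar multiplication in the fibres of `D → A`. -/
def scaleA (t : ℝ) (x : D.Tot) : D.Tot := D.e.symm (D.overA.scale t (D.e x))

/-- The section `s` of `D → V` as a map to the manifold `D`. -/
def secMap (s : D.overV.Sec) (v : V.Tot) : D.Tot := ⟨v, s v⟩

/-- The section `s` of `D → V` is linear over the section `a` of `A → M`: as a map from `V → M` to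
`D → A` it is a vector bundle morphism over `a : M → A`. -/
def IsLinearOver (s : D.overV.Sec) (a : A.Sec) : Prop :=
  IsFibreLinear V D.overA (fun v => D.e (D.secMap s v)) ∧
    ∀ v : V.Tot, D.projA (D.secMap s v) = ⟨v.proj, a v.proj⟩

/-- The linear sections `Γ_V^l(D)`. -/
def IsLinear (s : D.overV.Sec) : Prop := ∃ a : A.Sec, D.IsLinearOver s a

/-- The point `d` lies in the core, over `m`: it projects to the zero vectors of `V` and `A`. -/
def IsCorePoint (m : M) (d : D.Tot) : Prop := d.proj = V.zeroAt m ∧ D.projA d = A.zeroAt m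

/-- The core sections `Γ_V^c(D)`: sections of the form `v ↦ 0_v +_A c(m)`, `v ∈ V_m`, with `c` a
section of the core.  Here `c(m) = s(0_m)`, so that `c` is automatically smooth. -/
def IsCore (s : D.overV.Sec) : Prop :=
  ∃ c : M → D.Tot, (∀ m, D.IsCorePoint m (c m)) ∧
    ∀ v : V.Tot, D.IsSumA (D.overV.zeroAt v) (c v.proj) (D.secMap s v)

/-- The core of `D` as a vector bundle `C → M`: its fibre over `m` is, with the linear structure
of the fibre of `D → V` over `0_m`, the space of core points over `m`, and its smooth sections are
those which are smooth as maps to `D`. -/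
structure CoreBundle where
  /-- the vector bundle -/
  bundle : SmoothVB I M
  /-- the inclusion of the core into `D` -/
  incl : ∀ m, bundle.Fib m →ₗ[ℝ] D.overV.Fib (V.zeroAt m)
  injective : ∀ m, Function.Injective (incl m)
  mem_range : ∀ m (d : D.overV.Fib (V.zeroAt m)),
    d ∈ Set.range (incl m) ↔ D.IsCorePoint m ⟨V.zeroAt m, d⟩
  smooth_iff : ∀ s : (∀ m, bundle.Fib m),
    ContMDiff I bundle.J ∞ (fun m => (⟨m, s m⟩ : bundle.Tot)) ↔
      ContMDiff I D.overV.J ∞ (fun m => (⟨V.zeroAt m, incl m (s m)⟩ : D.Tot))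

/-- A map `V_m → D` which is a section of `D → V` over `V_m` is linear if it takes values in a
single fibre of `D → A` over a point of `A_m` and is linear as a map to this fibre. -/
def IsLinearAt (m : M) (φ : ∀ v : V.Fib m, D.overV.Fib ⟨m, v⟩) : Prop :=
  (∃ a : A.Fib m, ∀ v, D.projA ⟨⟨m, v⟩, φ v⟩ = ⟨m, a⟩) ∧
  (∀ v w, D.IsSumA ⟨⟨m, v⟩, φ v⟩ ⟨⟨m, w⟩, φ w⟩ ⟨⟨m, v + w⟩, φ (v + w)⟩) ∧
  ∀ (t : ℝ) (v), (⟨⟨m, t • v⟩, φ (t • v)⟩ : D.Tot) = D.scaleA t ⟨⟨m, v⟩, φ v⟩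

/-- The vector bundle `Â → M` of linear sections of `D → V`: its fibre over `m` is the space of
linear maps `V_m → D` (with the pointwise linear structure of `D → V`), and its smooth sections
are precisely those which are smooth as sections `V → D`, so that `Γ(Â) = Γ_V^l(D)`. -/
structure FatBundle where
  /-- the vector bundle -/
  bundle : SmoothVB I M
  /-- evaluation of an element of `Â_m` on `V_m` -/
  ev : ∀ m, bundle.Fib m →ₗ[ℝ] (∀ v : V.Fib m, D.overV.Fib ⟨m, v⟩)
  injective : ∀ m, Function.Injective (ev m)
  mem_range : ∀ m (φ : ∀ v : V.Fib m, D.overV.Fib ⟨m, v⟩),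
    φ ∈ Set.range (ev m) ↔ D.IsLinearAt m φ
  smooth_iff : ∀ s : (∀ m, bundle.Fib m),
    ContMDiff I bundle.J ∞ (fun m => (⟨m, s m⟩ : bundle.Tot)) ↔
      ContMDiff V.J D.overV.J ∞
        (fun v : V.Tot => (⟨v, ev v.proj (s v.proj) v.2⟩ : D.Tot))

variable {D}

/-- The linear section of `D → V` given by a section of `Â`. -/
def FatBundle.toSec (B : D.FatBundle) (s : B.bundle.Sec) : D.overV.Sec :=
  ⟨fun v => B.ev v.proj (s v.proj) v.2, (B.smooth_iff s).1 s.contMDiff⟩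

end DoubleVB

/-! ## Tangent double vector bundle and VB-Lie `n`-algebroids -/

/-- Addition in the fibres of `TV → TM`, obtained by applying the tangent functor to the
addition map `V ⊕ V → V`. -/
def IsTangentSum (V : SmoothVB I M) (x y z : TangentBundle V.J V.Tot) : Prop :=
  ∃ ξ : TangentBundle (sumVB V V).J (sumVB V V).Tot,
    tangentMap (sumVB V V).J V.J (fun p : (sumVB V V).Tot => (⟨p.proj, p.2.1⟩ : V.Tot)) ξ = x ∧
    tangentMap (sumVB V V).J V.J (fun p : (sumVB V V).Tot => (⟨p.proj, p.2.2⟩ : V.Tot)) ξ = y ∧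
    tangentMap (sumVB V V).J V.J
      (fun p : (sumVB V V).Tot => (⟨p.proj, p.2.1 + p.2.2⟩ : V.Tot)) ξ = z

variable [IsManifold I ∞ M]

/-- The anchor `ρ_D : D → TV` is a morphism of double vector bundles from `(D, V, A, M)` to
`(TV, V, TM, M)` over `id_V` and `ρ_A : A → TM`. -/
structure IsLinearAnchor {V A : SmoothVB I M} (D : DoubleVB V A) (ρD : AnchorMap D.overV)
    (ρA : AnchorMap A) : Prop where
  comm : ∀ d : D.Tot,
    tangentMap V.J I (fun v : V.Tot => v.proj) (ρD.totMap d) = ρA.totMap (D.projA d)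
  add : ∀ x y z, D.IsSumA x y z → IsTangentSum V (ρD.totMap x) (ρD.totMap y) (ρD.totMap z)
  smul : ∀ (t : ℝ) (x), ρD.totMap (D.scaleA t x) = tangentMap V.J V.J (V.scale t) (ρD.totMap x)

/-- `(∂_D, id_V, ∂_A, id_M)` is a morphism of double vector bundles. -/
structure IsDoubleVBMorphism {V A B : SmoothVB I M} (D : DoubleVB V A) (D' : DoubleVB V B)
    (dD : VBHom D.overV D'.overV) (dA : VBHom A B) : Prop where
  comm : ∀ d : D.Tot, D'.projA (dD.totMap d) = dA.totMap (D.projA d)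
  linear : IsFibreLinear D.overA D'.overA (fun x => D'.e (dD.totMap (D.e.symm x)))

/-- A Lie `n`-algebroid structure on `D = D₁[1] ⊕ ... ⊕ Dₙ[n] → V` makes `(D, V, A, M)` a VB-Lie
`n`-algebroid if it is linear over `A₁[1] ⊕ ... ⊕ Aₙ[n] → M`. -/
structure IsVBLieNAlgebroid {n : ℕ} [NeZero n] {V : SmoothVB I M} {A : Fin n → SmoothVB I M}
    (D : ∀ i, DoubleVB V (A i)) (L : LieNAlgebroid (fun i => (D i).overV)) : Prop where
  /-- the anchor is a morphism of double vector bundles -/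
  anchor_linear : ∃ ρA : AnchorMap (A 0), IsLinearAnchor (D 0) L.anchor ρA
  /-- the maps `∂ : D_i → D_{i-1}` (the `1`-bracket) are morphisms of double vector bundles -/
  differential_linear : ∀ i j : Fin n, i.val = j.val + 1 →
    ∃ (dD : VBHom (D i).overV (D j).overV) (dA : VBHom (A i) (A j)),
      (∀ s : (D i).overV.Sec, L.br 1 (fun _ => Pi.single i s) j = dD.mapSec s) ∧
        IsDoubleVBMorphism (D i) (D j) dD dA
  /-- brackets of linear sections are linear -/
  br_linear : ∀ (k : ℕ) (d : Fin k → GSec (fun i => (D i).overV)),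
    (∀ p i, (D i).IsLinear (d p i)) → ∀ i, (D i).IsLinear (L.br k d i)
  /-- brackets of linear sections with one core section are core sections -/
  br_core : ∀ (k : ℕ) (d : Fin k → GSec (fun i => (D i).overV)) (p₀ : Fin k),
    (∀ i, (D i).IsCore (d p₀ i)) → (∀ p, p ≠ p₀ → ∀ i, (D i).IsLinear (d p i)) →
      ∀ i, (D i).IsCore (L.br k d i)
  /-- brackets of linear and core sections, at least two of them core sections, are zero -/
  br_zero : ∀ (k : ℕ) (d : Fin k → GSec (fun i => (D i).overV)) (p₀ p₁ : Fin k), p₀ ≠ p₁ →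
    (∀ i, (D i).IsCore (d p₀ i)) → (∀ i, (D i).IsCore (d p₁ i)) →
    (∀ p, (∀ i, (D i).IsLinear (d p i)) ∨ (∀ i, (D i).IsCore (d p i))) → L.br k d = 0

/-- The Lie `n`-algebroid structure `LA` on `A → M` is the one induced by the VB-Lie `n`-algebroid
structure `L`: the anchor of `L` is linear over that of `LA`, and the bracket of linear sections
over `a₁, ..., aₖ` is linear over the bracket of `a₁, ..., aₖ`. -/
structure IsSideStructure {n : ℕ} [NeZero n] {V : SmoothVB I M} {A : Fin n → SmoothVB I M}
    (D : ∀ i, DoubleVB V (A i)) (L : LieNAlgebroid (fun i => (D i).overV))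
    (LA : LieNAlgebroid A) : Prop where
  anchor : IsLinearAnchor (D 0) L.anchor LA.anchor
  bracket : ∀ (k : ℕ) (d : Fin k → GSec (fun i => (D i).overV)) (a : Fin k → GSec A),
    (∀ p i, (D i).IsLinearOver (d p i) (a p i)) →
      ∀ i, (D i).IsLinearOver (L.br k d i) (LA.br k a i)

/-- The Lie `n`-algebroid structure `LF` on `Â = ⊕ Â_i[i] → M` is the restriction of `L` to the
linear sections: its brackets are those of `L`, and its anchor sends a linear section `d` of `D₁`
to the vector field on `M` to which the linear vector field `ρ_D(d)` on `V` projects. -/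
structure IsFatStructure {n : ℕ} [NeZero n] {V : SmoothVB I M} {A : Fin n → SmoothVB I M}
    (D : ∀ i, DoubleVB V (A i)) (L : LieNAlgebroid (fun i => (D i).overV))
    (B : ∀ i, (D i).FatBundle) (LF : LieNAlgebroid (fun i => (B i).bundle)) : Prop where
  anchor : ∀ (m : M) (b : (B 0).bundle.Fib m) (v : V.Fib m),
    tangentMap V.J I (fun v : V.Tot => v.proj)
      (L.anchor.totMap ⟨⟨m, v⟩, (B 0).ev m b v⟩) = LF.anchor.totMap ⟨m, b⟩
  bracket : ∀ (k : ℕ) (s : Fin k → GSec (fun i => (B i).bundle)) (i : Fin n),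
    (B i).toSec (LF.br k s i) = L.br k (fun p l => (B l).toSec (s p l)) i

/-- The morphism `j : Hom(V, C) → Â` is the inclusion of the core-linear sections
`ψ ↦ (v ↦ 0_v +_A ψ(v))`. -/
def IsCoreLinearInclusion {V A : SmoothVB I M} {D : DoubleVB V A} (C : D.CoreBundle)
    (B : D.FatBundle) (j : VBHom (homVB V C.bundle) B.bundle) : Prop :=
  ∀ (m : M) (ψ : V.Fib m →L[ℝ] C.bundle.Fib m) (v : V.Fib m),
    D.IsSumA (D.overV.zeroAt ⟨m, v⟩) ⟨V.zeroAt m, C.incl m (ψ v)⟩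
      ⟨⟨m, v⟩, B.ev m (j.toFun m ψ) v⟩

/-- The morphism `pr : Â → A` sends a linear map `V_m → D` over `a ∈ A_m` to `a`. -/
def IsFatProjection {V A : SmoothVB I M} {D : DoubleVB V A} (B : D.FatBundle)
    (pr : VBHom B.bundle A) : Prop :=
  ∀ (m : M) (b : B.bundle.Fib m) (v : V.Fib m),
    D.projA ⟨⟨m, v⟩, B.ev m b v⟩ = ⟨m, pr.toFun m b⟩

/-- The sequence `0 → A → B → C → 0` of vector bundles over `M` is exact. -/
structure IsShortExact {A B C : SmoothVB I M} (j : VBHom A B) (pr : VBHom B C) : Prop where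
  injective : ∀ m, Function.Injective (j.toFun m)
  exact : ∀ m, Function.Exact (j.toFun m) (pr.toFun m)
  surjective : ∀ m, Function.Surjective (pr.toFun m)

end Double

end

noncomputable section

open Topology Filter

/-! ### Smoothness of maps into vector bundles, read in trivializations. -/

section BundleGeneralities

variable {E H : Type*} [NormedAddCommGroup E] [NormedSpace ℝ E] [TopologicalSpace H]
  {I : ModelWithCorners ℝ E H} {M : Type u} [TopologicalSpace M] [ChartedSpace H M]
  {E' H' : Type*} [NormedAddCommGroup E'] [NormedSpace ℝ E'] [TopologicalSpace H']
  {I' : ModelWithCorners ℝ E' H'} {N : Type*} [TopologicalSpace N] [ChartedSpace H' N]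

/-! Everything rests on a decomposition `Â_i ≅ A_i ⊕ Hom(V, C_i)`. The core is the kernel of `D → A`
over the zero section of `V`. The zero section of `D → A` splits this projection there, so the core
is the image of a smooth family of projections of constant rank, hence a vector bundle
(`ProjFamily.bundle`). A linear map `V_m → D` over `0 ∈ A_m` is precisely `v ↦ 0_v +_A ψ(v)` with `ψ
∈ Hom(V_m, C_m)` (`IsLinearAtOver.exists_eq_coreIncl`). It remains to produce, smoothly and linearly
in `a`, one linear map over each `a ∈ A_m`.

For this, choose a smooth right inverse `S` of the surjection from `D` to the pullback of `A` over
`V`, and differentiate `t ↦ S_{tv}(a)` at `t = 0` inside the vector space `D_a`, the fibre of `D →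
A` over `a` (`Lift.lin`). The result is the derivative at the origin of a smooth map `V_m → D_a` in
the direction `v`; hence it is linear in `v`, and it lies over `v`. By the interchange law, addition
in `D → V` is a linear map on `D_a ×_{V_m} D_{a'}`, so it commutes with differentiation and
linearity in `a` survives (`Lift.lift_add_smul`). Subtracting this lift from any linear map over `a`
leaves a core-linear one. The exact sequence is then that of a direct sum.

For the brackets, linear sections are closed under the operations of `D`, and a section of `Â` is
determined by its linear section. All axioms therefore restrict, with a function `f` on `M` acting
as its pullback to `V`; the anchor is the anchor of `A` composed with the projection `Â → A`
(`LieNAlgebroid.restrict`).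

To descend to `A`, a bracket of linear sections with one entry over zero must again lie over zero
(`qA_br_eq_zero`). Such an entry is core-linear. Up to a term `g • d` with `g` vanishing near the
given point, it is a finite sum `∑ l_j • c_j` with core sections `c_j` and functions `l_j` on `V`.
Brackets of linear sections with one core section are core sections, and these project to zero; the
Leibniz rule adds only multiples of the `c_j`, which project to zero as well. Thus the projection of
a bracket depends only on the projections of its entries: `A` is a quotient of `Â`, and `Hom(V, C)`
is the kernel. -/

theorem contMDiffAt_clm_of_apply {F G : Type*} [NormedAddCommGroup F] [NormedSpace ℝ F]
    [FiniteDimensional ℝ F] [NormedAddCommGroup G] [NormedSpace ℝ G] {f : N → F →L[ℝ] G} {x₀ : N}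
    (h : ∀ w, ContMDiffAt I' 𝓘(ℝ, G) ∞ (fun x => f x w) x₀) :
    ContMDiffAt I' 𝓘(ℝ, F →L[ℝ] G) ∞ f x₀ := by
  have hd : Module.finrank ℝ F = Module.finrank ℝ (Fin (Module.finrank ℝ F) → ℝ) :=
    (Module.finrank_fin_fun ℝ).symm
  let e₁ := ContinuousLinearEquiv.ofFinrankEq hd
  let e₂ := (e₁.arrowCongr (1 : G ≃L[ℝ] G)).trans
    (ContinuousLinearEquiv.piRing (Fin (Module.finrank ℝ F)))
  rw [← Function.id_comp f, ← e₂.symm_comp_self]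
  exact e₂.symm.contDiff.contMDiff.contMDiffAt.comp x₀ (contMDiffAt_pi_space.2 fun i => h _)

namespace SmoothVB

variable (A B : SmoothVB I M) {b : N → M} {x₀ : N}

instance (x : M) : FiniteDimensional ℝ (A.Fib x) :=
  LinearEquiv.finiteDimensional (VectorBundle.continuousLinearEquivAt ℝ A.F A.Fib x).symm.toLinearEquiv

instance (x : M) : T2Space (A.Fib x) :=
  (VectorBundle.continuousLinearEquivAt ℝ A.F A.Fib x).toHomeomorph.symm.t2Space

theorem finrank_fib (x : M) : Module.finrank ℝ (A.Fib x) = Module.finrank ℝ A.F :=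
  (VectorBundle.continuousLinearEquivAt ℝ A.F A.Fib x).toLinearEquiv.finrank_eq

/-- The preferred trivialization at `x`. -/
abbrev triv (x : M) : Trivialization A.F (π A.F A.Fib) := trivializationAt A.F A.Fib x

theorem mem_triv (x : M) : x ∈ (A.triv x).baseSet := mem_baseSet_trivializationAt A.F A.Fib x

variable {A B}

theorem contMDiffAt_proj_of {s : ∀ x, A.Fib (b x)}
    (h : ContMDiffAt I' A.J ∞ (fun x => (⟨b x, s x⟩ : A.Tot)) x₀) : ContMDiffAt I' I ∞ b x₀ :=
  (contMDiffAt_totalSpace.1 h).1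

/-- Smoothness may be tested in any trivialization around the point. Off its base set
`continuousLinearMapAt` is a default value, which is harmless because only germs matter; in exchange
the coordinate expression is linear everywhere. -/
theorem contMDiffAt_mk_iff (y : M) (hy : b x₀ ∈ (A.triv y).baseSet) {s : ∀ x, A.Fib (b x)} :
    ContMDiffAt I' A.J ∞ (fun x => (⟨b x, s x⟩ : A.Tot)) x₀ ↔
      ContMDiffAt I' I ∞ b x₀ ∧
        ContMDiffAt I' 𝓘(ℝ, A.F) ∞ (fun x => (A.triv y).continuousLinearMapAt ℝ (b x) (s x)) x₀ := by
  rw [(A.triv y).contMDiffAt_iff ((A.triv y).mem_source.2 hy)]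
  refine and_congr_right fun h => ?_
  refine Filter.EventuallyEq.contMDiffAt_iff ?_
  filter_upwards [h.continuousAt.preimage_mem_nhds ((A.triv y).open_baseSet.mem_nhds hy)] with x hx
  exact ((A.triv y).continuousLinearMapAt_apply_of_mem ℝ hx _).symm

theorem contMDiffAt_mk_iff' {s : ∀ x, A.Fib (b x)} :
    ContMDiffAt I' A.J ∞ (fun x => (⟨b x, s x⟩ : A.Tot)) x₀ ↔
      ContMDiffAt I' I ∞ b x₀ ∧ ContMDiffAt I' 𝓘(ℝ, A.F) ∞
        (fun x => (A.triv (b x₀)).continuousLinearMapAt ℝ (b x) (s x)) x₀ :=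
  contMDiffAt_mk_iff _ (A.mem_triv _)

theorem contMDiffAt_symmL (y : M) (hy : b x₀ ∈ (A.triv y).baseSet) {w : N → A.F}
    (hb : ContMDiffAt I' I ∞ b x₀) (hw : ContMDiffAt I' 𝓘(ℝ, A.F) ∞ w x₀) :
    ContMDiffAt I' A.J ∞ (fun x => (⟨b x, (A.triv y).symmL ℝ (b x) (w x)⟩ : A.Tot)) x₀ := by
  refine (contMDiffAt_mk_iff y hy).2 ⟨hb, hw.congr_of_eventuallyEq ?_⟩
  filter_upwards [hb.continuousAt.preimage_mem_nhds ((A.triv y).open_baseSet.mem_nhds hy)] with x hx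
  exact (A.triv y).continuousLinearMapAt_symmL hx _

theorem contMDiffAt_add {s t : ∀ x, A.Fib (b x)}
    (hs : ContMDiffAt I' A.J ∞ (fun x => (⟨b x, s x⟩ : A.Tot)) x₀)
    (ht : ContMDiffAt I' A.J ∞ (fun x => (⟨b x, t x⟩ : A.Tot)) x₀) :
    ContMDiffAt I' A.J ∞ (fun x => (⟨b x, s x + t x⟩ : A.Tot)) x₀ := by
  rw [contMDiffAt_mk_iff'] at *
  refine ⟨hs.1, (hs.2.add ht.2).congr_of_eventuallyEq (.of_forall fun x => ?_)⟩
  simp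

theorem contMDiffAt_sub {s t : ∀ x, A.Fib (b x)}
    (hs : ContMDiffAt I' A.J ∞ (fun x => (⟨b x, s x⟩ : A.Tot)) x₀)
    (ht : ContMDiffAt I' A.J ∞ (fun x => (⟨b x, t x⟩ : A.Tot)) x₀) :
    ContMDiffAt I' A.J ∞ (fun x => (⟨b x, s x - t x⟩ : A.Tot)) x₀ := by
  rw [contMDiffAt_mk_iff'] at *
  refine ⟨hs.1, (hs.2.sub ht.2).congr_of_eventuallyEq (.of_forall fun x => ?_)⟩
  simp

theorem contMDiffAt_smul {f : N → ℝ} {s : ∀ x, A.Fib (b x)}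
    (hf : ContMDiffAt I' 𝓘(ℝ, ℝ) ∞ f x₀)
    (hs : ContMDiffAt I' A.J ∞ (fun x => (⟨b x, s x⟩ : A.Tot)) x₀) :
    ContMDiffAt I' A.J ∞ (fun x => (⟨b x, f x • s x⟩ : A.Tot)) x₀ := by
  rw [contMDiffAt_mk_iff'] at *
  refine ⟨hs.1, (hf.smul hs.2).congr_of_eventuallyEq (.of_forall fun x => ?_)⟩
  simp

theorem contMDiffAt_zero (hb : ContMDiffAt I' I ∞ b x₀) :
    ContMDiffAt I' A.J ∞ (fun x => (⟨b x, 0⟩ : A.Tot)) x₀ := by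
  rw [contMDiffAt_mk_iff']
  refine ⟨hb, contMDiffAt_const (c := 0) |>.congr_of_eventuallyEq (.of_forall fun x => ?_)⟩
  simp

theorem contMDiffAt_hom_apply {φ : ∀ x, A.Fib (b x) →L[ℝ] B.Fib (b x)} {s : ∀ x, A.Fib (b x)}
    (hφ : ContMDiffAt I' (homVB A B).J ∞ (fun x => (⟨b x, φ x⟩ : (homVB A B).Tot)) x₀)
    (hs : ContMDiffAt I' A.J ∞ (fun x => (⟨b x, s x⟩ : A.Tot)) x₀) :
    ContMDiffAt I' B.J ∞ (fun x => (⟨b x, φ x (s x)⟩ : B.Tot)) x₀ :=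
  ContMDiffAt.clm_bundle_apply (F₁ := A.F) (E₁ := A.Fib) (F₂ := B.F) (E₂ := B.Fib) hφ hs

/-- A family of linear maps which sends smooth sections to smooth sections is smooth. -/
theorem contMDiffAt_hom_of_apply {φ : ∀ x, A.Fib (b x) →L[ℝ] B.Fib (b x)}
    (hb : ContMDiffAt I' I ∞ b x₀)
    (h : ∀ s : ∀ x, A.Fib (b x), ContMDiffAt I' A.J ∞ (fun x => (⟨b x, s x⟩ : A.Tot)) x₀ →
      ContMDiffAt I' B.J ∞ (fun x => (⟨b x, φ x (s x)⟩ : B.Tot)) x₀) :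
    ContMDiffAt I' (homVB A B).J ∞ (fun x => (⟨b x, φ x⟩ : (homVB A B).Tot)) x₀ := by
  refine (contMDiffAt_hom_bundle (F₁ := A.F) (E₁ := A.Fib) (F₂ := B.F) (E₂ := B.Fib) _).2
    ⟨hb, contMDiffAt_clm_of_apply fun w => ?_⟩
  exact (contMDiffAt_mk_iff'.1 (h _ (contMDiffAt_symmL (b x₀) (A.mem_triv _) hb
    (contMDiffAt_const (c := w))))).2

theorem contMDiffAt_prod_iff {s : ∀ x, A.Fib (b x)} {t : ∀ x, B.Fib (b x)} :
    ContMDiffAt I' (sumVB A B).J ∞ (fun x => (⟨b x, (s x, t x)⟩ : (sumVB A B).Tot)) x₀ ↔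
      ContMDiffAt I' A.J ∞ (fun x => (⟨b x, s x⟩ : A.Tot)) x₀ ∧
        ContMDiffAt I' B.J ∞ (fun x => (⟨b x, t x⟩ : B.Tot)) x₀ := by
  rw [contMDiffAt_totalSpace (F := A.F), contMDiffAt_totalSpace (F := B.F)]
  refine (contMDiffAt_totalSpace (F := A.F × B.F) (E := fun x => A.Fib x × B.Fib x)).trans ?_
  constructor
  · rintro ⟨h1, h2⟩
    have h3 := (contMDiffAt_prod_module_iff _).1 h2
    exact ⟨⟨h1, h3.1⟩, h1, h3.2⟩
  · rintro ⟨⟨h1, h2⟩, -, h3⟩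
    exact ⟨h1, h2.prodMk_space h3⟩

end SmoothVB

end BundleGeneralities

/-! ### Pullback bundles and derivatives of curves in a fibre. -/

section BundleGeneralities

variable {E H : Type*} [NormedAddCommGroup E] [NormedSpace ℝ E] [TopologicalSpace H]
  {I : ModelWithCorners ℝ E H} {M : Type u} [TopologicalSpace M] [ChartedSpace H M]
  {E' H' : Type*} [NormedAddCommGroup E'] [NormedSpace ℝ E'] [TopologicalSpace H']
  {I' : ModelWithCorners ℝ E' H'} {N : Type*} [TopologicalSpace N] [ChartedSpace H' N]

namespace SmoothVB

/-- The pullback of a vector bundle along a smooth map. -/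
def pull {N : Type u} [TopologicalSpace N] [ChartedSpace H' N] (f : C^∞⟮I', N; I, M⟯)
    (A : SmoothVB I M) : SmoothVB I' N where
  F := A.F
  Fib := fun x => A.Fib (f x)
  instTopTot := Pullback.TotalSpace.topologicalSpace A.F A.Fib f
  instAddCommGroup := fun x => A.instAddCommGroup (f x)
  instModule := fun x => A.instModule (f x)
  instTopFib := fun x => A.instTopFib (f x)
  instTopAddGroup := fun x => A.instTopAddGroup (f x)
  instContSMul := fun x => A.instContSMul (f x)
  instFiberBundle := FiberBundle.pullback (F := A.F) (E := A.Fib) f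
  instVectorBundle := VectorBundle.pullback ℝ (F := A.F) (E := A.Fib) f
  instSmooth := ContMDiffVectorBundle.pullback A.F A.Fib I' f

/-- The trivializations of the pullback are those of `A` over the image point, so both sides have
the same coordinate expression. -/
theorem contMDiffAt_pull_iff {N' : Type u} [TopologicalSpace N'] {E'' H'' : Type*}
    [NormedAddCommGroup E''] [NormedSpace ℝ E''] [TopologicalSpace H'']
    {I'' : ModelWithCorners ℝ E'' H''} [ChartedSpace H'' N'] (f : C^∞⟮I'', N'; I, M⟯)
    {A : SmoothVB I M} {b : N → N'} {x₀ : N} {s : ∀ x, A.Fib (f (b x))} :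
    ContMDiffAt I' (A.pull f).J ∞ (fun x => (TotalSpace.mk (b x) (s x) : (A.pull f).Tot)) x₀ ↔
      ContMDiffAt I' I'' ∞ b x₀ ∧
        ContMDiffAt I' A.J ∞ (fun x => (⟨f (b x), s x⟩ : A.Tot)) x₀ := by
  let _ := FiberBundle.pullback (F := A.F) (E := A.Fib) f
  rw [contMDiffAt_totalSpace (F := A.F) (E := A.Fib)]
  refine (contMDiffAt_totalSpace (F := (A.pull f).F) (E := (A.pull f).Fib)).trans ?_
  constructor
  · rintro ⟨h1, h2⟩
    exact ⟨h1, f.contMDiff.contMDiffAt.comp x₀ h1, h2⟩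
  · rintro ⟨h1, -, h3⟩
    exact ⟨h1, h3⟩

/-- The derivative at `0` of a curve in a fibre. -/
def fibDeriv {A : SmoothVB I M} {y : M} (g : ℝ → A.Fib y) : A.Fib y :=
  (A.triv y).symmL ℝ y (deriv (fun t => (A.triv y).continuousLinearMapAt ℝ y (g t)) 0)

/-- This makes `fibDeriv` independent of the trivialization in its definition: it can be computed
after any continuous linear map out of the fibre. -/
theorem hasDerivAt_fibDeriv {A : SmoothVB I M} {y : M} {g : ℝ → A.Fib y}
    (hg : ContMDiffAt 𝓘(ℝ, ℝ) A.J ∞ (fun t => (⟨y, g t⟩ : A.Tot)) 0)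
    {W : Type*} [NormedAddCommGroup W] [NormedSpace ℝ W] (φ : A.Fib y →L[ℝ] W) :
    HasDerivAt (fun t => φ (g t)) (φ (fibDeriv g)) 0 := by
  have h1 : DifferentiableAt ℝ (fun t => (A.triv y).continuousLinearMapAt ℝ y (g t)) 0 :=
    ((contMDiffAt_mk_iff (b := fun _ : ℝ => y) y (A.mem_triv y)).1 hg).2.contDiffAt.differentiableAt
      (by simp)
  have h2 := ((φ.comp ((A.triv y).symmL ℝ y)).hasFDerivAt.comp_hasDerivAt (0 : ℝ) h1.hasDerivAt)
  refine h2.congr_of_eventuallyEq (.of_forall fun t => ?_)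
  exact congrArg φ ((A.triv y).symmL_continuousLinearMapAt (A.mem_triv y) (g t)).symm

/-- In the fixed trivialization at `b x₀` the fibre derivative is a partial derivative in `t` of a
jointly smooth function, hence smooth in the parameter. -/
theorem contMDiffAt_fibDeriv [IsManifold I' ∞ N] {A : SmoothVB I M} {b : N → M} {x₀ : N}
    {G : ∀ x, ℝ → A.Fib (b x)}
    (hG : ContMDiff (I'.prod 𝓘(ℝ, ℝ)) A.J ∞
      (fun p : N × ℝ => (⟨b p.1, G p.1 p.2⟩ : A.Tot))) :
    ContMDiffAt I' A.J ∞ (fun x => (⟨b x, fibDeriv (G x)⟩ : A.Tot)) x₀ := by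
  have hb : ContMDiffAt I' I ∞ b x₀ := by
    have h := contMDiffAt_proj_of (b := fun p : N × ℝ => b p.1) (hG (x₀, 0))
    exact h.comp (f := fun x => (x, (0 : ℝ))) x₀ (contMDiffAt_id.prodMk contMDiffAt_const)
  refine contMDiffAt_mk_iff'.2 ⟨hb, ?_⟩
  have h1 := (contMDiffAt_mk_iff' (b := fun p : N × ℝ => b p.1) (x₀ := (x₀, (0 : ℝ)))).1 (hG (x₀, 0))
  have : IsManifold I' 1 N := IsManifold.of_le (n := ∞) (by simp)
  have h2 := ContMDiffAt.mfderiv_apply (m := ∞) (I := 𝓘(ℝ, ℝ)) (I' := 𝓘(ℝ, A.F)) (J := I')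
    (x₀ := x₀) (fun x (t : ℝ) => (A.triv (b x₀)).continuousLinearMapAt ℝ (b x) (G x t))
    (fun _ => 0) id (fun _ => (1 : ℝ)) h1.2 contMDiffAt_const contMDiffAt_id contMDiffAt_const
    (by simp)
  refine h2.congr_of_eventuallyEq (.of_forall fun x => ?_)
  -- `fibDeriv` uses the trivialization at `b x`, whereas smoothness is read in the one at `b x₀`;
  -- the derivatives agree by linearity.
  have h3 := hasDerivAt_fibDeriv (g := G x)
    ((hG (x, 0)).comp (0 : ℝ) (contMDiffAt_const.prodMk contMDiffAt_id))
    ((A.triv (b x₀)).continuousLinearMapAt ℝ (b x))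
  simp only [inTangentCoordinates_model_space, mfderiv_eq_fderiv, id]
  exact h3.deriv.symm

end SmoothVB
end BundleGeneralities

/-! ### Right inverses of surjective morphisms; topology of total spaces. -/

section BundleGeneralities

variable {E H : Type*} [NormedAddCommGroup E] [NormedSpace ℝ E] [TopologicalSpace H]
  {I : ModelWithCorners ℝ E H} {M : Type u} [TopologicalSpace M] [ChartedSpace H M]

theorem contMDiffAt_inverse {N E' H' : Type*} [NormedAddCommGroup E'] [NormedSpace ℝ E']
    [TopologicalSpace H'] {I' : ModelWithCorners ℝ E' H'} [TopologicalSpace N] [ChartedSpace H' N]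
    {F : Type*} [NormedAddCommGroup F] [NormedSpace ℝ F]
    [CompleteSpace F] {g : N → F →L[ℝ] F} {x₀ : N} (hg : ContMDiffAt I' 𝓘(ℝ, F →L[ℝ] F) ∞ g x₀)
    (hu : IsUnit (g x₀)) :
    ContMDiffAt I' 𝓘(ℝ, F →L[ℝ] F) ∞ (fun x => Ring.inverse (g x)) x₀ := by
  obtain ⟨u, hu⟩ := hu
  have h := contDiffAt_ringInverse ℝ u (n := ∞)
  rw [hu] at h
  exact h.contMDiffAt.comp x₀ hg

namespace SmoothVB

variable {A B : SmoothVB I M}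

/-- A smooth surjective morphism of vector bundles has local smooth right inverses. -/
theorem exists_local_rightInverse (φ : ∀ x, A.Fib x →L[ℝ] B.Fib x)
    (hφ : ∀ x, ContMDiffAt I (homVB A B).J ∞ (fun x => (⟨x, φ x⟩ : (homVB A B).Tot)) x)
    (x₀ : M) (hs : Function.Surjective (φ x₀)) :
    ∃ U ∈ 𝓝 x₀, ∃ S : ∀ x, B.Fib x →L[ℝ] A.Fib x,
      (∀ x ∈ U, ContMDiffAt I (homVB B A).J ∞ (fun x => (⟨x, S x⟩ : (homVB B A).Tot)) x) ∧
        ∀ x ∈ U, ∀ y, φ x (S x y) = y := by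
  have : CompleteSpace B.F := FiniteDimensional.complete ℝ B.F
  let a := A.triv x₀
  let b := B.triv x₀
  have ha := A.mem_triv x₀
  have hb := B.mem_triv x₀
  let φ₀ : A.F →L[ℝ] B.F := (b.continuousLinearMapAt ℝ x₀).comp ((φ x₀).comp (a.symmL ℝ x₀))
  have hs₀ : Function.Surjective φ₀ := by
    intro w
    obtain ⟨y, hy⟩ := hs (b.symmL ℝ x₀ w)
    refine ⟨a.continuousLinearMapAt ℝ x₀ y, ?_⟩
    change b.continuousLinearMapAt ℝ x₀ (φ x₀ (a.symmL ℝ x₀ (a.continuousLinearMapAt ℝ x₀ y))) = w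
    rw [a.symmL_continuousLinearMapAt ha, hy, b.continuousLinearMapAt_symmL hb]
  obtain ⟨r₀, hr₀⟩ := (φ₀ : A.F →ₗ[ℝ] B.F).exists_rightInverse_of_surjective
    (LinearMap.range_eq_top.2 hs₀)
  let r : B.F →L[ℝ] A.F := LinearMap.toContinuousLinearMap r₀
  -- In coordinates `g = φ ∘ r`, where `r` is a right inverse at `x₀` kept constant. Since `g x₀ =
  -- 1`, it is invertible nearby, and `r ∘ g⁻¹` is a right inverse there.
  let g : M → B.F →L[ℝ] B.F := fun x =>
    (b.continuousLinearMapAt ℝ x).comp ((φ x).comp ((a.symmL ℝ x).comp r))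
  have hg : ∀ x ∈ a.baseSet ∩ b.baseSet, ContMDiffAt I 𝓘(ℝ, B.F →L[ℝ] B.F) ∞ g x := by
    rintro x ⟨hxa, hxb⟩
    refine contMDiffAt_clm_of_apply fun w => ?_
    refine ((contMDiffAt_mk_iff (b := fun x : M => x) x₀ hxb).1 (contMDiffAt_hom_apply (hφ x) ?_)).2
    exact contMDiffAt_symmL (b := fun x : M => x) x₀ hxa contMDiffAt_id contMDiffAt_const
  have hg₀ : g x₀ = 1 := by
    ext w
    exact LinearMap.congr_fun hr₀ w
  have hbase : a.baseSet ∩ b.baseSet ∈ 𝓝 x₀ :=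
    inter_mem (a.open_baseSet.mem_nhds ha) (b.open_baseSet.mem_nhds hb)
  have hunit : ∀ᶠ x in 𝓝 x₀, IsUnit (g x) :=
    (hg x₀ ⟨ha, hb⟩).continuousAt.eventually (Units.isOpen.mem_nhds (by rw [hg₀]; exact isUnit_one))
  refine ⟨_, inter_mem hbase hunit,
    fun x => (a.symmL ℝ x).comp (r.comp ((Ring.inverse (g x)).comp (b.continuousLinearMapAt ℝ x))),
    ?_, ?_⟩
  · rintro x ⟨⟨hxa, hxb⟩, hu⟩
    refine contMDiffAt_hom_of_apply (b := fun x : M => x) contMDiffAt_id fun s hs => ?_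
    refine contMDiffAt_symmL (b := fun x : M => x) x₀ hxa contMDiffAt_id ?_
    refine r.contDiff.contMDiff.contMDiffAt.comp x ?_
    exact (contMDiffAt_inverse (hg x ⟨hxa, hxb⟩) hu).clm_apply
      ((contMDiffAt_mk_iff (b := fun x : M => x) x₀ hxb).1 hs).2
  · rintro x ⟨⟨hxa, hxb⟩, hu⟩ y
    have h1 := congrArg (fun f => f (b.continuousLinearMapAt ℝ x y)) (Ring.mul_inverse_cancel _ hu)
    have h2 := congrArg (b.symmL ℝ x) h1
    change b.symmL ℝ x (b.continuousLinearMapAt ℝ x (φ x _)) =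
      b.symmL ℝ x (b.continuousLinearMapAt ℝ x y) at h2
    rwa [b.symmL_continuousLinearMapAt hxb, b.symmL_continuousLinearMapAt hxb] at h2

/-- A smooth surjective morphism of vector bundles has a global smooth right inverse. -/
theorem exists_rightInverse [FiniteDimensional ℝ E] [IsManifold I ∞ M] [T2Space M]
    [SigmaCompactSpace M] (φ : ∀ x, A.Fib x →L[ℝ] B.Fib x)
    (hφ : ∀ x, ContMDiffAt I (homVB A B).J ∞ (fun x => (⟨x, φ x⟩ : (homVB A B).Tot)) x)
    (hs : ∀ x, Function.Surjective (φ x)) :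
    ∃ S : ∀ x, B.Fib x →L[ℝ] A.Fib x,
      ContMDiff I (homVB B A).J ∞ (fun x => (⟨x, S x⟩ : (homVB B A).Tot)) ∧
        ∀ x y, φ x (S x y) = y := by
  -- Right inverses form an affine space, so local ones can be glued by a partition of unity.
  have hconv : ∀ x, Convex ℝ {S : B.Fib x →L[ℝ] A.Fib x | ∀ y, φ x (S y) = y} := by
    intro x S hS T hT s t _ _ hst y
    have h : φ x ((s • S + t • T) y) = s • φ x (S y) + t • φ x (T y) := by simp
    rw [h, hS, hT, ← add_smul, hst, one_smul]
  obtain ⟨S, hS⟩ := exists_contMDiffSection_forall_mem_convex_of_local (n := ⊤) I (homVB B A).Fib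
    (F_fiber := (homVB B A).F) (fun x => {S : B.Fib x →L[ℝ] A.Fib x | ∀ y, φ x (S y) = y})
    hconv
    (fun x₀ => by
      obtain ⟨U, hU, S, h1, h2⟩ := exists_local_rightInverse φ hφ x₀ (hs x₀)
      exact ⟨U, hU, S, fun x hx => (h1 x hx).contMDiffWithinAt, h2⟩)
  exact ⟨S, S.contMDiff, hS⟩

/-- Together with σ-compactness of the total space, this allows gluing right inverses over the
manifold `V.Tot` and not only over `M`. -/
instance [T2Space M] : T2Space A.Tot := by
  refine ⟨fun x y hxy => ?_⟩
  have hc : Continuous (fun x : A.Tot => x.proj) := FiberBundle.continuous_proj A.F A.Fib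
  by_cases h : x.proj = y.proj
  · have hx : x ∈ (A.triv x.proj).source := (A.triv _).mem_source.2 (A.mem_triv _)
    have hy : y ∈ (A.triv x.proj).source := (A.triv _).mem_source.2 (h ▸ A.mem_triv _)
    have hne : (A.triv x.proj x).2 ≠ (A.triv x.proj y).2 := fun h2 =>
      hxy ((A.triv x.proj).injOn hx hy (Prod.ext
        (((A.triv _).coe_fst hx).trans (h.trans ((A.triv _).coe_fst hy).symm)) h2))
    obtain ⟨u, v, hu, hv, hxu, hyv, huv⟩ := t2_separation hne
    have ho {w : Set (M × A.F)} (hw : IsOpen w) :=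
      (A.triv x.proj).continuousOn.isOpen_inter_preimage (A.triv x.proj).open_source hw
    refine ⟨_, _, ho (hu.preimage continuous_snd), ho (hv.preimage continuous_snd), ⟨hx, hxu⟩,
      ⟨hy, hyv⟩, ?_⟩
    exact Set.disjoint_left.2 fun z hz hz' => Set.disjoint_left.1 huv hz.2 hz'.2
  · obtain ⟨u, v, hu, hv, hxu, hyv, huv⟩ := t2_separation h
    exact ⟨_, _, hu.preimage hc, hv.preimage hc, hxu, hyv, huv.preimage _⟩

/-- Countably many trivialized pieces `K × A.F` with `K` compact cover the total space, and each is
σ-compact. -/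
theorem sigmaCompactSpace_tot [FiniteDimensional ℝ E] [SigmaCompactSpace M] (A : SmoothVB I M) :
    SigmaCompactSpace A.Tot := by
  have : LocallyCompactSpace M := Manifold.locallyCompact_of_finiteDimensional (M := M) I
  have : ProperSpace A.F := FiniteDimensional.proper_real A.F
  have hK : ∀ x : M, ∃ K ∈ 𝓝 x, K ⊆ (A.triv x).baseSet ∧ IsCompact K := fun x =>
    local_compact_nhds ((A.triv x).open_baseSet.mem_nhds (A.mem_triv x))
  choose K hK hKt hKc using hK
  obtain ⟨s, hs, hsK⟩ := countable_cover_nhds_of_sigmaCompact hK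
  have : Countable s := hs
  rw [← isSigmaCompact_univ_iff]
  have hcover : (Set.univ : Set A.Tot) =
      ⋃ x : s, (A.triv x).toOpenPartialHomeomorph.symm '' (K x ×ˢ Set.univ) := by
    refine (Set.eq_univ_of_forall fun p => ?_).symm
    have hp : p.proj ∈ ⋃ x ∈ s, K x := by rw [hsK]; trivial
    simp only [Set.mem_iUnion] at hp ⊢
    obtain ⟨x, hx, hpx⟩ := hp
    have hps : p ∈ (A.triv x).source := (A.triv x).mem_source.2 (hKt x hpx)
    refine ⟨⟨x, hx⟩, A.triv x p, ⟨?_, trivial⟩, (A.triv x).left_inv hps⟩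
    rw [(A.triv x).coe_fst hps]
    exact hpx
  rw [hcover]
  refine isSigmaCompact_iUnion _ fun x => ?_
  have hKF : IsSigmaCompact (K x ×ˢ (Set.univ : Set A.F)) := by
    rw [← iUnion_compactCovering A.F, Set.prod_iUnion]
    exact isSigmaCompact_iUnion_of_isCompact _ fun k => (hKc x).prod (isCompact_compactCovering _ k)
  refine hKF.image_of_continuousOn ((A.triv x).continuousOn_invFun.mono ?_)
  rintro ⟨y, w⟩ ⟨hy, -⟩
  exact (A.triv x).mem_target.2 (hKt x hy)

end SmoothVB
end BundleGeneralities

/-! ### The algebra of double vector bundles in terms of their fibres. -/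

section DoubleAlgebra

variable {E H : Type*} [NormedAddCommGroup E] [NormedSpace ℝ E] [TopologicalSpace H]
  {I : ModelWithCorners ℝ E H} {M : Type u} [TopologicalSpace M] [ChartedSpace H M]

namespace SmoothVB

variable (A : SmoothVB I M)

/-- A point of the total space over `y`, as an element of the fibre over `y`. -/
def fibAt {y : M} (t : A.Tot) (h : t.proj = y) : A.Fib y := h ▸ t.2

@[simp]
theorem mk_fibAt {y : M} (t : A.Tot) (h : t.proj = y) : (⟨y, A.fibAt t h⟩ : A.Tot) = t := by
  subst h; rfl

variable {A}

theorem mk_inj {y : M} {a b : A.Fib y} : (⟨y, a⟩ : A.Tot) = ⟨y, b⟩ ↔ a = b :=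
  TotalSpace.mk_inj

theorem isSum_mk {y : M} {a b c : A.Fib y} :
    A.IsSum ⟨y, a⟩ ⟨y, b⟩ ⟨y, c⟩ ↔ a + b = c := by
  constructor
  · rintro ⟨p, a', b', h1, h2, h3⟩
    obtain rfl : y = p := congrArg TotalSpace.proj h1
    rw [mk_inj] at h1 h2 h3
    rw [h1, h2, h3]
  · rintro rfl
    exact ⟨y, a, b, rfl, rfl, rfl⟩

theorem IsSum.proj_left {x y z : A.Tot} (h : A.IsSum x y z) : x.proj = z.proj := by
  obtain ⟨p, a, b, rfl, rfl, rfl⟩ := h; rfl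

theorem IsSum.proj_eq {x y z : A.Tot} (h : A.IsSum x y z) : x.proj = y.proj := by
  obtain ⟨p, a, b, rfl, rfl, rfl⟩ := h; rfl

theorem IsSum.unique {x y z z' : A.Tot} (h : A.IsSum x y z) (h' : A.IsSum x y z') : z = z' := by
  obtain ⟨p, a, b, rfl, rfl, rfl⟩ := h
  obtain ⟨p', a', b', h1, h2, rfl⟩ := h'
  obtain rfl : p = p' := congrArg TotalSpace.proj h1
  rw [mk_inj] at h1 h2
  rw [h1, h2]

theorem exists_isSum {x y : A.Tot} (h : x.proj = y.proj) : ∃ z, A.IsSum x y z :=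
  ⟨⟨y.proj, A.fibAt x h + y.2⟩, y.proj, A.fibAt x h, y.2, (A.mk_fibAt x h).symm, rfl, rfl⟩

theorem continuous_mk (y : M) : Continuous (fun a : A.Fib y => (⟨y, a⟩ : A.Tot)) :=
  FiberBundle.continuous_totalSpaceMk A.F A.Fib y

theorem continuous_fibAt {X : Type*} [TopologicalSpace X] {y : M} {f : X → A.Tot}
    (hf : Continuous f) (h : ∀ x, (f x).proj = y) : Continuous (fun x => A.fibAt (f x) (h x)) := by
  rw [(FiberBundle.totalSpaceMk_isInducing A.F A.Fib y).continuous_iff]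
  exact hf.congr fun x => (A.mk_fibAt (f x) (h x)).symm

end SmoothVB

namespace DoubleVB

variable {V A : SmoothVB I M} (D : DoubleVB V A)

/-- The double vector bundle with the two side bundles interchanged. -/
def flip : DoubleVB A V where
  overV := D.overA
  overA := D.overV
  e := D.e.symm
  comm d := by simpa using (D.comm (D.e.symm d)).symm
  proj_linear := D.cover
  cover := D.proj_linear
  interchange x₁ y₁ z₁ x₂ y₂ z₂ x₃ y₃ z₃ h₁ h₂ h₃ h₄ h₅ := by
    have hz : (D.e.symm z₁).proj = (D.e.symm z₂).proj :=
      SmoothVB.IsSum.unique (D.proj_linear.add _ _ _ h₁)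
        (h₄.proj_eq ▸ h₅.proj_eq ▸ D.proj_linear.add _ _ _ h₂)
    -- The original law exhibits `w = z₁ +_V z₂` as the sum over `A` of `x₃` and `y₃`. Sums are
    -- unique, so `w` is `z₃`.
    obtain ⟨w, hw⟩ := SmoothVB.exists_isSum hz
    have h := D.interchange _ _ _ _ _ _ _ _ _ h₄ h₅ hw (by simpa using h₁) (by simpa using h₂)
    have h' := h.unique (by simpa using h₃)
    have h'' : w = D.e.symm z₃ := by rw [← h', Diffeomorph.symm_apply_apply]
    exact h'' ▸ hw
  add_scale t x y z h := D.scale_linear t |>.add x y z h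
  scale_linear t := by
    refine ⟨fun x y z h => D.add_scale t x y z h, fun s x => ?_⟩
    have h := (D.scale_linear s).smul t (D.e x)
    have h' := congrArg D.e.symm h
    simp only [Diffeomorph.symm_apply_apply] at h'
    exact h'.symm

/-- The projection `D → A`, as a linear map on the fibres of `D → V`. -/
def qA (p : V.Tot) : D.overV.Fib p →ₗ[ℝ] A.Fib p.proj where
  toFun x := A.fibAt (D.e ⟨p, x⟩).proj (D.comm _)
  map_add' x y := by
    have h := D.cover.add _ _ _ (SmoothVB.isSum_mk (a := x) (b := y).2 rfl)
    rw [← A.mk_fibAt (D.e ⟨p, x⟩).proj (D.comm _), ← A.mk_fibAt (D.e ⟨p, y⟩).proj (D.comm _),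
      ← A.mk_fibAt (D.e ⟨p, x + y⟩).proj (D.comm _)] at h
    exact (SmoothVB.isSum_mk.1 h).symm
  map_smul' t x := by
    have h := D.cover.smul t ⟨p, x⟩
    rw [← A.mk_fibAt (D.e ⟨p, x⟩).proj (D.comm _),
      ← A.mk_fibAt (D.e (D.overV.scale t ⟨p, x⟩)).proj (D.comm _)] at h
    exact SmoothVB.mk_inj.1 h

theorem projA_mk (p : V.Tot) (x : D.overV.Fib p) : D.projA ⟨p, x⟩ = ⟨p.proj, D.qA p x⟩ :=
  (A.mk_fibAt _ _).symm

/-- The projection `D → V`, as a linear map on the fibres of `D → A`. -/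
def qV (a : A.Tot) : D.overA.Fib a →ₗ[ℝ] V.Fib a.proj := D.flip.qA a

theorem proj_mk (a : A.Tot) (y : D.overA.Fib a) : (D.e.symm ⟨a, y⟩).proj = ⟨a.proj, D.qV a y⟩ :=
  D.flip.projA_mk a y

/-- A point of `D` over `v ∈ V_m` and `a ∈ A_m`, as an element of the fibre over `a`. -/
def toA {m : M} {v : V.Fib m} (x : D.overV.Fib ⟨m, v⟩) (a : A.Fib m) (h : D.qA ⟨m, v⟩ x = a) :
    D.overA.Fib ⟨m, a⟩ :=
  D.overA.fibAt (D.e ⟨⟨m, v⟩, x⟩) (by subst h; exact D.projA_mk _ x)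

/-- A point of `D` over `v ∈ V_m` and `a ∈ A_m`, as an element of the fibre over `v`. -/
def toV {m : M} {a : A.Fib m} (y : D.overA.Fib ⟨m, a⟩) (v : V.Fib m) (h : D.qV ⟨m, a⟩ y = v) :
    D.overV.Fib ⟨m, v⟩ :=
  D.overV.fibAt (D.e.symm ⟨⟨m, a⟩, y⟩) (by subst h; exact D.proj_mk _ y)

variable {m : M} {v v' v'' : V.Fib m} {a a' : A.Fib m}

@[simp]
theorem mk_toA {x : D.overV.Fib ⟨m, v⟩} (h : D.qA ⟨m, v⟩ x = a) :
    (⟨⟨m, a⟩, D.toA x a h⟩ : D.overA.Tot) = D.e ⟨⟨m, v⟩, x⟩ :=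
  SmoothVB.mk_fibAt _ _ _

@[simp]
theorem mk_toV {y : D.overA.Fib ⟨m, a⟩} (h : D.qV ⟨m, a⟩ y = v) :
    (⟨⟨m, v⟩, D.toV y v h⟩ : D.overV.Tot) = D.e.symm ⟨⟨m, a⟩, y⟩ :=
  SmoothVB.mk_fibAt _ _ _

theorem qV_toA {x : D.overV.Fib ⟨m, v⟩} (h : D.qA ⟨m, v⟩ x = a) :
    D.qV ⟨m, a⟩ (D.toA x a h) = v := by
  have := D.proj_mk ⟨m, a⟩ (D.toA x a h)
  rw [mk_toA, Diffeomorph.symm_apply_apply] at this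
  exact (SmoothVB.mk_inj.1 this).symm

theorem qA_toV {y : D.overA.Fib ⟨m, a⟩} (h : D.qV ⟨m, a⟩ y = v) :
    D.qA ⟨m, v⟩ (D.toV y v h) = a := by
  have := D.projA_mk ⟨m, v⟩ (D.toV y v h)
  rw [mk_toV, projA, Diffeomorph.apply_symm_apply] at this
  exact (SmoothVB.mk_inj.1 this).symm

@[simp]
theorem toA_toV {y : D.overA.Fib ⟨m, a⟩} (h : D.qV ⟨m, a⟩ y = v) :
    D.toA (D.toV y v h) a (D.qA_toV h) = y := by
  rw [← SmoothVB.mk_inj, mk_toA, mk_toV, Diffeomorph.apply_symm_apply]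

/-- The interchange law, for elements of the fibres. -/
theorem toA_add {x x' : D.overV.Fib ⟨m, v⟩} {y y' : D.overV.Fib ⟨m, v'⟩}
    {z z' : D.overV.Fib ⟨m, v''⟩} (hx : D.qA _ x = a) (hy : D.qA _ y = a) (hz : D.qA _ z = a)
    (hx' : D.qA _ x' = a') (hy' : D.qA _ y' = a') (hz' : D.qA _ z' = a')
    (h : D.toA x a hx + D.toA y a hy = D.toA z a hz)
    (h' : D.toA x' a' hx' + D.toA y' a' hy' = D.toA z' a' hz') {c : A.Fib m}
    (h₁ : D.qA _ (x + x') = c) (h₂ : D.qA _ (y + y') = c) (h₃ : D.qA _ (z + z') = c) :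
    D.toA (x + x') c h₁ + D.toA (y + y') c h₂ = D.toA (z + z') c h₃ := by
  rw [← SmoothVB.isSum_mk] at h h' ⊢
  simp only [mk_toA] at h h' ⊢
  exact D.interchange _ _ _ _ _ _ _ _ _ (SmoothVB.isSum_mk.2 rfl) (SmoothVB.isSum_mk.2 rfl)
    (SmoothVB.isSum_mk.2 rfl) h h'

/-- With `toA_smul_smul`, this says that multiplication by `t` in `D → V` is linear from `D_a` to
`D_{ta}`. With `toA_add` and `toA_add_smul`, these laws are the algebra behind all linearity
statements below. -/
theorem toA_smul_add (t : ℝ) {x : D.overV.Fib ⟨m, v⟩} {y : D.overV.Fib ⟨m, v'⟩}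
    {z : D.overV.Fib ⟨m, v''⟩} (hx : D.qA _ x = a) (hy : D.qA _ y = a) (hz : D.qA _ z = a)
    (h : D.toA x a hx + D.toA y a hy = D.toA z a hz) {c : A.Fib m}
    (h₁ : D.qA _ (t • x) = c) (h₂ : D.qA _ (t • y) = c) (h₃ : D.qA _ (t • z) = c) :
    D.toA (t • x) c h₁ + D.toA (t • y) c h₂ = D.toA (t • z) c h₃ := by
  rw [← SmoothVB.isSum_mk] at h ⊢
  simp only [mk_toA] at h ⊢
  have h1 := (D.scale_linear t).add _ _ _ h
  simp only [Diffeomorph.symm_apply_apply] at h1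
  exact h1

theorem smul_toA_iff (s : ℝ) {x : D.overV.Fib ⟨m, v⟩} {y : D.overV.Fib ⟨m, v'⟩}
    (hx : D.qA _ x = a) (hy : D.qA _ y = a) : s • D.toA x a hx = D.toA y a hy ↔
      D.scaleA s ⟨⟨m, v⟩, x⟩ = ⟨⟨m, v'⟩, y⟩ := by
  rw [← SmoothVB.mk_inj, mk_toA, scaleA, ← D.mk_toA hx]
  constructor
  · intro h
    exact (congrArg D.e.symm h).trans (D.e.symm_apply_apply _)
  · intro h
    exact (D.e.apply_symm_apply _).symm.trans (congrArg D.e h)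

theorem toA_smul_smul (s t : ℝ) {x : D.overV.Fib ⟨m, v⟩} {y : D.overV.Fib ⟨m, v'⟩}
    (hx : D.qA _ x = a) (hy : D.qA _ y = a) (h : s • D.toA x a hx = D.toA y a hy) {c : A.Fib m}
    (h₁ : D.qA _ (t • x) = c) (h₂ : D.qA _ (t • y) = c) :
    s • D.toA (t • x) c h₁ = D.toA (t • y) c h₂ := by
  rw [smul_toA_iff] at h ⊢
  have h1 := congrArg D.e.symm ((D.scale_linear t).smul s (D.e ⟨⟨m, v⟩, x⟩))
  simp only [Diffeomorph.symm_apply_apply] at h1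
  refine h1.symm.trans ?_
  rw [scaleA] at h
  rw [h]; rfl

theorem toA_add_smul (s : ℝ) {x x' : D.overV.Fib ⟨m, v⟩} {y y' : D.overV.Fib ⟨m, v'⟩}
    (hx : D.qA _ x = a) (hy : D.qA _ y = a) (hx' : D.qA _ x' = a') (hy' : D.qA _ y' = a')
    (h : s • D.toA x a hx = D.toA y a hy) (h' : s • D.toA x' a' hx' = D.toA y' a' hy')
    {c : A.Fib m} (h₁ : D.qA _ (x + x') = c) (h₂ : D.qA _ (y + y') = c) :
    s • D.toA (x + x') c h₁ = D.toA (y + y') c h₂ := by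
  rw [smul_toA_iff] at h h' ⊢
  have h1 := D.add_scale s _ _ _ (SmoothVB.isSum_mk (a := x) (b := x').2 rfl)
  rw [scaleA] at h h' ⊢
  rw [h, h'] at h1
  exact h1.unique (SmoothVB.isSum_mk.2 rfl)

end DoubleVB

end DoubleAlgebra

/-! ### The core, and linear maps from a fibre of `V` to `D`. -/

section DoubleCore

variable {E H : Type*} [NormedAddCommGroup E] [NormedSpace ℝ E] [TopologicalSpace H]
  {I : ModelWithCorners ℝ E H} {M : Type u} [TopologicalSpace M] [ChartedSpace H M]

namespace DoubleVB

variable {V A : SmoothVB I M} (D : DoubleVB V A) {m : M}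

theorem toA_inj {v : V.Fib m} {a : A.Fib m} {x y : D.overV.Fib ⟨m, v⟩}
    (hx : D.qA ⟨m, v⟩ x = a) (hy : D.qA ⟨m, v⟩ y = a) : D.toA x a hx = D.toA y a hy ↔ x = y := by
  rw [← SmoothVB.mk_inj, mk_toA, mk_toA]
  exact ⟨fun h => SmoothVB.mk_inj.1 (D.e.injective h), fun h => by rw [h]⟩

theorem qA_zero (v : V.Fib m) : D.qA ⟨m, v⟩ 0 = 0 := map_zero _

/-- The zero vectors of `D → V` lie in the fibre of `D → A` over zero, and depend linearly on the
base point. -/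
def zV (m : M) : V.Fib m →ₗ[ℝ] D.overA.Fib ⟨m, 0⟩ where
  toFun v := D.toA (0 : D.overV.Fib ⟨m, v⟩) 0 (D.qA_zero v)
  map_add' v w := by
    have hq : D.qV ⟨m, 0⟩ (D.toA (0 : D.overV.Fib ⟨m, v⟩) 0 (D.qA_zero v) +
        D.toA (0 : D.overV.Fib ⟨m, w⟩) 0 (D.qA_zero w)) = v + w := by
      rw [map_add, qV_toA, qV_toA]
    -- A zero vector of `D → V` is `0` times any point of its fibre. Multiplying the sum of `0_v`
    -- and `0_w` over `A` by `0` therefore gives `0_{v+w}` on one side and leaves the sum unchanged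
    -- on the other.
    have h := D.toA_smul_add 0 (D.qA_zero v) (D.qA_zero w) (D.qA_toV hq) (D.toA_toV hq).symm
      (c := 0) (by simp) (by simp) (by simp)
    simp only [zero_smul] at h
    exact h.symm
  map_smul' s v := by
    have hq : D.qV ⟨m, 0⟩ (s • D.toA (0 : D.overV.Fib ⟨m, v⟩) 0 (D.qA_zero v)) = s • v := by
      rw [map_smul, qV_toA]
    have h := D.toA_smul_smul s 0 (D.qA_zero v) (D.qA_toV hq) (D.toA_toV hq).symm (c := 0)
      (by simp) (by simp)
    simp only [zero_smul] at h
    exact h.symm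

theorem toA_zero (v : V.Fib m) : D.toA 0 0 (D.qA_zero v) = D.zV m v := rfl

@[simp]
theorem qV_zV (v : V.Fib m) : D.qV ⟨m, 0⟩ (D.zV m v) = v := D.qV_toA (D.qA_zero v)

/-- The zero vectors of `D → A`. -/
def zA (m : M) : A.Fib m →ₗ[ℝ] D.overV.Fib ⟨m, 0⟩ := D.flip.zV m

theorem qA_zA (a : A.Fib m) : D.qA ⟨m, 0⟩ (D.zA m a) = a := D.flip.qV_zV a

theorem mk_zA (a : A.Fib m) :
    (⟨⟨m, 0⟩, D.zA m a⟩ : D.overV.Tot) = D.e.symm ⟨⟨m, a⟩, 0⟩ :=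
  D.flip.mk_toA (a := 0) (m := m) (v := a) (x := 0) (map_zero _)

/-- The core fibre over `m`, as a subspace of the fibre of `D → V` over `0_m`. -/
abbrev coreSub (m : M) : Submodule ℝ (D.overV.Fib (⟨m, 0⟩ : V.Tot)) := LinearMap.ker (D.qA ⟨m, 0⟩)

theorem isCorePoint_iff (x : D.overV.Fib (V.zeroAt m)) :
    D.IsCorePoint m ⟨V.zeroAt m, x⟩ ↔ x ∈ D.coreSub m := by
  have h : D.projA ⟨V.zeroAt m, x⟩ = ⟨m, D.qA ⟨m, 0⟩ x⟩ := D.projA_mk (V.zeroAt m) x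
  exact ⟨fun h' => SmoothVB.mk_inj.1 (h.symm.trans h'.2),
    fun h' => ⟨rfl, h.trans (SmoothVB.mk_inj.2 h')⟩⟩

theorem qA_core (c : D.coreSub m) : D.qA ⟨m, 0⟩ c.1 = 0 := c.2

/-- The core points in the fibre of `D → A` over zero. -/
def coreA (m : M) : D.coreSub m →ₗ[ℝ] D.overA.Fib ⟨m, 0⟩ :=
  let f : D.coreSub m →+ D.overA.Fib ⟨m, 0⟩ := AddMonoidHom.mk'
    (fun c => D.toA c.1 0 (D.qA_core c)) fun c c' => by
      have h0 : D.toA (0 : D.overV.Fib ⟨m, 0⟩) 0 (D.qA_zero 0) = 0 := by rw [toA_zero, map_zero]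
      -- The Eckmann–Hilton argument: interchange for `c +_A 0` and `0 +_A c'` identifies the two
      -- additions on the core.
      have h := D.toA_add (D.qA_core c) (D.qA_zero 0) (D.qA_core c) (D.qA_zero 0) (D.qA_core c')
        (D.qA_core c') (by rw [h0, add_zero]) (by rw [h0, zero_add])
        (c := 0) (by simp [D.qA_core c]) (by simp [D.qA_core c'])
        (by simp [D.qA_core c, D.qA_core c'])
      simp only [zero_add, add_zero] at h
      exact h.symm
  -- A continuous additive map is real linear; hence the two scalar multiplications agree on the
  -- core as well.
  (f.toRealLinearMap (SmoothVB.continuous_fibAt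
    (f := fun c : D.coreSub m => D.e ⟨⟨m, 0⟩, c.1⟩)
    (D.e.continuous.comp ((SmoothVB.continuous_mk _).comp continuous_subtype_val)) _)).toLinearMap

theorem coreA_apply (c : D.coreSub m) : D.coreA m c = D.toA c.1 0 (D.qA_core c) := rfl

theorem qV_coreA (c : D.coreSub m) : D.qV ⟨m, 0⟩ (D.coreA m c) = 0 := D.qV_toA (D.qA_core c)

/-- The core in terms of the fibres of `D → A`. -/
def coreEquiv (m : M) : D.coreSub m ≃ₗ[ℝ] LinearMap.ker (D.qV (⟨m, 0⟩ : A.Tot)) :=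
  LinearEquiv.ofBijective ((D.coreA m).codRestrict _ fun c => D.qV_coreA c) <| by
    constructor
    · intro c c' h
      exact Subtype.ext ((D.toA_inj (D.qA_core c) (D.qA_core c')).1 (congrArg Subtype.val h))
    · rintro ⟨y, hy⟩
      exact ⟨⟨D.toV y 0 hy, D.qA_toV hy⟩, Subtype.ext (D.toA_toV hy)⟩

theorem qV_zV_add_coreA (v : V.Fib m) (c : D.coreSub m) :
    D.qV ⟨m, 0⟩ (D.zV m v + D.coreA m c) = v := by
  rw [map_add, qV_zV, qV_coreA, add_zero]

/-- The map `c ↦ 0_v +_A c`. -/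
def coreIncl {m : M} (v : V.Fib m) : D.coreSub m →ₗ[ℝ] D.overV.Fib ⟨m, v⟩ where
  toFun c := D.toV (D.zV m v + D.coreA m c) v (D.qV_zV_add_coreA v c)
  map_add' c c' := by
    have hs : ∀ c, D.toA (0 : D.overV.Fib ⟨m, v⟩) 0 (D.qA_zero v) + D.toA c.1 0 (D.qA_core c) =
        D.toA (D.toV _ v (D.qV_zV_add_coreA v c)) 0 (D.qA_toV _) := fun c =>
      (D.toA_toV (D.qV_zV_add_coreA v c)).symm
    have h₁ : D.qA ⟨m, 0⟩ (c.1 + c'.1) = 0 := D.qA_core (c + c')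
    have h₂ : D.qA ⟨m, v⟩ (D.toV _ v (D.qV_zV_add_coreA v c) +
        D.toV _ v (D.qV_zV_add_coreA v c')) = 0 := by
      rw [map_add, D.qA_toV (D.qV_zV_add_coreA v c), D.qA_toV (D.qV_zV_add_coreA v c'), add_zero]
    -- Interchange for `0_v +_A c` and `0_v +_A c'`, where `0_v +_V 0_v = 0_v`.
    have h := D.toA_add _ _ _ _ _ _ (hs c) (hs c') (c := 0) (by simp) h₁ h₂
    rw [← D.toA_inj (D.qA_toV (D.qV_zV_add_coreA v (c + c'))) h₂, ← h, ← hs]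
    simp only [add_zero]
    rfl
  map_smul' t c := by
    have hs := (D.toA_toV (D.qV_zV_add_coreA v c)).symm
    have h₁ : D.qA ⟨m, 0⟩ (t • c.1) = 0 := D.qA_core (t • c)
    have h₂ : D.qA ⟨m, v⟩ (t • D.toV _ v (D.qV_zV_add_coreA v c)) = 0 := by
      rw [map_smul, D.qA_toV (D.qV_zV_add_coreA v c), smul_zero]
    have h := D.toA_smul_add t (D.qA_zero v) (D.qA_core c) _ hs (c := 0) (by simp) h₁ h₂
    refine (D.toA_inj (D.qA_toV (D.qV_zV_add_coreA v (t • c))) h₂).1 ?_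
    rw [← h, toA_toV]
    simp only [smul_zero]
    rfl

theorem qA_coreIncl (v : V.Fib m) (c : D.coreSub m) : D.qA ⟨m, v⟩ (D.coreIncl v c) = 0 :=
  D.qA_toV (D.qV_zV_add_coreA v c)

theorem toA_coreIncl (v : V.Fib m) (c : D.coreSub m) :
    D.toA (D.coreIncl v c) 0 (D.qA_coreIncl v c) = D.zV m v + D.coreA m c :=
  D.toA_toV (D.qV_zV_add_coreA v c)

theorem coreIncl_injective (v : V.Fib m) : Function.Injective (D.coreIncl v) := by
  intro c c' h
  have h1 : D.zV m v + D.coreA m c = D.zV m v + D.coreA m c' := by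
    rw [← toA_coreIncl, ← toA_coreIncl]; simp only [h]
  exact Subtype.ext ((D.toA_inj (D.qA_core c) (D.qA_core c')).1 (add_left_cancel h1))

theorem isSumA_coreIncl (v : V.Fib m) (c : D.coreSub m) :
    D.IsSumA (D.overV.zeroAt ⟨m, v⟩) ⟨⟨m, 0⟩, c.1⟩ ⟨⟨m, v⟩, D.coreIncl v c⟩ := by
  have h := SmoothVB.isSum_mk.2 (D.toA_coreIncl v c).symm
  rw [coreA_apply, ← D.toA_zero v] at h
  have h1 := D.mk_toA (D.qA_zero v)
  have h2 := D.mk_toA (D.qA_core c)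
  rw [h1, h2, D.mk_toA (D.qA_coreIncl v c)] at h
  exact h

/-- The linear maps `V_m → D` over `a`, given by a linear map to the fibre of `D → A` over `a`. -/
def IsLinearAtOver (a : A.Fib m) (φ : ∀ v : V.Fib m, D.overV.Fib ⟨m, v⟩) : Prop :=
  ∃ f : V.Fib m →ₗ[ℝ] D.overA.Fib ⟨m, a⟩,
    ∀ v, (⟨⟨m, a⟩, f v⟩ : D.overA.Tot) = D.e ⟨⟨m, v⟩, φ v⟩

variable {D}

theorem IsLinearAtOver.qA_eq {a : A.Fib m} {φ : ∀ v : V.Fib m, D.overV.Fib ⟨m, v⟩}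
    (h : D.IsLinearAtOver a φ) (v : V.Fib m) : D.qA ⟨m, v⟩ (φ v) = a := by
  obtain ⟨f, hf⟩ := h
  have h1 := D.projA_mk ⟨m, v⟩ (φ v)
  rw [projA, ← hf] at h1
  exact (SmoothVB.mk_inj.1 h1).symm

/-- Rephrases the existence of a linear map into `D_a` as identities between `toA`s, the form to
which the interchange laws apply. -/
theorem isLinearAtOver_iff {a : A.Fib m} {φ : ∀ v : V.Fib m, D.overV.Fib ⟨m, v⟩} :
    D.IsLinearAtOver a φ ↔ ∃ h : ∀ v, D.qA ⟨m, v⟩ (φ v) = a,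
      (∀ v w, D.toA (φ v) a (h v) + D.toA (φ w) a (h w) = D.toA (φ (v + w)) a (h _)) ∧
      ∀ (t : ℝ) v, t • D.toA (φ v) a (h v) = D.toA (φ (t • v)) a (h _) := by
  constructor
  · intro hφ
    have hq := hφ.qA_eq
    obtain ⟨f, hf⟩ := hφ
    have hf' : ∀ v, D.toA (φ v) a (hq v) = f v := fun v => by
      rw [← SmoothVB.mk_inj, mk_toA, hf]
    exact ⟨hq, fun v w => by simp [hf'], fun t v => by simp [hf']⟩
  · rintro ⟨hq, h1, h2⟩
    exact ⟨⟨⟨fun v => D.toA (φ v) a (hq v), fun v w => (h1 v w).symm⟩, fun t v => (h2 t v).symm⟩,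
      fun v => D.mk_toA (hq v)⟩

theorem isLinearAt_iff {φ : ∀ v : V.Fib m, D.overV.Fib ⟨m, v⟩} :
    D.IsLinearAt m φ ↔ ∃ a, D.IsLinearAtOver a φ := by
  simp only [isLinearAtOver_iff]
  constructor
  · rintro ⟨⟨a, ha⟩, h1, h2⟩
    have hq : ∀ v, D.qA ⟨m, v⟩ (φ v) = a := fun v => by
      have h := ha v
      rw [projA_mk] at h
      exact SmoothVB.mk_inj.1 h
    refine ⟨a, hq, fun v w => ?_, fun t v => ?_⟩
    · rw [← SmoothVB.isSum_mk, mk_toA, mk_toA, mk_toA]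
      exact h1 v w
    · rw [smul_toA_iff]
      exact (h2 t v).symm
  · rintro ⟨a, hq, h1, h2⟩
    refine ⟨⟨a, fun v => by rw [projA_mk, hq]⟩, fun v w => ?_, fun t v => ?_⟩
    · have h := h1 v w
      rw [← SmoothVB.isSum_mk, mk_toA, mk_toA, mk_toA] at h
      exact h
    · have h := h2 t v
      rw [smul_toA_iff] at h
      exact h.symm

/-- This is the interchange law. With `IsLinearAtOver.smul` it makes the linear maps `V_m → D` a
vector space under the pointwise operations of `D → V`. -/
theorem IsLinearAtOver.add {a a' : A.Fib m} {φ φ' : ∀ v : V.Fib m, D.overV.Fib ⟨m, v⟩}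
    (h : D.IsLinearAtOver a φ) (h' : D.IsLinearAtOver a' φ') :
    D.IsLinearAtOver (a + a') (φ + φ') := by
  rw [isLinearAtOver_iff] at *
  obtain ⟨hq, h1, h2⟩ := h
  obtain ⟨hq', h1', h2'⟩ := h'
  exact ⟨fun v => by rw [Pi.add_apply, map_add, hq, hq'],
    fun v w => D.toA_add _ _ _ _ _ _ (h1 v w) (h1' v w) _ _ _,
    fun t v => D.toA_add_smul t _ _ _ _ (h2 t v) (h2' t v) _ _⟩

theorem IsLinearAtOver.smul (t : ℝ) {a : A.Fib m} {φ : ∀ v : V.Fib m, D.overV.Fib ⟨m, v⟩}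
    (h : D.IsLinearAtOver a φ) : D.IsLinearAtOver (t • a) (t • φ) := by
  rw [isLinearAtOver_iff] at *
  obtain ⟨hq, h1, h2⟩ := h
  exact ⟨fun v => by rw [Pi.smul_apply, map_smul, hq],
    fun v w => D.toA_smul_add t _ _ _ (h1 v w) _ _ _,
    fun s v => D.toA_smul_smul s t _ _ (h2 s v) _ _⟩

theorem isLinearAtOver_coreIncl (ψ : V.Fib m →ₗ[ℝ] D.coreSub m) :
    D.IsLinearAtOver 0 (fun v => D.coreIncl v (ψ v)) :=
  ⟨D.zV m + (D.coreA m).comp ψ, fun v => by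
    rw [← D.mk_toA (D.qA_coreIncl v (ψ v)), toA_coreIncl]; rfl⟩

/-- Both `φ` and the zero section `v ↦ 0_v` are linear maps into the fibre of `D → A` over zero
which lift the identity of `V_m`. Their difference takes values in the kernel of `D → V` there,
which is the core by `coreEquiv`. This identifies the kernel of `Â → A`. -/
theorem IsLinearAtOver.exists_eq_coreIncl {φ : ∀ v : V.Fib m, D.overV.Fib ⟨m, v⟩}
    (h : D.IsLinearAtOver 0 φ) :
    ∃ ψ : V.Fib m →ₗ[ℝ] D.coreSub m, ∀ v, φ v = D.coreIncl v (ψ v) := by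
  have hq := h.qA_eq
  obtain ⟨f, hf⟩ := h
  have hf' : ∀ v, D.toA (φ v) 0 (hq v) = f v := fun v => by
    rw [← SmoothVB.mk_inj, mk_toA, hf]
  refine ⟨(D.coreEquiv m).symm.toLinearMap.comp ((f - D.zV m).codRestrict _ fun v => ?_),
    fun v => (D.toA_inj (hq v) (D.qA_coreIncl v _)).1 ?_⟩
  · rw [LinearMap.mem_ker, LinearMap.sub_apply, map_sub, qV_zV, ← hf', qV_toA, sub_self]
  · rw [toA_coreIncl, hf']
    have h1 : ∀ c, D.coreA m c = D.coreEquiv m c := fun c => rfl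
    rw [h1]
    simp

end DoubleVB

end DoubleCore

/-! ### The image of a constant-rank family of projections as a vector bundle. -/

section ImageBundle

variable {E H : Type*} [NormedAddCommGroup E] [NormedSpace ℝ E] [TopologicalSpace H]
  {I : ModelWithCorners ℝ E H} {M : Type u} [TopologicalSpace M] [ChartedSpace H M]

/-- A smooth family of projections of constant rank on the fibres of a vector bundle. -/
structure ProjFamily (B : SmoothVB I M) where
  /-- the projections -/
  P : ∀ x, B.Fib x →L[ℝ] B.Fib x
  idem : ∀ x y, P x (P x y) = P x y
  smooth : ∀ x, ContMDiffAt I (homVB B B).J ∞ (fun x => (⟨x, P x⟩ : (homVB B B).Tot)) x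
  /-- the rank -/
  rank : ℕ
  finrank_range : ∀ x, Module.finrank ℝ (LinearMap.range (P x : B.Fib x →ₗ[ℝ] B.Fib x)) = rank

namespace ProjFamily

variable {B : SmoothVB I M} (Q : ProjFamily B)

/-- The model fibre of the image bundle. -/
abbrev Model : Type u := ULift.{u} (Fin Q.rank) → ℝ

/-- The image of the projection at `i`. -/
abbrev img (i : M) : Submodule ℝ (B.Fib i) := LinearMap.range (Q.P i : B.Fib i →ₗ[ℝ] B.Fib i)

theorem apply_of_mem {x : M} {y : B.Fib x} (hy : y ∈ Q.img x) : Q.P x y = y := by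
  obtain ⟨z, rfl⟩ := hy
  exact Q.idem x z

/-- A linear parametrization of the image at `i`. -/
def param (i : M) : Q.Model ≃ₗ[ℝ] Q.img i :=
  LinearEquiv.ofFinrankEq _ _ (by rw [Q.finrank_range]; simp)

/-- The parametrization of the image at `i`, extended to a neighbourhood. -/
def frame (i m : M) : Q.Model →L[ℝ] B.Fib m :=
  (Q.P m).comp (((B.triv i).symmL ℝ m).comp (((B.triv i).continuousLinearMapAt ℝ i).comp
    (LinearMap.toContinuousLinearMap ((Q.img i).subtype.comp (Q.param i).toLinearMap))))

/-- A left inverse of the parametrization of the image at `i`, extended to a neighbourhood. -/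
def coframe (i m : M) : B.Fib m →L[ℝ] Q.Model :=
  (LinearMap.toContinuousLinearMap ((Q.param i).symm.toLinearMap.comp
    (Q.P i : B.Fib i →ₗ[ℝ] B.Fib i).rangeRestrict)).comp
      (((B.triv i).symmL ℝ i).comp ((B.triv i).continuousLinearMapAt ℝ m))

/-- The coordinates of one frame with respect to another. -/
def gram (i j m : M) : Q.Model →L[ℝ] Q.Model := (Q.coframe j m).comp (Q.frame i m)

/-- At the centre `i` the passage through the trivialization is the identity, so the coframe inverts
the frame. Invertibility then persists nearby, which defines `base`. -/
theorem gram_self (i : M) : Q.gram i i i = 1 := by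
  ext1 w
  have h1 : Q.frame i i w = (Q.param i w : B.Fib i) := by
    change Q.P i ((B.triv i).symmL ℝ i ((B.triv i).continuousLinearMapAt ℝ i _)) = _
    rw [(B.triv i).symmL_continuousLinearMapAt (B.mem_triv i)]
    exact Q.apply_of_mem (Q.param i w).2
  change Q.coframe i i (Q.frame i i w) = w
  rw [h1]
  change (Q.param i).symm ((Q.P i : B.Fib i →ₗ[ℝ] B.Fib i).rangeRestrict
    ((B.triv i).symmL ℝ i ((B.triv i).continuousLinearMapAt ℝ i _))) = w
  rw [(B.triv i).symmL_continuousLinearMapAt (B.mem_triv i), LinearEquiv.symm_apply_eq]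
  exact Subtype.ext (Q.apply_of_mem (Q.param i w).2)

section Smooth

variable {E' H' : Type*} [NormedAddCommGroup E'] [NormedSpace ℝ E'] [TopologicalSpace H']
  {I' : ModelWithCorners ℝ E' H'} {N : Type*} [TopologicalSpace N] [ChartedSpace H' N]
  {b : N → M} {x₀ : N}

theorem contMDiffAt_frame (i : M) (hi : b x₀ ∈ (B.triv i).baseSet) {y : N → Q.Model}
    (hb : ContMDiffAt I' I ∞ b x₀) (hy : ContMDiffAt I' 𝓘(ℝ, Q.Model) ∞ y x₀) :
    ContMDiffAt I' B.J ∞ (fun x => (⟨b x, Q.frame i (b x) (y x)⟩ : B.Tot)) x₀ := by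
  refine SmoothVB.contMDiffAt_hom_apply (φ := fun x => Q.P (b x)) ((Q.smooth (b x₀)).comp x₀ hb) ?_
  refine SmoothVB.contMDiffAt_symmL i hi hb ?_
  exact (ContinuousLinearMap.contDiff _).contMDiff.contMDiffAt.comp x₀ hy

theorem contMDiffAt_coframe (i : M) (hi : b x₀ ∈ (B.triv i).baseSet) {s : ∀ x, B.Fib (b x)}
    (hs : ContMDiffAt I' B.J ∞ (fun x => (⟨b x, s x⟩ : B.Tot)) x₀) :
    ContMDiffAt I' 𝓘(ℝ, Q.Model) ∞ (fun x => Q.coframe i (b x) (s x)) x₀ :=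
  (ContinuousLinearMap.contDiff ((LinearMap.toContinuousLinearMap
    ((Q.param i).symm.toLinearMap.comp (Q.P i : B.Fib i →ₗ[ℝ] B.Fib i).rangeRestrict)).comp
      ((B.triv i).symmL ℝ i))).contMDiff.contMDiffAt.comp x₀ ((SmoothVB.contMDiffAt_mk_iff i hi).1 hs).2

end Smooth

theorem contMDiffAt_gram (i j : M) {m : M} (hi : m ∈ (B.triv i).baseSet)
    (hj : m ∈ (B.triv j).baseSet) : ContMDiffAt I 𝓘(ℝ, Q.Model →L[ℝ] Q.Model) ∞ (Q.gram i j) m :=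
  contMDiffAt_clm_of_apply fun _ => Q.contMDiffAt_coframe (b := fun x => x) j hj
    (Q.contMDiffAt_frame (b := fun x => x) i hi contMDiffAt_id contMDiffAt_const)

/-- The inverse of the Gram matrix of a frame. -/
def gramInv (i m : M) : Q.Model →L[ℝ] Q.Model := Ring.inverse (Q.gram i i m)

theorem gramInv_apply {i m : M} (h : IsUnit (Q.gram i i m)) (w : Q.Model) :
    Q.gramInv i m (Q.gram i i m w) = w :=
  congrArg (fun f => f w) (Ring.inverse_mul_cancel _ h)

/-- The set on which the frame at `i` is invertible. -/
def base (i : M) : Set M := {m | m ∈ (B.triv i).baseSet ∧ IsUnit (Q.gram i i m)}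

theorem mem_base (i : M) : i ∈ Q.base i := ⟨B.mem_triv i, by rw [gram_self]; exact isUnit_one⟩

theorem isOpen_base (i : M) : IsOpen (Q.base i) := by
  rw [isOpen_iff_mem_nhds]
  rintro m ⟨hm, hu⟩
  exact inter_mem ((B.triv i).open_baseSet.mem_nhds hm)
    ((Q.contMDiffAt_gram i i hm hm).continuousAt.eventually (Units.isOpen.mem_nhds hu))

theorem frame_injective {i m : M} (h : m ∈ Q.base i) : Function.Injective (Q.frame i m) := by
  intro w w' hw
  have h1 : Q.gram i i m w = Q.gram i i m w' := congrArg (Q.coframe i m) hw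
  rw [← Q.gramInv_apply h.2 w, h1, Q.gramInv_apply h.2 w']

/-- The frame ends with the projection, so it lands in the image; being injective between spaces of
equal dimension, it fills it. This is where constancy of the rank enters. -/
theorem range_frame {i m : M} (h : m ∈ Q.base i) :
    LinearMap.range (Q.frame i m : Q.Model →ₗ[ℝ] B.Fib m) = Q.img m := by
  refine Submodule.eq_of_le_of_finrank_eq ?_ ?_
  · rintro _ ⟨w, rfl⟩
    exact ⟨_, rfl⟩
  · rw [LinearMap.finrank_range_of_inj (Q.frame_injective h), Q.finrank_range]
    simp

/-- The transition from the frame at `i` to the frame at `j`. -/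
def change (i j m : M) : Q.Model →L[ℝ] Q.Model :=
  (Q.gramInv j m).comp (Q.gram i j m)

/-- Away from `j` the coframe alone is no longer a left inverse of the frame; the inverse Gram
matrix corrects it. -/
theorem coords_frame {j m : M} (hj : m ∈ Q.base j) {y : B.Fib m} (hy : y ∈ Q.img m) :
    Q.frame j m (Q.gramInv j m (Q.coframe j m y)) = y := by
  rw [← Q.range_frame hj] at hy
  obtain ⟨w, rfl⟩ := hy
  exact congrArg (Q.frame j m) (Q.gramInv_apply hj.2 w)

theorem frame_change {i j m : M} (hj : m ∈ Q.base j) (w : Q.Model) :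
    Q.frame j m (Q.change i j m w) = Q.frame i m w :=
  Q.coords_frame hj ⟨_, rfl⟩

theorem contMDiffAt_change {i j m : M} (hi : m ∈ Q.base i) (hj : m ∈ Q.base j) :
    ContMDiffAt I 𝓘(ℝ, Q.Model →L[ℝ] Q.Model) ∞ (Q.change i j) m :=
  (contMDiffAt_inverse (Q.contMDiffAt_gram j j hj.1 hj.1) hj.2).clm_comp
    (Q.contMDiffAt_gram i j hi.1 hj.1)

/-- The cocycle of the image bundle. -/
def core : VectorBundleCore ℝ M Q.Model M where
  baseSet := Q.base
  isOpen_baseSet := Q.isOpen_base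
  indexAt := id
  mem_baseSet_at := Q.mem_base
  coordChange := Q.change
  coordChange_self _ _ hm w := Q.frame_injective hm (Q.frame_change hm w)
  continuousOn_coordChange _ _ _ hm :=
    (Q.contMDiffAt_change hm.1 hm.2).continuousAt.continuousWithinAt
  coordChange_comp i j k m hm w := by
    -- Every transition preserves the vector described by the coordinates, so the cocycle identity
    -- can be checked after applying an injective frame.
    refine Q.frame_injective hm.2 ?_
    rw [Q.frame_change hm.2, Q.frame_change hm.1.2, Q.frame_change hm.2]

instance : Q.core.IsContMDiff I ∞ where
  contMDiffOn_coordChange _ _ _ hm := (Q.contMDiffAt_change hm.1 hm.2).contMDiffWithinAt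

/-- The image of a smooth family of projections, as a vector bundle. -/
def bundle : SmoothVB I M where
  F := Q.Model
  Fib := Q.core.Fiber
  instTopAddGroup := fun _ => inferInstanceAs (IsTopologicalAddGroup Q.Model)
  instContSMul := fun _ => inferInstanceAs (ContinuousSMul ℝ Q.Model)
  instFiberBundle := Q.core.fiberBundle
  instVectorBundle := Q.core.vectorBundle
  instSmooth := VectorBundleCore.instContMDiffVectorBundle Q.core

/-- The inclusion of the image bundle. -/
def incl (m : M) : Q.bundle.Fib m →ₗ[ℝ] B.Fib m := (Q.frame m m : Q.Model →ₗ[ℝ] B.Fib m)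

theorem incl_injective (m : M) : Function.Injective (Q.incl m) := Q.frame_injective (Q.mem_base m)

theorem range_incl (m : M) : LinearMap.range (Q.incl m) = Q.img m := Q.range_frame (Q.mem_base m)

/-- Applying the frame at `b x₀` turns smooth coordinates into a smooth vector of `B`. Conversely
the coordinates are recovered by the smooth map `gramInv ∘ coframe`. This yields the
characterization of smooth core sections. -/
theorem contMDiffAt_incl_iff {E' H' : Type*} [NormedAddCommGroup E'] [NormedSpace ℝ E']
    [TopologicalSpace H'] {I' : ModelWithCorners ℝ E' H'} {N : Type*} [TopologicalSpace N]
    [ChartedSpace H' N] {b : N → M} {x₀ : N} {s : ∀ x, Q.bundle.Fib (b x)} :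
    ContMDiffAt I' Q.bundle.J ∞ (fun x => (⟨b x, s x⟩ : Q.bundle.Tot)) x₀ ↔
      ContMDiffAt I' B.J ∞ (fun x => (⟨b x, Q.incl (b x) (s x)⟩ : B.Tot)) x₀ := by
  have hev (hb : ContMDiffAt I' I ∞ b x₀) : ∀ᶠ x in 𝓝 x₀, b x ∈ Q.base (b x₀) :=
    hb.continuousAt.eventually ((Q.isOpen_base _).mem_nhds (Q.mem_base _))
  have key : ContMDiffAt I' Q.bundle.J ∞ (fun x => (⟨b x, s x⟩ : Q.bundle.Tot)) x₀ ↔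
      ContMDiffAt I' I ∞ b x₀ ∧
        ContMDiffAt I' 𝓘(ℝ, Q.Model) ∞ (fun x => Q.change (b x) (b x₀) (b x) (s x)) x₀ :=
    contMDiffAt_totalSpace (F := Q.Model) (E := Q.core.Fiber)
  rw [key]
  constructor
  · rintro ⟨hb, hy⟩
    refine (Q.contMDiffAt_frame (b x₀) (B.mem_triv _) hb hy).congr_of_eventuallyEq ?_
    filter_upwards [hev hb] with x hx
    exact congrArg (TotalSpace.mk (b x)) (Q.frame_change hx (s x)).symm
  · intro h
    have hb := SmoothVB.contMDiffAt_proj_of h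
    refine ⟨hb, ?_⟩
    exact (((contMDiffAt_inverse (Q.contMDiffAt_gram (b x₀) (b x₀) (B.mem_triv _) (B.mem_triv _))
      (Q.mem_base _).2).comp x₀ hb).clm_apply
      (Q.contMDiffAt_coframe (b x₀) (B.mem_triv _) h))

end ProjFamily

end ImageBundle

/-! ### The core bundle, and surjectivity of `D → A` on fibres over `V`. -/

section DoubleSmooth

variable {E H : Type*} [NormedAddCommGroup E] [NormedSpace ℝ E] [TopologicalSpace H]
  {I : ModelWithCorners ℝ E H} {M : Type u} [TopologicalSpace M] [ChartedSpace H M]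

/-- The zero section, as a smooth map to the total space. -/
def SmoothVB.zeroMap (V : SmoothVB I M) : C^∞⟮I, M; V.J, V.Tot⟯ :=
  ⟨fun m => ⟨m, 0⟩, fun _ => contMDiffAt_zero contMDiffAt_id⟩

/-- The projection, as a smooth map. -/
def SmoothVB.projMap (V : SmoothVB I M) : C^∞⟮V.J, V.Tot; I, M⟯ :=
  ⟨fun v => v.proj, contMDiff_proj V.Fib⟩

namespace DoubleVB

variable {V A : SmoothVB I M} (D : DoubleVB V A) {m : M}
  {E' H' : Type*} [NormedAddCommGroup E'] [NormedSpace ℝ E'] [TopologicalSpace H']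
  {I' : ModelWithCorners ℝ E' H'} {N : Type*} [TopologicalSpace N] [ChartedSpace H' N]

theorem contMDiffAt_qA {b : N → V.Tot} {x₀ : N} {s : ∀ x, D.overV.Fib (b x)}
    (hs : ContMDiffAt I' D.overV.J ∞ (fun x => (⟨b x, s x⟩ : D.overV.Tot)) x₀) :
    ContMDiffAt I' A.J ∞ (fun x => (⟨(b x).proj, D.qA (b x) (s x)⟩ : A.Tot)) x₀ := by
  have h : ContMDiffAt I' A.J ∞ (fun x => (D.e ⟨b x, s x⟩).proj) x₀ :=
    (contMDiff_proj D.overA.Fib).contMDiffAt.comp x₀ (D.e.contMDiff.contMDiffAt.comp x₀ hs)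
  exact h.congr_of_eventuallyEq (.of_forall fun x => (D.projA_mk (b x) (s x)).symm)

theorem contMDiffAt_zA {b : N → M} {x₀ : N} {a : ∀ x, A.Fib (b x)}
    (ha : ContMDiffAt I' A.J ∞ (fun x => (⟨b x, a x⟩ : A.Tot)) x₀) :
    ContMDiffAt I' D.overV.J ∞ (fun x => (⟨⟨b x, 0⟩, D.zA (b x) (a x)⟩ : D.overV.Tot)) x₀ := by
  have h : ContMDiffAt I' D.overV.J ∞ (fun x => D.e.symm ⟨⟨b x, a x⟩, 0⟩) x₀ :=
    D.e.symm.contMDiff.contMDiffAt.comp x₀ (SmoothVB.contMDiffAt_zero ha)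
  exact h.congr_of_eventuallyEq (.of_forall fun x => D.mk_zA (a x))

/-- The projection of the fibre of `D → V` over `0_m` to the core. -/
def coreP (m : M) : D.overV.Fib (⟨m, 0⟩ : V.Tot) →ₗ[ℝ] D.overV.Fib (⟨m, 0⟩ : V.Tot) :=
  LinearMap.id - (D.zA m).comp (D.qA ⟨m, 0⟩)

theorem coreP_apply (x : D.overV.Fib (⟨m, 0⟩ : V.Tot)) :
    D.coreP m x = x - D.zA m (D.qA ⟨m, 0⟩ x) := rfl

theorem coreP_of_mem {x : D.overV.Fib (⟨m, 0⟩ : V.Tot)} (hx : x ∈ D.coreSub m) :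
    D.coreP m x = x := by
  rw [coreP_apply, LinearMap.mem_ker.1 hx, map_zero, sub_zero]

theorem range_coreP (m : M) : LinearMap.range (D.coreP m) = D.coreSub m := by
  ext x
  constructor
  · rintro ⟨y, rfl⟩
    rw [LinearMap.mem_ker, coreP_apply, map_sub, qA_zA, sub_self]
  · exact fun hx => ⟨x, D.coreP_of_mem hx⟩

/-- The zero section of `D → A` splits the projection over `0_m`, so this projection is onto and
rank-nullity gives a dimension independent of `m`. -/
theorem finrank_coreSub (m : M) : Module.finrank ℝ (D.coreSub m) =
    Module.finrank ℝ D.overV.F - Module.finrank ℝ A.F := by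
  have h := (D.qA ⟨m, 0⟩).finrank_range_add_finrank_ker
  have hr : LinearMap.range (D.qA ⟨m, 0⟩) = ⊤ :=
    LinearMap.range_eq_top.2 fun a => ⟨D.zA m a, D.qA_zA a⟩
  rw [hr, finrank_top, SmoothVB.finrank_fib, SmoothVB.finrank_fib] at h
  exact Nat.eq_sub_of_add_eq' h

/-- The projections to the core. -/
def coreProj : ProjFamily (D.overV.pull V.zeroMap) where
  P m := LinearMap.toContinuousLinearMap (D.coreP m)
  idem m y := D.coreP_of_mem (by rw [← range_coreP]; exact ⟨y, rfl⟩)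
  smooth m := by
    refine SmoothVB.contMDiffAt_hom_of_apply (b := fun m : M => m) contMDiffAt_id fun s hs => ?_
    have hs' := ((SmoothVB.contMDiffAt_pull_iff V.zeroMap (b := fun m : M => m) (s := s)).1 hs).2
    exact (SmoothVB.contMDiffAt_pull_iff V.zeroMap (b := fun m : M => m)).2 ⟨contMDiffAt_id,
      SmoothVB.contMDiffAt_sub hs' (D.contMDiffAt_zA (D.contMDiffAt_qA hs'))⟩
  rank := Module.finrank ℝ D.overV.F - Module.finrank ℝ A.F
  finrank_range m := by
    rw [← D.finrank_coreSub m, ← D.range_coreP m]; rfl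

/-- The core bundle. -/
def core : D.CoreBundle where
  bundle := D.coreProj.bundle
  incl m := D.coreProj.incl m
  injective m := D.coreProj.incl_injective m
  mem_range m d := by
    rw [isCorePoint_iff, ← range_coreP]
    exact SetLike.ext_iff.1 (D.coreProj.range_incl m) d
  smooth_iff s := forall_congr' fun m => by
    refine (D.coreProj.contMDiffAt_incl_iff (b := fun m => m) (s := s)).trans ?_
    exact (SmoothVB.contMDiffAt_pull_iff V.zeroMap (b := fun m : M => m)).trans
      (and_iff_right contMDiffAt_id)

theorem contMDiffAt_core_iff {b : N → M} {x₀ : N} {c : ∀ x, D.core.bundle.Fib (b x)} :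
    ContMDiffAt I' D.core.bundle.J ∞ (fun x => (⟨b x, c x⟩ : D.core.bundle.Tot)) x₀ ↔
      ContMDiffAt I' I ∞ b x₀ ∧ ContMDiffAt I' D.overV.J ∞
        (fun x => (⟨⟨b x, 0⟩, D.core.incl (b x) (c x)⟩ : D.overV.Tot)) x₀ := by
  refine (D.coreProj.contMDiffAt_incl_iff (b := b) (s := c)).trans ?_
  exact SmoothVB.contMDiffAt_pull_iff V.zeroMap (b := b)

theorem scaleA_proj (t : ℝ) (x : D.Tot) : (D.scaleA t x).proj = V.scale t x.proj := by
  have h := D.proj_linear.smul t (D.e x)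
  simp only [Diffeomorph.symm_apply_apply] at h
  exact h

theorem projA_scaleA (t : ℝ) (x : D.Tot) : D.projA (D.scaleA t x) = D.projA x := by
  simp [projA, scaleA, SmoothVB.scale]

/-- The projection `D → A`, as a morphism of vector bundles over `V`. -/
def qAL (p : V.Tot) : D.overV.Fib p →L[ℝ] (A.pull V.projMap).Fib p :=
  LinearMap.toContinuousLinearMap (D.qA p)

theorem contMDiffAt_qAL (p : V.Tot) :
    ContMDiffAt V.J (homVB D.overV (A.pull V.projMap)).J ∞
      (fun p => (⟨p, D.qAL p⟩ : (homVB D.overV (A.pull V.projMap)).Tot)) p := by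
  refine SmoothVB.contMDiffAt_hom_of_apply (b := fun p : V.Tot => p) contMDiffAt_id fun s hs => ?_
  exact (SmoothVB.contMDiffAt_pull_iff V.projMap (b := fun p : V.Tot => p)).2
    ⟨contMDiffAt_id, D.contMDiffAt_qA hs⟩

/-- Surjectivity holds over `0_m` because of `zA`, and is an open condition, hence holds over `tv`
for small `t`. Scaling by `t⁻¹` in `D → A` moves the base point from `tv` to `v` and leaves `a`
unchanged. -/
theorem qA_surjective (p : V.Tot) : Function.Surjective (D.qA p) := by
  obtain ⟨m, v⟩ := p
  obtain ⟨U, hU, S, -, hS⟩ := SmoothVB.exists_local_rightInverse D.qAL D.contMDiffAt_qAL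
    (⟨m, 0⟩ : V.Tot) fun a => ⟨D.zA m a, D.qA_zA a⟩
  have hc : Tendsto (fun t : ℝ => (⟨m, t • v⟩ : V.Tot)) (𝓝[≠] 0) (𝓝 ⟨m, 0⟩) := by
    have h : Continuous (fun t : ℝ => (⟨m, t • v⟩ : V.Tot)) :=
      (SmoothVB.continuous_mk m).comp (continuous_id.smul continuous_const)
    have h0 := h.tendsto 0
    rw [zero_smul] at h0
    exact h0.mono_left nhdsWithin_le_nhds
  obtain ⟨t, htU, ht⟩ := ((hc.eventually hU).and self_mem_nhdsWithin).exists
  intro a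
  have hx : D.projA ⟨⟨m, t • v⟩, S ⟨m, t • v⟩ a⟩ = ⟨m, a⟩ := by
    rw [projA_mk]; exact SmoothVB.mk_inj.2 (hS _ htU a)
  have hp : (D.scaleA t⁻¹ ⟨⟨m, t • v⟩, S ⟨m, t • v⟩ a⟩).proj = ⟨m, v⟩ := by
    rw [scaleA_proj, SmoothVB.scale]
    simp [smul_smul, inv_mul_cancel₀ ht]
  refine ⟨D.overV.fibAt _ hp, SmoothVB.mk_inj.1 ?_⟩
  rw [← D.projA_mk ⟨m, v⟩, SmoothVB.mk_fibAt, projA_scaleA, hx]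

end DoubleVB
end DoubleSmooth

/-! ### Linear splittings of `D → A`, obtained by differentiating right inverses. -/

section Splitting

variable {E H : Type*} [NormedAddCommGroup E] [NormedSpace ℝ E] [TopologicalSpace H]
  {I : ModelWithCorners ℝ E H} {M : Type u} [TopologicalSpace M] [ChartedSpace H M]

theorem SmoothVB.mk_add_smul_congr {B : SmoothVB I M} {p p' : M} {x y : B.Fib p} {x' y' : B.Fib p'}
    (hx : (⟨p, x⟩ : B.Tot) = ⟨p', x'⟩) (hy : (⟨p, y⟩ : B.Tot) = ⟨p', y'⟩) (c : ℝ) :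
    (⟨p, x + c • y⟩ : B.Tot) = ⟨p', x' + c • y'⟩ := by
  obtain rfl : p = p' := congrArg TotalSpace.proj hx
  rw [mk_inj] at hx hy
  rw [hx, hy]

namespace DoubleVB

variable {V A : SmoothVB I M} (D : DoubleVB V A) {m : M}

/-- A smooth family of linear right inverses of the projections `D_v → A_m`. -/
structure Lift where
  /-- the right inverses -/
  S : ∀ p : V.Tot, (A.pull V.projMap).Fib p →L[ℝ] D.overV.Fib p
  smooth : ContMDiff V.J (homVB (A.pull V.projMap) D.overV).J ∞
    (fun p => (⟨p, S p⟩ : (homVB (A.pull V.projMap) D.overV).Tot))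
  qA_S : ∀ (p : V.Tot) (a : A.Fib p.proj), D.qA p (S p a) = a

/-- The right inverse lives over all of `V` and need not depend linearly on the point of `V`;
linearity in that direction is created afterwards by differentiation. -/
theorem nonempty_lift [FiniteDimensional ℝ E] [IsManifold I ∞ M] [T2Space M]
    [SigmaCompactSpace M] : Nonempty D.Lift := by
  have := SmoothVB.sigmaCompactSpace_tot V
  obtain ⟨S, h1, h2⟩ := SmoothVB.exists_rightInverse D.qAL D.contMDiffAt_qAL
    (fun p => D.qA_surjective p)
  exact ⟨⟨S, h1, h2⟩⟩

/-- The map `(x, y) ↦ x +_V c y` from pairs of points of `D_a` and `D_{a'}` over the same point of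
`V` to `D_{a + c a'}` extends to a linear map on all pairs. -/
theorem exists_linear_add (a a' : A.Fib m) (c : ℝ) :
    ∃ L : D.overA.Fib ⟨m, a⟩ × D.overA.Fib ⟨m, a'⟩ →ₗ[ℝ] D.overA.Fib ⟨m, a + c • a'⟩,
      ∀ (v : V.Fib m) (x x' : D.overV.Fib ⟨m, v⟩) (hx : D.qA _ x = a) (hx' : D.qA _ x' = a'),
        L (D.toA x a hx, D.toA x' a' hx') =
          D.toA (x + c • x') (a + c • a') (by rw [map_add, map_smul, hx, hx']) := by
  -- `W` is the fibre product `D_a ×_{V_m} D_{a'}`, the exact domain on which addition in `D → V`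
  -- makes sense.
  let W : Submodule ℝ (D.overA.Fib ⟨m, a⟩ × D.overA.Fib ⟨m, a'⟩) :=
    LinearMap.ker ((D.qV ⟨m, a⟩).comp (LinearMap.fst ℝ _ _) -
      (D.qV ⟨m, a'⟩).comp (LinearMap.snd ℝ _ _))
  have hW : ∀ w : W, D.qV ⟨m, a'⟩ w.1.2 = D.qV ⟨m, a⟩ w.1.1 := fun w =>
    (sub_eq_zero.1 w.2).symm
  let l : ∀ w : W, D.overV.Fib ⟨m, D.qV ⟨m, a⟩ w.1.1⟩ := fun w => D.toV w.1.1 _ rfl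
  let r : ∀ w : W, D.overV.Fib ⟨m, D.qV ⟨m, a⟩ w.1.1⟩ := fun w => D.toV w.1.2 _ (hW w)
  have hl : ∀ w, D.qA _ (l w) = a := fun w => D.qA_toV _
  have hr : ∀ w, D.qA _ (r w) = a' := fun w => D.qA_toV (hW w)
  have hcr : ∀ w, D.qA _ (c • r w) = c • a' := fun w => by rw [map_smul, hr]
  have hlr : ∀ w, D.qA _ (l w + c • r w) = a + c • a' := fun w => by rw [map_add, hl, hcr]
  have hl' : ∀ w, D.toA (l w) a (hl w) = w.1.1 := fun w => D.toA_toV _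
  have hr' : ∀ w, D.toA (r w) a' (hr w) = w.1.2 := fun w => D.toA_toV (hW w)
  let L₀ : W →ₗ[ℝ] D.overA.Fib ⟨m, a + c • a'⟩ :=
    { toFun := fun w => D.toA (l w + c • r w) _ (hlr w)
      map_add' := fun w w' => by
        refine (D.toA_add (hl w) (hl w') (hl (w + w')) (hcr w) (hcr w') (hcr (w + w')) ?_
          (D.toA_smul_add c (hr w) (hr w') (hr (w + w')) ?_ (hcr w) (hcr w') (hcr (w + w')))
          (hlr w) (hlr w') (hlr (w + w'))).symm
        · rw [hl', hl', hl']; rfl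
        · rw [hr', hr', hr']; rfl
      map_smul' := fun s w => by
        refine (D.toA_add_smul s (hl w) (hl (s • w)) (hcr w) (hcr (s • w)) ?_
          (D.toA_smul_smul s c (hr w) (hr (s • w)) ?_ (hcr w) (hcr (s • w)))
          (hlr w) (hlr (s • w))).symm
        · rw [hl', hl']; rfl
        · rw [hr', hr']; rfl }
  -- The extension off `W` is arbitrary. It allows writing `L (y, y')` as `L (y, 0) + L (0, y')`, so
  -- that the two rays can be differentiated separately.
  obtain ⟨L, hL⟩ := L₀.exists_extend
  refine ⟨L, fun v x x' hx hx' => ?_⟩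
  let w : W := ⟨(D.toA x a hx, D.toA x' a' hx'), by
    rw [LinearMap.mem_ker]
    exact sub_eq_zero.2 ((D.qV_toA hx).trans (D.qV_toA hx').symm)⟩
  have h1 : L w.1 = L₀ w := LinearMap.congr_fun hL w
  refine h1.trans ?_
  have e1 : (⟨⟨m, D.qV ⟨m, a⟩ w.1.1⟩, l w⟩ : D.overV.Tot) = ⟨⟨m, v⟩, x⟩ := by
    rw [D.mk_toV]
    exact (congrArg D.e.symm (D.mk_toA hx)).trans (D.e.symm_apply_apply _)
  have e2 : (⟨⟨m, D.qV ⟨m, a⟩ w.1.1⟩, r w⟩ : D.overV.Tot) = ⟨⟨m, v⟩, x'⟩ := by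
    rw [D.mk_toV]
    exact (congrArg D.e.symm (D.mk_toA hx')).trans (D.e.symm_apply_apply _)
  rw [← SmoothVB.mk_inj, mk_toA]
  refine (D.mk_toA (hlr w)).trans (congrArg D.e ?_)
  exact SmoothVB.mk_add_smul_congr e1 e2 c

namespace Lift

variable {D} (S : D.Lift)

/-- The value of the right inverse over `v ∈ V_m` on `a ∈ A_m`. -/
def app (v : V.Fib m) : A.Fib m →ₗ[ℝ] D.overV.Fib ⟨m, v⟩ := (S.S ⟨m, v⟩).toLinearMap

theorem qA_app (v : V.Fib m) (a : A.Fib m) : D.qA ⟨m, v⟩ (S.app v a) = a := S.qA_S ⟨m, v⟩ a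

/-- The ray `t ↦ S_{tv}(a)` in the fibre of `D → A` over `a`. -/
def ray (v : V.Fib m) (a : A.Fib m) (t : ℝ) : D.overA.Fib ⟨m, a⟩ :=
  D.toA (S.app (t • v) a) a (S.qA_app (t • v) a)

theorem ray_congr {v w : V.Fib m} (a : A.Fib m) {s t : ℝ} (h : s • v = t • w) :
    S.ray v a s = S.ray w a t := by
  have key : ∀ u u' : V.Fib m, u = u' →
      D.toA (S.app u a) a (S.qA_app u a) = D.toA (S.app u' a) a (S.qA_app u' a) := by
    rintro u _ rfl; rfl
  exact key _ _ h

theorem contMDiff_ray {E' H' : Type*} [NormedAddCommGroup E'] [NormedSpace ℝ E']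
    [TopologicalSpace H'] {I' : ModelWithCorners ℝ E' H'} {N : Type*} [TopologicalSpace N]
    [ChartedSpace H' N] {b : N → M} {v : ∀ x, V.Fib (b x)} {a : ∀ x, A.Fib (b x)} {t : N → ℝ}
    (hv : ContMDiff I' V.J ∞ (fun x => (⟨b x, v x⟩ : V.Tot)))
    (ha : ContMDiff I' A.J ∞ (fun x => (⟨b x, a x⟩ : A.Tot)))
    (ht : ContMDiff I' 𝓘(ℝ, ℝ) ∞ t) :
    ContMDiff I' D.overA.J ∞
      (fun x => (⟨⟨b x, a x⟩, S.ray (v x) (a x) (t x)⟩ : D.overA.Tot)) := by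
  intro x₀
  have hb : ContMDiffAt I' V.J ∞ (fun x => (⟨b x, t x • v x⟩ : V.Tot)) x₀ :=
    SmoothVB.contMDiffAt_smul (ht x₀) (hv x₀)
  have h := SmoothVB.contMDiffAt_hom_apply (b := fun x => (⟨b x, t x • v x⟩ : V.Tot))
    (φ := fun x => S.S ⟨b x, t x • v x⟩) (s := fun x => a x) ((S.smooth _).comp x₀ hb)
    ((SmoothVB.contMDiffAt_pull_iff V.projMap (b := fun x => (⟨b x, t x • v x⟩ : V.Tot))).2
      ⟨hb, ha x₀⟩)
  refine (D.e.contMDiff.contMDiffAt.comp x₀ h).congr_of_eventuallyEq (.of_forall fun x => ?_)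
  exact D.mk_toA _

theorem contMDiff_ray_time (v : V.Fib m) (a : A.Fib m) :
    ContMDiff 𝓘(ℝ, ℝ) D.overA.J ∞ (fun t => (⟨⟨m, a⟩, S.ray v a t⟩ : D.overA.Tot)) :=
  S.contMDiff_ray (b := fun _ => m) contMDiff_const contMDiff_const contMDiff_id

/-- The derivative of `t ↦ S_{tv}(a)` at `0`. -/
def lin (v : V.Fib m) (a : A.Fib m) : D.overA.Fib ⟨m, a⟩ := SmoothVB.fibDeriv (S.ray v a)

theorem hasDerivAt_lin (v : V.Fib m) (a : A.Fib m) {W : Type*} [NormedAddCommGroup W]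
    [NormedSpace ℝ W] (φ : D.overA.Fib ⟨m, a⟩ →L[ℝ] W) :
    HasDerivAt (fun t => φ (S.ray v a t)) (φ (S.lin v a)) 0 :=
  SmoothVB.hasDerivAt_fibDeriv (S.contMDiff_ray_time v a 0) φ

/-- The ray at time `t` lies over `tv`, and `D → V` is linear on `D_a`, so the derivative lies over
`v`. -/
theorem qV_lin (v : V.Fib m) (a : A.Fib m) : D.qV ⟨m, a⟩ (S.lin v a) = v := by
  let σ := VectorBundle.continuousLinearEquivAt ℝ V.F V.Fib m
  let φ : D.overA.Fib ⟨m, a⟩ →L[ℝ] V.F :=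
    (σ : V.Fib m →L[ℝ] V.F).comp (LinearMap.toContinuousLinearMap (D.qV ⟨m, a⟩))
  have h1 := S.hasDerivAt_lin v a φ
  have h2 : ∀ t, φ (S.ray v a t) = t • σ v := fun t =>
    (congrArg σ (D.qV_toA _)).trans (map_smul σ t v)
  have h3 : HasDerivAt (fun t => φ (S.ray v a t)) ((1 : ℝ) • σ v) 0 := by
    simp only [h2]
    exact (hasDerivAt_id (0 : ℝ)).smul_const (σ v)
  have h4 := h1.unique h3
  rw [one_smul] at h4
  exact σ.injective h4

/-- The curve `t ↦ S_{tv}(a)` is the restriction to a line of the smooth map `w ↦ S_w(a)` from `V_m`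
to `D_a`. Its velocity at `0` is the total derivative at the origin applied to `v`, whatever the
value `S_0(a)` is. -/
theorem exists_linearMap_lin (a : A.Fib m) :
    ∃ f : V.Fib m →ₗ[ℝ] D.overA.Fib ⟨m, a⟩, ∀ v, f v = S.lin v a := by
  let σ := (V.triv m).continuousLinearEquivAt ℝ m (V.mem_triv m)
  let τ := (D.overA.triv ⟨m, a⟩).continuousLinearEquivAt ℝ ⟨m, a⟩ (D.overA.mem_triv _)
  have hσ : ∀ w, σ.symm w = (V.triv m).symmL ℝ m w := fun w => by
    rw [ContinuousLinearEquiv.symm_apply_eq]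
    exact ((V.triv m).continuousLinearMapAt_symmL (V.mem_triv m) w).symm.trans
      ((V.triv m).continuousLinearMapAt_apply_of_mem ℝ (V.mem_triv m) _)
  have hτ : ∀ y, τ y = (D.overA.triv ⟨m, a⟩).continuousLinearMapAt ℝ ⟨m, a⟩ y := fun y =>
    ((D.overA.triv _).continuousLinearMapAt_apply_of_mem ℝ (D.overA.mem_triv _) _).symm
  have hv : ContMDiff 𝓘(ℝ, V.F) V.J ∞ (fun w => (⟨m, σ.symm w⟩ : V.Tot)) := fun w => by
    simp only [hσ]
    exact SmoothVB.contMDiffAt_symmL (b := fun _ : V.F => m) m (V.mem_triv m) contMDiffAt_const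
      contMDiffAt_id
  have h := S.contMDiff_ray (b := fun _ : V.F => m) (a := fun _ => a) (t := fun _ => 1) hv
    contMDiff_const contMDiff_const
  have h1 : DifferentiableAt ℝ (fun w => τ (S.ray (σ.symm w) a 1)) 0 := by
    simp only [hτ]
    exact (((SmoothVB.contMDiffAt_mk_iff (b := fun _ : V.F => (⟨m, a⟩ : A.Tot)) ⟨m, a⟩
      (D.overA.mem_triv _)).1 (h 0)).2.contDiffAt.differentiableAt (by simp))
  refine ⟨τ.symm.toLinearMap ∘ₗ (fderiv ℝ (fun w => τ (S.ray (σ.symm w) a 1)) 0).toLinearMap ∘ₗ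
    σ.toLinearMap, fun v => ?_⟩
  have h2 : HasDerivAt (fun t : ℝ => t • σ v) (σ v) 0 := by
    simpa using (hasDerivAt_id (0 : ℝ)).smul_const (σ v)
  have h3 := HasFDerivAt.comp_hasDerivAt_of_eq (0 : ℝ) h1.hasFDerivAt h2 (by simp)
  have h4 := S.hasDerivAt_lin v a (τ : D.overA.Fib ⟨m, a⟩ →L[ℝ] D.overA.F)
  have h5 : ((fun w => τ (S.ray (σ.symm w) a 1)) ∘ fun t : ℝ => t • σ v) =
      fun t => τ (S.ray v a t) := by
    funext t
    exact congrArg τ (S.ray_congr a (by simp))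
  rw [h5] at h3
  exact (congrArg τ.symm (h3.unique h4)).trans (τ.symm_apply_apply _)

/-- The linear section through `v` over `a` obtained by differentiating `S` in fibre direction. -/
def lift (v : V.Fib m) (a : A.Fib m) : D.overV.Fib ⟨m, v⟩ := D.toV (S.lin v a) v (S.qV_lin v a)

theorem qA_lift (v : V.Fib m) (a : A.Fib m) : D.qA ⟨m, v⟩ (S.lift v a) = a :=
  D.qA_toV (S.qV_lin v a)

theorem mk_lift (v : V.Fib m) (a : A.Fib m) :
    (⟨⟨m, v⟩, S.lift v a⟩ : D.overV.Tot) = D.e.symm ⟨⟨m, a⟩, S.lin v a⟩ :=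
  D.mk_toV (S.qV_lin v a)

theorem toA_lift (v : V.Fib m) (a : A.Fib m) :
    D.toA (S.lift v a) a (S.qA_lift v a) = S.lin v a := D.toA_toV (S.qV_lin v a)

theorem isLinearAtOver_lift (a : A.Fib m) : D.IsLinearAtOver a (fun v => S.lift v a) := by
  obtain ⟨f, hf⟩ := S.exists_linearMap_lin a
  refine ⟨f, fun v => ?_⟩
  rw [hf, mk_lift, Diffeomorph.apply_symm_apply]

/-- For every `t`, `S_{tv}(a + c a') = S_{tv}(a) +_V c S_{tv}(a')`, and the right side is a linear
map `L` of the two rays. Differentiation commutes with `L`, which is then read back as a sum in `D →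
V` over `v`. -/
theorem lift_add_smul (v : V.Fib m) (a a' : A.Fib m) (c : ℝ) :
    S.lift v (a + c • a') = S.lift v a + c • S.lift v a' := by
  obtain ⟨L, hL⟩ := D.exists_linear_add a a' c
  let τ := VectorBundle.continuousLinearEquivAt ℝ D.overA.F D.overA.Fib ⟨m, a + c • a'⟩
  let L₁ : D.overA.Fib ⟨m, a⟩ →L[ℝ] D.overA.F := (τ : _ →L[ℝ] D.overA.F).comp
    (LinearMap.toContinuousLinearMap (L.comp (LinearMap.inl ℝ _ _)))
  let L₂ : D.overA.Fib ⟨m, a'⟩ →L[ℝ] D.overA.F := (τ : _ →L[ℝ] D.overA.F).comp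
    (LinearMap.toContinuousLinearMap (L.comp (LinearMap.inr ℝ _ _)))
  have hsum : ∀ y y', τ (L (y, y')) = L₁ y + L₂ y' := fun y y' => by
    change _ = τ (L (y, 0)) + τ (L (0, y'))
    rw [← map_add, ← map_add, Prod.mk_add_mk, add_zero, zero_add]
  have h1 := (S.hasDerivAt_lin v a L₁).add (S.hasDerivAt_lin v a' L₂)
  have h2 := S.hasDerivAt_lin v (a + c • a') (τ : _ →L[ℝ] D.overA.F)
  have h3 : (fun t => (τ : _ →L[ℝ] D.overA.F) (S.ray v (a + c • a') t)) =
      (fun t => L₁ (S.ray v a t)) + fun t => L₂ (S.ray v a' t) := by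
    funext t
    rw [Pi.add_apply, ← hsum]
    refine congrArg τ (Eq.trans ?_ (hL (t • v) (S.app (t • v) a) (S.app (t • v) a')
      (S.qA_app _ _) (S.qA_app _ _)).symm)
    refine (D.toA_inj (S.qA_app _ _) _).2 ?_
    rw [map_add, map_smul]
  rw [h3] at h2
  have h4 := h2.unique h1
  rw [← hsum] at h4
  have h5 := τ.injective h4
  have hq := hL v (S.lift v a) (S.lift v a') (S.qA_lift v a) (S.qA_lift v a')
  rw [toA_lift, toA_lift] at hq
  refine (D.toA_inj (S.qA_lift v _) (by rw [map_add, map_smul, qA_lift, qA_lift])).1 ?_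
  rw [toA_lift, ← hq]
  exact h5

theorem contMDiff_lift [IsManifold I ∞ M] (a : A.Sec) :
    ContMDiff V.J D.overV.J ∞
      (fun v : V.Tot => (⟨v, S.lift v.2 (a v.proj)⟩ : D.overV.Tot)) := by
  have ha : ContMDiff V.J A.J ∞ (fun v : V.Tot => (⟨v.proj, a v.proj⟩ : A.Tot)) :=
    a.contMDiff.comp (contMDiff_proj V.Fib)
  have h := S.contMDiff_ray (I' := V.J.prod 𝓘(ℝ, ℝ)) (N := V.Tot × ℝ)
    (b := fun p : V.Tot × ℝ => p.1.proj) (v := fun p => p.1.2) (a := fun p => a p.1.proj)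
    (t := fun p => p.2) contMDiff_fst (ha.comp contMDiff_fst) contMDiff_snd
  intro v
  have h1 := SmoothVB.contMDiffAt_fibDeriv (b := fun v : V.Tot => (⟨v.proj, a v.proj⟩ : A.Tot))
    (G := fun v t => S.ray v.2 (a v.proj) t) (x₀ := v) h
  refine (D.e.symm.contMDiff.contMDiffAt.comp v h1).congr_of_eventuallyEq (.of_forall fun v => ?_)
  exact D.mk_toV (S.qV_lin v.2 _)

end Lift

end DoubleVB
end Splitting

/-! ### The bundle of linear sections and its exact sequence. -/

section Fat

variable {E H : Type*} [NormedAddCommGroup E] [NormedSpace ℝ E] [TopologicalSpace H]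
  {I : ModelWithCorners ℝ E H} {M : Type u} [TopologicalSpace M] [ChartedSpace H M]

namespace DoubleVB

variable {V A : SmoothVB I M} (D : DoubleVB V A) {m : M}

/-- The fibres of the core bundle. -/
def coreLE (m : M) : D.core.bundle.Fib m ≃ₗ[ℝ] D.coreSub m :=
  LinearEquiv.ofBijective ((D.core.incl m).codRestrict (D.coreSub m) fun c =>
      (D.isCorePoint_iff _).1 ((D.core.mem_range m _).1 ⟨c, rfl⟩)) <| by
    constructor
    · intro c c' h
      exact D.core.injective m (congrArg Subtype.val h)
    · rintro ⟨x, hx⟩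
      obtain ⟨c, hc⟩ := (D.core.mem_range m x).2 ((D.isCorePoint_iff x).2 hx)
      exact ⟨c, Subtype.ext hc⟩

section Smooth

variable {E' H' : Type*} [NormedAddCommGroup E'] [NormedSpace ℝ E'] [TopologicalSpace H']
  {I' : ModelWithCorners ℝ E' H'} {N : Type*} [TopologicalSpace N] [ChartedSpace H' N]
  {b : N → M} {x₀ : N} {v : ∀ x, V.Fib (b x)} {c : ∀ x, D.core.bundle.Fib (b x)}

theorem contMDiffAt_zV (hv : ContMDiffAt I' V.J ∞ (fun x => (⟨b x, v x⟩ : V.Tot)) x₀) :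
    ContMDiffAt I' D.overA.J ∞ (fun x => (⟨⟨b x, 0⟩, D.zV (b x) (v x)⟩ : D.overA.Tot)) x₀ :=
  D.flip.contMDiffAt_zA hv

theorem contMDiffAt_coreA_iff : ContMDiffAt I' D.overA.J ∞
      (fun x => (⟨⟨b x, 0⟩, D.coreA (b x) (D.coreLE _ (c x))⟩ : D.overA.Tot)) x₀ ↔
    ContMDiffAt I' D.core.bundle.J ∞ (fun x => (⟨b x, c x⟩ : D.core.bundle.Tot)) x₀ := by
  have he : ∀ x, (⟨⟨b x, 0⟩, D.coreA (b x) (D.coreLE _ (c x))⟩ : D.overA.Tot) =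
      D.e ⟨⟨b x, 0⟩, D.core.incl (b x) (c x)⟩ := fun x => D.mk_toA (D.qA_core (D.coreLE _ (c x)))
  simp only [he]
  rw [contMDiffAt_core_iff]
  constructor
  · intro h
    have h1 := D.e.symm.contMDiff.contMDiffAt.comp x₀ h
    have h2 : ContMDiffAt I' D.overV.J ∞
        (fun x => (⟨⟨b x, 0⟩, D.core.incl (b x) (c x)⟩ : D.overV.Tot)) x₀ :=
      h1.congr_of_eventuallyEq (.of_forall fun x => (D.e.symm_apply_apply _).symm)
    exact ⟨SmoothVB.contMDiffAt_proj_of (SmoothVB.contMDiffAt_proj_of h2), h2⟩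
  · exact fun h => D.e.contMDiff.contMDiffAt.comp x₀ h.2

/-- In `D → A` the point is `0_v + c`, and `0_v` depends smoothly on `v`; adding or subtracting it
passes between the two smoothness conditions. -/
theorem contMDiffAt_coreIncl_iff
    (hv : ContMDiffAt I' V.J ∞ (fun x => (⟨b x, v x⟩ : V.Tot)) x₀) :
    ContMDiffAt I' D.overV.J ∞
      (fun x => (⟨⟨b x, v x⟩, D.coreIncl (v x) (D.coreLE _ (c x))⟩ : D.overV.Tot)) x₀ ↔
    ContMDiffAt I' D.core.bundle.J ∞ (fun x => (⟨b x, c x⟩ : D.core.bundle.Tot)) x₀ := by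
  rw [← contMDiffAt_coreA_iff]
  have he : ∀ x, (⟨⟨b x, v x⟩, D.coreIncl (v x) (D.coreLE _ (c x))⟩ : D.overV.Tot) =
      D.e.symm ⟨⟨b x, 0⟩, D.zV (b x) (v x) + D.coreA (b x) (D.coreLE _ (c x))⟩ := fun x =>
    D.mk_toV (D.qV_zV_add_coreA _ _)
  simp only [he]
  constructor
  · intro h
    have h1 := D.e.contMDiff.contMDiffAt.comp x₀ h
    have h2 : ContMDiffAt I' D.overA.J ∞ (fun x => (⟨⟨b x, 0⟩, D.zV (b x) (v x) +
        D.coreA (b x) (D.coreLE _ (c x))⟩ : D.overA.Tot)) x₀ :=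
      h1.congr_of_eventuallyEq (.of_forall fun x => (D.e.apply_symm_apply _).symm)
    refine (SmoothVB.contMDiffAt_sub h2 (D.contMDiffAt_zV hv)).congr_of_eventuallyEq
      (.of_forall fun x => ?_)
    simp only [add_sub_cancel_left]
  · intro h
    exact D.e.symm.contMDiff.contMDiffAt.comp x₀ (SmoothVB.contMDiffAt_add (D.contMDiffAt_zV hv) h)

end Smooth

namespace Lift

variable {D} (S : D.Lift)

/-- The linear sections through `v`, as a linear map. -/
def liftL (v : V.Fib m) : A.Fib m →ₗ[ℝ] D.overV.Fib ⟨m, v⟩ :=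
  have hadd : ∀ a a', S.lift v (a + a') = S.lift v a + S.lift v a' := fun a a' => by
    simpa using S.lift_add_smul v a a' 1
  { toFun := S.lift v
    map_add' := hadd
    map_smul' := fun c a => by
      have h0 : S.lift v 0 = 0 := by simpa using hadd 0 0
      simpa [h0] using S.lift_add_smul v 0 a c }

/-- The linear map `V_m → D` given by `a ∈ A_m` and a linear map `V_m → C_m`. -/
def ev (m : M) : (A.Fib m × (V.Fib m →L[ℝ] D.core.bundle.Fib m)) →ₗ[ℝ]
    (∀ v : V.Fib m, D.overV.Fib ⟨m, v⟩) :=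
  LinearMap.pi fun v =>
    { toFun := fun x => S.liftL v x.1 + D.coreIncl v (D.coreLE m (x.2 v))
      map_add' := fun x y => by
        rw [Prod.fst_add, Prod.snd_add, add_apply, map_add, map_add, map_add]
        abel
      map_smul' := fun t x => by
        rw [Prod.smul_fst, Prod.smul_snd, smul_apply, map_smul, map_smul,
          map_smul, smul_add]
        rfl }

theorem ev_apply (x : A.Fib m × (V.Fib m →L[ℝ] D.core.bundle.Fib m)) (v : V.Fib m) :
    S.ev m x v = S.lift v x.1 + D.coreIncl v (D.coreLE m (x.2 v)) := rfl

theorem qA_ev (x : A.Fib m × (V.Fib m →L[ℝ] D.core.bundle.Fib m)) (v : V.Fib m) :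
    D.qA ⟨m, v⟩ (S.ev m x v) = x.1 := by
  rw [ev_apply, map_add, qA_lift, qA_coreIncl, add_zero]

theorem ev_injective (m : M) : Function.Injective (S.ev m) := by
  rintro ⟨a, ψ⟩ ⟨a', ψ'⟩ h
  obtain rfl : a = a' := by
    have h1 := S.qA_ev (a, ψ) 0
    rw [h, qA_ev] at h1
    exact h1.symm
  refine Prod.ext rfl (ContinuousLinearMap.ext fun v => ?_)
  have h1 := congrFun h v
  rw [ev_apply, ev_apply] at h1
  exact (D.coreLE m).injective (D.coreIncl_injective v (add_left_cancel h1))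

theorem isLinearAtOver_ev (x : A.Fib m × (V.Fib m →L[ℝ] D.core.bundle.Fib m)) :
    D.IsLinearAtOver x.1 (S.ev m x) := by
  have h := (S.isLinearAtOver_lift x.1).add
    (D.isLinearAtOver_coreIncl ((D.coreLE m).toLinearMap.comp x.2.toLinearMap))
  rw [add_zero] at h
  exact h

/-- A linear map over `a` minus the chosen lift of `a` is linear over zero, hence core-linear. -/
theorem mem_range_ev {φ : ∀ v : V.Fib m, D.overV.Fib ⟨m, v⟩} :
    φ ∈ Set.range (S.ev m) ↔ D.IsLinearAt m φ := by
  rw [isLinearAt_iff]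
  constructor
  · rintro ⟨x, rfl⟩
    exact ⟨x.1, S.isLinearAtOver_ev x⟩
  · rintro ⟨a, ha⟩
    have h := ha.add ((S.isLinearAtOver_lift a).smul (-1))
    have h0 : a + (-1 : ℝ) • a = 0 := by simp
    rw [h0] at h
    obtain ⟨ψ, hψ⟩ := h.exists_eq_coreIncl
    refine ⟨(a, LinearMap.toContinuousLinearMap ((D.coreLE m).symm.toLinearMap.comp ψ)),
      funext fun v => ?_⟩
    have h1 : D.coreLE m ((D.coreLE m).symm (ψ v)) = ψ v := (D.coreLE m).apply_symm_apply _
    refine (congrArg (fun c => S.lift v a + D.coreIncl v c) h1).trans ?_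
    rw [← hψ]
    simp

/-- For the converse, restriction to the zero section of `V` followed by the projection to `A`
recovers `a`. Subtracting the smooth lift of `a` along a smooth section of `V` then tests the
`Hom(V, C)` component. -/
theorem contMDiff_ev_iff [IsManifold I ∞ M]
    {s : ∀ m, A.Fib m × (V.Fib m →L[ℝ] D.core.bundle.Fib m)} :
    ContMDiff I (sumVB A (homVB V D.core.bundle)).J ∞
        (fun m => (⟨m, s m⟩ : (sumVB A (homVB V D.core.bundle)).Tot)) ↔
      ContMDiff V.J D.overV.J ∞ (fun v : V.Tot => (⟨v, S.ev v.proj (s v.proj) v.2⟩ : D.Tot)) := by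
  have hp : ContMDiff I (sumVB A (homVB V D.core.bundle)).J ∞
        (fun m => (⟨m, s m⟩ : (sumVB A (homVB V D.core.bundle)).Tot)) ↔
      ContMDiff I A.J ∞ (fun m => (⟨m, (s m).1⟩ : A.Tot)) ∧
        ContMDiff I (homVB V D.core.bundle).J ∞
          (fun m => (⟨m, (s m).2⟩ : (homVB V D.core.bundle).Tot)) :=
    (forall_congr' fun m => SmoothVB.contMDiffAt_prod_iff (b := fun m : M => m)
      (s := fun m => (s m).1) (B := homVB V D.core.bundle) (t := fun m => (s m).2)).trans
        forall_and
  rw [hp]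
  constructor
  · rintro ⟨h1, h2⟩ v
    refine SmoothVB.contMDiffAt_add (b := fun v : V.Tot => v)
      (S.contMDiff_lift ⟨fun m => (s m).1, h1⟩ v) ?_
    refine (D.contMDiffAt_coreIncl_iff (b := fun v : V.Tot => v.proj) (v := fun v => v.2)
      contMDiffAt_id).2 ?_
    exact SmoothVB.contMDiffAt_hom_apply (b := fun v : V.Tot => v.proj)
      (h2.comp (contMDiff_proj V.Fib) v) contMDiffAt_id
  · intro h
    have h1 : ContMDiff I A.J ∞ (fun m => (⟨m, (s m).1⟩ : A.Tot)) := by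
      intro m
      have h0 := D.contMDiffAt_qA (b := fun m : M => V.zeroMap m)
        (s := fun m => S.ev m (s m) 0) ((h.comp V.zeroMap.contMDiff) m)
      exact h0.congr_of_eventuallyEq (.of_forall fun m =>
        congrArg (TotalSpace.mk m) (S.qA_ev (s m) 0).symm)
    refine ⟨h1, fun m => SmoothVB.contMDiffAt_hom_of_apply (b := fun m : M => m) contMDiffAt_id
      fun v hv => ?_⟩
    refine (D.contMDiffAt_coreIncl_iff hv).1 ?_
    have h2 := SmoothVB.contMDiffAt_sub (b := fun m : M => (⟨m, v m⟩ : V.Tot))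
      ((h _).comp m hv) ((S.contMDiff_lift ⟨fun m => (s m).1, h1⟩ _).comp m hv)
    refine h2.congr_of_eventuallyEq (.of_forall fun m => congrArg (TotalSpace.mk _) ?_)
    exact (add_sub_cancel_left (S.lift (v m) (s m).1) _).symm

/-- The bundle of linear sections. -/
def fatBundle [IsManifold I ∞ M] : D.FatBundle where
  bundle := sumVB A (homVB V D.core.bundle)
  ev := S.ev
  injective := S.ev_injective
  mem_range _ _ := S.mem_range_ev
  smooth_iff _ := S.contMDiff_ev_iff

end Lift

end DoubleVB

namespace SmoothVB

variable (A B : SmoothVB I M)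

/-- The inclusion of the first summand. -/
def inl : VBHom A (sumVB A B) where
  toFun _ := LinearMap.inl ℝ _ _
  smooth p := (contMDiffAt_prod_iff (b := fun p : A.Tot => p.proj) (s := fun p => p.2)).2
    ⟨contMDiffAt_id, contMDiffAt_zero ((contMDiff_proj A.Fib) p)⟩

/-- The inclusion of the second summand. -/
def inr : VBHom B (sumVB A B) where
  toFun _ := LinearMap.inr ℝ _ _
  smooth p := (contMDiffAt_prod_iff (b := fun p : B.Tot => p.proj) (t := fun p => p.2)).2
    ⟨contMDiffAt_zero ((contMDiff_proj B.Fib) p), contMDiffAt_id⟩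

/-- The projection to the first summand. -/
def fst : VBHom (sumVB A B) A where
  toFun _ := LinearMap.fst ℝ _ _
  smooth _ := ((contMDiffAt_prod_iff (b := fun p : (sumVB A B).Tot => p.proj)
    (s := fun p => p.2.1) (t := fun p => p.2.2)).1 contMDiffAt_id).1

/-- The projection to the second summand. -/
def snd : VBHom (sumVB A B) B where
  toFun _ := LinearMap.snd ℝ _ _
  smooth _ := ((contMDiffAt_prod_iff (b := fun p : (sumVB A B).Tot => p.proj)
    (s := fun p => p.2.1) (t := fun p => p.2.2)).1 contMDiffAt_id).2

theorem isShortExact_inr_fst : IsShortExact (inr A B) (fst A B) where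
  injective _ := LinearMap.inr_injective
  exact _ := Function.Exact.inr_fst
  surjective _ := LinearMap.fst_surjective

end SmoothVB

namespace DoubleVB

variable [IsManifold I ∞ M] {V A : SmoothVB I M} {D : DoubleVB V A}

theorem Lift.isCoreLinearInclusion (S : D.Lift) :
    IsCoreLinearInclusion D.core S.fatBundle (SmoothVB.inr A (homVB V D.core.bundle)) := by
  intro m ψ v
  have h := D.isSumA_coreIncl v (D.coreLE m (ψ v))
  have h1 : D.coreIncl v (D.coreLE m (ψ v)) = S.ev m (0, ψ) v := by
    rw [S.ev_apply]
    exact (zero_add _).symm.trans (congrArg (· + _) (map_zero (S.liftL v)).symm)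
  rw [h1] at h
  exact h

theorem Lift.isFatProjection (S : D.Lift) :
    IsFatProjection S.fatBundle (SmoothVB.fst A (homVB V D.core.bundle)) := by
  intro m b v
  exact (D.projA_mk ⟨m, v⟩ _).trans (congrArg (TotalSpace.mk m) (S.qA_ev b v))

end DoubleVB

end Fat

/-! ### Restriction, quotient and locality for split Lie `n`-algebroids. -/

section LieNGeneralities

variable {E H : Type*} [NormedAddCommGroup E] [NormedSpace ℝ E] [TopologicalSpace H]
  {I : ModelWithCorners ℝ E H} {M : Type u} [TopologicalSpace M] [ChartedSpace H M]
  {E' H' : Type*} [NormedAddCommGroup E'] [NormedSpace ℝ E'] [TopologicalSpace H']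
  {I' : ModelWithCorners ℝ E' H'} {N : Type u} [TopologicalSpace N] [ChartedSpace H' N] {n : ℕ}

/-- The map on sections induced by a morphism, as a linear map. -/
def VBHom.mapSecL {A B : SmoothVB I M} (φ : VBHom A B) : A.Sec →ₗ[ℝ] B.Sec where
  toFun := φ.mapSec
  map_add' s t := ContMDiffSection.ext fun x => map_add (φ.toFun x) (s x) (t x)
  map_smul' c s := ContMDiffSection.ext fun x => map_smul (φ.toFun x) c (s x)

/-- The composition of an anchor map with a morphism of vector bundles. -/
def AnchorMap.comp [IsManifold I ∞ M] {A B : SmoothVB I M} (ρ : AnchorMap B) (φ : VBHom A B) :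
    AnchorMap A where
  toFun x := (ρ.toFun x).comp (φ.toFun x)
  smooth := ρ.smooth.comp φ.smooth

namespace GSec

variable {S : Fin n → SmoothVB I M} {B : Fin n → SmoothVB I' N}

/-- The map on graded sections given by maps on the sections of the summands. -/
def map (Ψ : ∀ i, (S i).Sec →ₗ[ℝ] (B i).Sec) : GSec S →ₗ[ℝ] GSec B :=
  LinearMap.pi fun i => (Ψ i).comp (LinearMap.proj i)

theorem map_apply (Ψ : ∀ i, (S i).Sec →ₗ[ℝ] (B i).Sec) (s : GSec S) (i : Fin n) :
    map Ψ s i = Ψ i (s i) := rfl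

theorem map_hom (Ψ : ∀ i, (S i).Sec →ₗ[ℝ] (B i).Sec) {k : ℕ} (deg : Fin k → Fin n)
    (s : ∀ p, (S (deg p)).Sec) (p : Fin k) :
    map Ψ (hom deg s p) = hom deg (fun p => Ψ (deg p) (s p)) p := by
  funext i
  rw [map_apply]
  exact Pi.apply_single (fun i => Ψ i) (fun i => map_zero _) (deg p) (s p) i

theorem map_comp_hom (Ψ : ∀ i, (S i).Sec →ₗ[ℝ] (B i).Sec) {k : ℕ} (deg : Fin k → Fin n)
    (s : ∀ p, (S (deg p)).Sec) :
    (fun p => map Ψ (hom deg s p)) = hom deg (fun p => Ψ (deg p) (s p)) :=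
  funext fun p => map_hom Ψ deg s p

/-- The left hand side of the strong homotopy Jacobi identity. -/
def jacobiator (br : ∀ k : ℕ, MultilinearMap ℝ (fun _ : Fin k => GSec S) (GSec S)) (k : ℕ)
    (deg : Fin k → Fin n) (s : ∀ p, (S (deg p)).Sec) : GSec S :=
  ∑ r : Fin k, (-1 : ℤ) ^ ((r.val + 1) * (k - (r.val + 1))) •
    ∑ σ : Equiv.Perm (Fin k) with IsShuffle (r.val + 1) σ,
      ksgn σ (fun p => (deg p).val) •
        br ((k - (r.val + 1)) + 1)
          (Fin.cons
            (br (r.val + 1)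
              (fun p => GSec.hom deg s (σ ⟨p.val, by have := p.isLt; have := r.isLt; omega⟩)))
            (fun q => GSec.hom deg s (σ ⟨r.val + 1 + q.val, by have := q.isLt; omega⟩)))

/-- The Jacobi identity is transported along any degreewise map commuting with the brackets:
backwards along an injection for restrictions, forwards along a surjection for quotients. -/
theorem map_jacobiator (Ψ : ∀ i, (S i).Sec →ₗ[ℝ] (B i).Sec)
    {br : ∀ k : ℕ, MultilinearMap ℝ (fun _ : Fin k => GSec S) (GSec S)}
    {br' : ∀ k : ℕ, MultilinearMap ℝ (fun _ : Fin k => GSec B) (GSec B)}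
    (h : ∀ k s, map Ψ (br k s) = br' k (fun p => map Ψ (s p))) (k : ℕ) (deg : Fin k → Fin n)
    (s : ∀ p, (S (deg p)).Sec) :
    map Ψ (jacobiator br k deg s) = jacobiator br' k deg (fun p => Ψ (deg p) (s p)) := by
  simp only [jacobiator, map_sum, map_zsmul, h]
  refine Finset.sum_congr rfl fun r _ => congrArg _ (Finset.sum_congr rfl fun σ _ =>
    congrArg _ (congrArg _ (funext fun p => ?_)))
  refine Fin.cases ?_ (fun q => ?_) p
  · simp only [Fin.cons_zero, h, map_hom]
  · simp only [Fin.cons_succ, map_hom]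

end GSec

/-- A fibrewise injective family of linear maps from a bundle over `M` to the sections of a bundle
over `V` along the fibres of `V → M`. -/
structure FibreSections (V S : SmoothVB I M) (B : SmoothVB V.J V.Tot) where
  /-- the linear maps -/
  ev : ∀ m, S.Fib m →ₗ[ℝ] (∀ v : V.Fib m, B.Fib ⟨m, v⟩)
  injective : ∀ m, Function.Injective (ev m)
  smooth : ∀ s : S.Sec,
    ContMDiff V.J B.J ∞ (fun v : V.Tot => (⟨v, ev v.proj (s v.proj) v.2⟩ : B.Tot))

namespace FibreSections

variable {V S : SmoothVB I M} {B : SmoothVB V.J V.Tot} (T : FibreSections V S B)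

/-- The map on sections. -/
def toSec : S.Sec →ₗ[ℝ] B.Sec where
  toFun s := ⟨fun v => T.ev v.proj (s v.proj) v.2, T.smooth s⟩
  map_add' s t := ContMDiffSection.ext fun v =>
    congrFun (map_add (T.ev v.proj) (s v.proj) (t v.proj)) v.2
  map_smul' c s := ContMDiffSection.ext fun v =>
    congrFun (map_smul (T.ev v.proj) c (s v.proj)) v.2

theorem toSec_apply (s : S.Sec) (m : M) (v : V.Fib m) :
    T.toSec s ⟨m, v⟩ = T.ev m (s m) v := rfl

theorem toSec_injective : Function.Injective T.toSec := by
  intro s t h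
  refine ContMDiffSection.ext fun m => T.injective m (funext fun v => ?_)
  rw [← toSec_apply, ← toSec_apply, h]

theorem toSec_fsmul (f : C^∞⟮I, M; ℝ⟯) (s : S.Sec) :
    T.toSec (SmoothVB.fsmul f s) = SmoothVB.fsmul (f.comp V.projMap) (T.toSec s) :=
  ContMDiffSection.ext fun v => congrFun (map_smul (T.ev v.proj) (f v.proj) (s v.proj)) v.2

end FibreSections

/-- A function pulled back from `M` only sees the projection of a tangent vector of `V`. Hence the
Leibniz rule over `V` restricts to one over `M` with the projected anchor. -/
theorem SmoothVB.mfderiv_comp_proj {V : SmoothVB I M} (f : C^∞⟮I, M; ℝ⟯) (v : V.Tot) (w : TangentSpace V.J v) :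
    mfderiv V.J 𝓘(ℝ, ℝ) (f.comp V.projMap) v w =
      mfderiv I 𝓘(ℝ, ℝ) f v.proj (mfderiv V.J I (fun v : V.Tot => v.proj) v w) := by
  have h := mfderiv_comp (I := V.J) (I' := I) (I'' := 𝓘(ℝ, ℝ)) v (g := f)
    (f := fun v : V.Tot => v.proj) (f.contMDiff.mdifferentiableAt (by simp))
    (V.projMap.contMDiff.mdifferentiableAt (by simp))
  exact congrArg (fun l => l w) h

namespace LieNAlgebroid

section

variable {V : SmoothVB I M} {S : Fin n → SmoothVB I M} {B : Fin n → SmoothVB V.J V.Tot}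
  (T : ∀ i, FibreSections V (S i) (B i))

/-- The map on graded sections given by sections along the fibres. -/
abbrev toGSec : GSec S →ₗ[ℝ] GSec B := GSec.map fun i => (T i).toSec

theorem toGSec_injective : Function.Injective (toGSec T) := fun _ _ h =>
  funext fun i => (T i).toSec_injective (congrFun h i)

variable {A F : Fin n → SmoothVB I M}

/-- The map on graded sections given by morphisms of vector bundles. -/
abbrev mapGSec (φ : ∀ i, VBHom (F i) (A i)) : GSec F →ₗ[ℝ] GSec A :=
  GSec.map fun i => (φ i).mapSecL

theorem mapGSec_fsmul (φ : ∀ i, VBHom (F i) (A i)) (f : C^∞⟮I, M; ℝ⟯) (b : GSec F) :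
    mapGSec φ (GSec.fsmul f b) = GSec.fsmul f (mapGSec φ b) :=
  funext fun i => ContMDiffSection.ext fun x => map_smul ((φ i).toFun x) (f x) (b i x)

end

variable [IsManifold I ∞ M] [NeZero n]

section Restrict

variable {V : SmoothVB I M} {S : Fin n → SmoothVB I M} {B : Fin n → SmoothVB V.J V.Tot}
  (L : LieNAlgebroid B) (T : ∀ i, FibreSections V (S i) (B i))

variable (hT : ∀ k (s : Fin k → GSec S), L.br k (fun p => toGSec T (s p)) ∈
  LinearMap.range (toGSec T))

/-- The restriction of the brackets to a subspace of sections. -/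
def restrictBr (k : ℕ) : MultilinearMap ℝ (fun _ : Fin k => GSec S) (GSec S) :=
  (LinearEquiv.ofInjective (toGSec T) (toGSec_injective T)).symm.toLinearMap.compMultilinearMap
    (((L.br k).compLinearMap fun _ => toGSec T).codRestrict (LinearMap.range (toGSec T)) (hT k))

theorem toGSec_restrictBr (k : ℕ) (s : Fin k → GSec S) :
    toGSec T (L.restrictBr T hT k s) = L.br k (fun p => toGSec T (s p)) :=
  congrArg Subtype.val ((LinearEquiv.ofInjective (toGSec T) (toGSec_injective T)).apply_symm_apply
    ⟨L.br k (fun p => toGSec T (s p)), hT k s⟩)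

theorem ev_restrictBr (k : ℕ) (s : Fin k → GSec S) (i : Fin n) (m : M) (v : V.Fib m) :
    (T i).ev m (L.restrictBr T hT k s i m) v = L.br k (fun p => toGSec T (s p)) i ⟨m, v⟩ :=
  congrArg (fun a : GSec B => a i ⟨m, v⟩) (L.toGSec_restrictBr T hT k s)

variable (ρ : AnchorMap (S 0)) (hρ : ∀ (m : M) (x : (S 0).Fib m) (v : V.Fib m),
  mfderiv V.J I (fun v : V.Tot => v.proj) ⟨m, v⟩ (L.anchor.toFun ⟨m, v⟩ ((T 0).ev m x v)) =
    ρ.toFun m x)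

/-- The restriction of a Lie `n`-algebroid to a subspace of sections along the fibres of `V → M`
which is closed under the brackets. -/
def restrict : LieNAlgebroid S where
  anchor := ρ
  br := L.restrictBr T hT
  degree k deg s j hj := by
    refine (T j).toSec_injective ?_
    have h := congrFun (L.toGSec_restrictBr T hT k (GSec.hom deg s)) j
    rw [GSec.map_comp_hom, L.degree k deg _ j hj] at h
    exact h.trans (map_zero _).symm
  leibniz a b f i x := by
    refine (T i).injective x (funext fun v => ?_)
    rw [map_add, map_smul, map_smul, Pi.add_apply, Pi.smul_apply, Pi.smul_apply, ev_restrictBr,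
      ev_restrictBr]
    have h1 : ∀ c : GSec S, (fun p => toGSec T (![a, c] p)) = ![toGSec T a, toGSec T c] :=
      fun c => funext fun p => by fin_cases p <;> rfl
    have h2 : toGSec T (GSec.fsmul f b) = GSec.fsmul (f.comp V.projMap) (toGSec T b) :=
      funext fun i => (T i).toSec_fsmul f (b i)
    have h3 : L.anchor.deriv (toGSec T a 0) (f.comp V.projMap) ⟨x, v⟩ = ρ.deriv (a 0) f x := by
      rw [AnchorMap.deriv, SmoothVB.mfderiv_comp_proj]
      exact congrArg _ (hρ x (a 0 x) v)
    rw [h1, h1, h2, L.leibniz, h3]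
    rfl
  linear k hk a p f := by
    refine toGSec_injective T ?_
    have h2 : ∀ b, toGSec T (GSec.fsmul f b) = GSec.fsmul (f.comp V.projMap) (toGSec T b) :=
      fun b => funext fun i => (T i).toSec_fsmul f (b i)
    rw [toGSec_restrictBr, h2, toGSec_restrictBr]
    have h3 : (fun q => toGSec T (Function.update a p (GSec.fsmul f (a p)) q)) =
        Function.update (fun q => toGSec T (a q)) p
          (GSec.fsmul (f.comp V.projMap) (toGSec T (a p))) := by
      funext q
      rw [← h2]
      exact Function.apply_update (fun _ => toGSec T) a p _ q
    rw [h3]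
    exact L.linear k hk (fun q => toGSec T (a q)) p (f.comp V.projMap)
  skew k deg s σ := by
    refine toGSec_injective T ?_
    rw [map_zsmul, toGSec_restrictBr, toGSec_restrictBr, GSec.map_comp_hom, ← L.skew]
    exact congrArg _ (funext fun p => GSec.map_hom _ deg s (σ p))
  jacobi k deg s := by
    refine toGSec_injective T ?_
    have h := GSec.map_jacobiator (fun i => (T i).toSec) (L.toGSec_restrictBr T hT) k deg s
    exact (h.trans (L.jacobi k deg _)).trans (map_zero _).symm

end Restrict

section Quotient

variable {A F : Fin n → SmoothVB I M} (L : LieNAlgebroid F)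

variable (pr : ∀ i, VBHom (F i) (A i)) (ι : ∀ i, VBHom (A i) (F i))
  (hι : ∀ i x a, (pr i).toFun x ((ι i).toFun x a) = a)

/-- The brackets on a quotient. -/
def quotientBr (k : ℕ) : MultilinearMap ℝ (fun _ : Fin k => GSec A) (GSec A) :=
  (mapGSec pr).compMultilinearMap ((L.br k).compLinearMap fun _ => mapGSec ι)

theorem quotientBr_apply (k : ℕ) (a : Fin k → GSec A) :
    L.quotientBr pr ι k a = mapGSec pr (L.br k fun p => mapGSec ι (a p)) := rfl

variable (hbr : ∀ k (s : Fin k → GSec F),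
    mapGSec pr (L.br k s) = L.quotientBr pr ι k (fun p => mapGSec pr (s p)))
  (ρ : AnchorMap (A 0)) (hρ : ∀ x a, L.anchor.toFun x ((ι 0).toFun x a) = ρ.toFun x a)

/-- The quotient of a Lie `n`-algebroid by an ideal. -/
def quotient : LieNAlgebroid A where
  anchor := ρ
  br := L.quotientBr pr ι
  degree k deg s j hj := by
    rw [quotientBr_apply, GSec.map_comp_hom, GSec.map_apply, L.degree k deg _ j hj, map_zero]
  leibniz a b f i x := by
    have h1 : ∀ c : GSec A, (fun p => mapGSec ι (![a, c] p)) = ![mapGSec ι a, mapGSec ι c] :=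
      fun c => funext fun p => by fin_cases p <;> rfl
    rw [quotientBr_apply, quotientBr_apply, h1, h1, mapGSec_fsmul]
    have h2 := congrArg ((pr i).toFun x) (L.leibniz (mapGSec ι a) (mapGSec ι b) f i x)
    rw [map_add, map_smul, map_smul] at h2
    have h3 : L.anchor.deriv (mapGSec ι a 0) f x = ρ.deriv (a 0) f x :=
      congrArg (fun w => mfderiv I 𝓘(ℝ, ℝ) f x w) (hρ x (a 0 x))
    have h4 : (pr i).toFun x (mapGSec ι b i x) = b i x := hι i x (b i x)
    rw [h3, h4] at h2
    exact h2
  linear k hk a p f := by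
    rw [quotientBr_apply, quotientBr_apply, ← mapGSec_fsmul,
      ← L.linear k hk (fun p => mapGSec ι (a p)) p f, ← mapGSec_fsmul]
    exact congrArg (fun b => mapGSec pr (L.br k b))
      (funext fun q => Function.apply_update (fun _ => mapGSec ι) a p _ q)
  skew k deg s σ := by
    rw [quotientBr_apply, quotientBr_apply, GSec.map_comp_hom, ← map_zsmul, ← L.skew]
    exact congrArg (fun b => mapGSec pr (L.br k b))
      (funext fun p => GSec.map_hom _ deg s (σ p))
  jacobi k deg s := by
    -- The identity upstairs is applied to the lifted sections `ι s` and projected.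
    have h := GSec.map_jacobiator (fun i => (pr i).mapSecL) hbr k deg
      (fun p => (ι (deg p)).mapSec (s p))
    have h0 : (fun p => (pr (deg p)).mapSecL ((ι (deg p)).mapSec (s p))) = s :=
      funext fun p => ContMDiffSection.ext fun x => hι (deg p) x (s p x)
    rw [h0] at h
    exact h.symm.trans ((congrArg (mapGSec pr) (L.jacobi k deg _)).trans (map_zero _))

end Quotient

section Locality

variable {A : Fin n → SmoothVB I M} (L : LieNAlgebroid A)

/-- Covers the linear case (`c = 0`) and the Leibniz case at once. For `k = 2` the slot must be the
second one, since the Leibniz rule is stated there; `c` is local in `f`. -/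
theorem exists_br_update_fsmul {k : ℕ} (a : Fin k → GSec A) (p : Fin k) (hp : k = 2 → p.val = 1)
    (b : GSec A) (f : C^∞⟮I, M; ℝ⟯) (i : Fin n) (x : M) :
    ∃ c : ℝ, (f =ᶠ[𝓝 x] 0 → c = 0) ∧
      L.br k (Function.update a p (GSec.fsmul f b)) i x =
        f x • L.br k (Function.update a p b) i x + c • b i x := by
  by_cases hk : k = 2
  · subst hk
    obtain rfl : p = 1 := Fin.ext (hp rfl)
    have h : ∀ c, Function.update a 1 c = ![a 0, c] := fun c => by
      funext q; fin_cases q <;> rfl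
    refine ⟨L.anchor.deriv (a 0 0) f x, fun hf => ?_, by rw [h, h]; exact L.leibniz _ _ _ _ _⟩
    rw [AnchorMap.deriv, hf.mfderiv_eq]
    have h0 : mfderiv I 𝓘(ℝ, ℝ) (0 : M → ℝ) x = 0 := mfderiv_const
    rw [h0]; rfl
  · refine ⟨0, fun _ => rfl, ?_⟩
    have h := L.linear k hk (Function.update a p b) p f
    rw [Function.update_self, Function.update_idem] at h
    rw [h, zero_smul, add_zero]
    rfl

/-- Skew symmetry for an involution. The sign is left unspecified, as it is only used to transfer
vanishing. -/
theorem br_hom_eq_smul {k : ℕ} (deg : Fin k → Fin n) (s : ∀ p, (A (deg p)).Sec)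
    (σ : Equiv.Perm (Fin k)) (hσ : ∀ p, σ (σ p) = p) :
    ∃ z : ℤ, L.br k (GSec.hom deg s) = z • L.br k (fun p => GSec.hom deg s (σ p)) := by
  have h := L.skew k (fun p => deg (σ p)) (fun p => s (σ p)) σ
  have h1 : (fun p => GSec.hom (fun p => deg (σ p)) (fun p => s (σ p)) (σ p)) =
      GSec.hom deg s := by
    funext p
    change GSec.hom deg s (σ (σ p)) = _
    rw [hσ]
  rw [h1] at h
  exact ⟨_, h⟩

end Locality

end LieNAlgebroid

end LieNGeneralities

/-! ### Decomposition of vectors of `V`; linear and core sections. -/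

section LinearSections

variable {E H : Type*} [NormedAddCommGroup E] [NormedSpace ℝ E] [TopologicalSpace H]
  {I : ModelWithCorners ℝ E H} {M : Type u} [TopologicalSpace M] [ChartedSpace H M]

/-- Every vector `v` of a vector bundle is the sum of `g v`, with `g` a function vanishing near a
given point, and of the values of finitely many sections multiplied by functions of `v`. -/
theorem SmoothVB.exists_decomposition [FiniteDimensional ℝ E] [IsManifold I ∞ M] [T2Space M]
    (V : SmoothVB I M) (m₀ : M) :
    ∃ (r : ℕ) (g : C^∞⟮I, M; ℝ⟯) (e : Fin r → V.Sec) (l : Fin r → C^∞⟮V.J, V.Tot; ℝ⟯),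
      g =ᶠ[𝓝 m₀] 0 ∧ ∀ (m : M) (v : V.Fib m), v = g m • v + ∑ j, l j ⟨m, v⟩ • e j m := by
  obtain ⟨χ, -, hχ⟩ := (SmoothBumpFunction.nhds_basis_tsupport (I := I) m₀).mem_iff.1
    ((V.triv m₀).open_baseSet.mem_nhds (V.mem_triv m₀))
  have hχs : ContMDiff I 𝓘(ℝ, ℝ) ∞ χ := χ.contMDiff
  have hev : ∀ m, m ∉ (V.triv m₀).baseSet → ∀ᶠ x in 𝓝 m, χ x = 0 := fun m hm =>
    notMem_tsupport_iff_eventuallyEq.1 fun h => hm (hχ h)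
  let b := Module.finBasis ℝ V.F
  have he : ∀ j, ContMDiff I V.J ∞
      (fun m => (⟨m, χ m • (V.triv m₀).symmL ℝ m (b j)⟩ : V.Tot)) := fun j m => by
    by_cases hm : m ∈ (V.triv m₀).baseSet
    · exact contMDiffAt_smul (b := fun m : M => m) (hχs m)
        (contMDiffAt_symmL m₀ hm contMDiffAt_id contMDiffAt_const)
    · refine (contMDiffAt_zero (b := fun m : M => m) contMDiffAt_id).congr_of_eventuallyEq ?_
      filter_upwards [hev m hm] with x hx
      rw [hx, zero_smul]
  have hl : ∀ j, ContMDiff V.J 𝓘(ℝ, ℝ) ∞ (fun v : V.Tot =>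
      χ v.proj * b.coord j ((V.triv m₀).continuousLinearMapAt ℝ v.proj v.2)) := fun j v => by
    have hp : ContMDiffAt V.J I ∞ (fun v : V.Tot => v.proj) v := (contMDiff_proj V.Fib) v
    by_cases hm : v.proj ∈ (V.triv m₀).baseSet
    · have h := ((contMDiffAt_mk_iff (b := fun v : V.Tot => v.proj) (s := fun v => v.2) m₀ hm).1
        contMDiffAt_id).2
      exact ((hχs _).comp v hp).mul
        ((LinearMap.toContinuousLinearMap (b.coord j)).contMDiff.contMDiffAt.comp v h)
    · refine (contMDiffAt_const (c := (0 : ℝ))).congr_of_eventuallyEq ?_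
      filter_upwards [hp.continuousAt.eventually (hev _ hm)] with x hx
      rw [hx, zero_mul]
  -- The bump function enters twice, making both the sections and the coefficient functions global.
  -- Hence they reproduce `χ² v`, and the remainder is `1 - χ²`, which vanishes near `m₀`.
  refine ⟨_, ⟨fun m => 1 - χ m * χ m, contMDiff_const.sub (hχs.mul hχs)⟩,
    fun j => ⟨_, he j⟩, fun j => ⟨_, hl j⟩, ?_, fun m v => ?_⟩
  · filter_upwards [χ.eventuallyEq_one] with m hm
    change 1 - χ m * χ m = 0
    rw [hm]; simp
  · change v = (1 - χ m * χ m) • v + ∑ j,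
      (χ m * b.coord j ((V.triv m₀).continuousLinearMapAt ℝ m v)) •
        (χ m • (V.triv m₀).symmL ℝ m (b j))
    have h1 : ∑ j, (χ m * b.coord j ((V.triv m₀).continuousLinearMapAt ℝ m v)) •
        (χ m • (V.triv m₀).symmL ℝ m (b j)) = (χ m * χ m) • (V.triv m₀).symmL ℝ m
          (∑ j, b.repr ((V.triv m₀).continuousLinearMapAt ℝ m v) j • b j) := by
      rw [map_sum, Finset.smul_sum]
      refine Finset.sum_congr rfl fun j _ => ?_
      rw [map_smul, smul_smul, smul_smul, Module.Basis.coord_apply]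
      congr 1
      ring
    rw [h1, b.sum_repr]
    by_cases hm : m ∈ (V.triv m₀).baseSet
    · rw [(V.triv m₀).symmL_continuousLinearMapAt hm, ← add_smul]
      simp
    · rw [(hev m hm).self_of_nhds]
      simp

/-- The evaluation of sections at a point. -/
def SmoothVB.evalSec (A : SmoothVB I M) (x : M) : A.Sec →ₗ[ℝ] A.Fib x where
  toFun s := s x
  map_add' _ _ := rfl
  map_smul' _ _ := rfl

namespace DoubleVB

variable {V A : SmoothVB I M} (D : DoubleVB V A)

theorem isLinearOver_iff (d : D.overV.Sec) (a : A.Sec) :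
    D.IsLinearOver d a ↔ ∀ m, D.IsLinearAtOver (a m) (fun v => d ⟨m, v⟩) := by
  simp only [isLinearAtOver_iff]
  constructor
  · rintro ⟨⟨h1, h2⟩, h3⟩ m
    have hq : ∀ v : V.Fib m, D.qA ⟨m, v⟩ (d ⟨m, v⟩) = a m := fun v =>
      SmoothVB.mk_inj.1 ((D.projA_mk ⟨m, v⟩ _).symm.trans (h3 ⟨m, v⟩))
    refine ⟨hq, fun v w => ?_, fun t v => ?_⟩
    · rw [← SmoothVB.isSum_mk, mk_toA, mk_toA, mk_toA]
      exact h1 _ _ _ (SmoothVB.isSum_mk.2 rfl)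
    · rw [smul_toA_iff]
      have h := congrArg D.e.symm (h2 t ⟨m, v⟩)
      exact h.symm.trans (D.e.symm_apply_apply _)
  · intro h
    refine ⟨⟨?_, ?_⟩, ?_⟩
    · rintro _ _ _ ⟨m, v, w, rfl, rfl, rfl⟩
      obtain ⟨hq, h1, -⟩ := h m
      have h4 := h1 v w
      rw [← SmoothVB.isSum_mk, mk_toA, mk_toA, mk_toA] at h4
      exact h4
    · rintro t ⟨m, v⟩
      obtain ⟨hq, -, h2⟩ := h m
      have h4 := h2 t v
      rw [smul_toA_iff] at h4
      exact (congrArg D.e h4.symm).trans (D.e.apply_symm_apply _)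
    · rintro ⟨m, v⟩
      obtain ⟨hq, -⟩ := h m
      exact (D.projA_mk ⟨m, v⟩ _).trans (congrArg (TotalSpace.mk m) (hq v))

variable {D}

theorem IsCore.qA_eq_zero {d : D.overV.Sec} (h : D.IsCore d) (m : M) (v : V.Fib m) :
    D.qA ⟨m, v⟩ (d ⟨m, v⟩) = 0 := by
  obtain ⟨c, hc, h⟩ := h
  have h1 := h ⟨m, v⟩
  have h2 : D.projA (D.secMap d ⟨m, v⟩) = A.zeroAt m :=
    (h1.proj_left.symm.trans h1.proj_eq).trans (hc m).2
  exact SmoothVB.mk_inj.1 ((D.projA_mk ⟨m, v⟩ _).symm.trans h2)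

variable (D) in
/-- The core section `v ↦ 0_v +_A c(m)`. -/
def coreSec (c : D.core.bundle.Sec) : D.overV.Sec where
  toFun v := D.coreIncl v.2 (D.coreLE v.proj (c v.proj))
  contMDiff_toFun v := (D.contMDiffAt_coreIncl_iff (b := fun v : V.Tot => v.proj)
    (v := fun v => v.2) contMDiffAt_id).2 (c.contMDiff.contMDiffAt.comp v (contMDiff_proj V.Fib v))

theorem isCore_coreSec (c : D.core.bundle.Sec) : D.IsCore (D.coreSec c) :=
  ⟨fun m => ⟨⟨m, 0⟩, D.core.incl m (c m)⟩, fun m => (D.core.mem_range m _).1 ⟨_, rfl⟩,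
    fun v => D.isSumA_coreIncl v.2 (D.coreLE v.proj (c v.proj))⟩

variable [IsManifold I ∞ M]

namespace Lift

variable (S : D.Lift)

/-- The fat bundle of a lift. -/
abbrev fat (_ : D.Lift) : SmoothVB I M := sumVB A (homVB V D.core.bundle)

variable {S} in
/-- The linear map `V_m → C_m` given by an element of the fat bundle. -/
def coreAt {m : M} (x : S.fat.Fib m) : V.Fib m →ₗ[ℝ] D.coreSub m :=
  (D.coreLE m).toLinearMap.comp (x.2 : V.Fib m →L[ℝ] D.core.bundle.Fib m).toLinearMap

/-- The sections of the fat bundle as linear sections. -/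
def linSections : FibreSections V S.fat D.overV where
  ev := S.ev
  injective := S.ev_injective
  smooth s := S.contMDiff_ev_iff.1 s.contMDiff

/-- The core-linear map `V_m → D` given by a linear map `V_m → C_m`. -/
def coreEv (m : M) : (homVB V D.core.bundle).Fib m →ₗ[ℝ] (∀ v : V.Fib m, D.overV.Fib ⟨m, v⟩) :=
  (S.ev m).comp (LinearMap.inr ℝ (A.Fib m) (V.Fib m →L[ℝ] D.core.bundle.Fib m))

/-- The sections of `Hom(V, C)` as linear sections. -/
def coreLinSections : FibreSections V (homVB V D.core.bundle) D.overV where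
  ev := S.coreEv
  injective m ψ ψ' h := by
    have h1 : ((0, ψ) : A.Fib m × (V.Fib m →L[ℝ] D.core.bundle.Fib m)) = (0, ψ') :=
      S.ev_injective m h
    exact congrArg Prod.snd h1
  smooth s := S.linSections.smooth ((SmoothVB.inr A (homVB V D.core.bundle)).mapSec s)

theorem isLinearOver_toSec (s : S.fat.Sec) :
    D.IsLinearOver (S.linSections.toSec s) ((SmoothVB.fst _ _).mapSec s) :=
  (D.isLinearOver_iff _ _).2 fun m => S.isLinearAtOver_ev (s m)

theorem eq_of_isLinearOver {s : S.fat.Sec} {a : A.Sec}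
    (h : D.IsLinearOver (S.linSections.toSec s) a) : (SmoothVB.fst _ _).mapSec s = a :=
  ContMDiffSection.ext fun m => by
    have h1 := ((D.isLinearOver_iff _ _).1 h m).qA_eq 0
    exact (S.qA_ev (s m) 0).symm.trans h1

/-- Pointwise, the linear map is a value of `ev`; smoothness of the resulting section of `Â` is
`contMDiff_ev_iff`. -/
theorem exists_toSec_eq {d : D.overV.Sec} (h : D.IsLinear d) :
    ∃ s, S.linSections.toSec s = d := by
  obtain ⟨a, ha⟩ := h
  have h1 : ∀ m, ∃ x, S.ev m x = fun v => d ⟨m, v⟩ := fun m =>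
    S.mem_range_ev.2 (isLinearAt_iff.2 ⟨a m, (D.isLinearOver_iff _ _).1 ha m⟩)
  choose x hx using h1
  have h2 : ∀ v : V.Tot, S.ev v.proj (x v.proj) v.2 = d v := fun v => congrFun (hx v.proj) v.2
  refine ⟨⟨x, S.contMDiff_ev_iff.2 ?_⟩, ContMDiffSection.ext h2⟩
  simp only [h2]
  exact d.contMDiff

end Lift

end DoubleVB

end LinearSections

/-! ### Brackets with an entry over zero project to zero. -/

section VBLieN

variable {E H : Type*} [NormedAddCommGroup E] [NormedSpace ℝ E] [TopologicalSpace H]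
  {I : ModelWithCorners ℝ E H} {M : Type u} [TopologicalSpace M] [ChartedSpace H M]
  {n : ℕ} {V : SmoothVB I M} {A : Fin n → SmoothVB I M}
  {D : ∀ i, DoubleVB V (A i)}

open LieNAlgebroid DoubleVB

/-- The value of the projection to `A` at a point of `V`. -/
def qAAt (i : Fin n) (m : M) (v : V.Fib m) : GSec (fun i => (D i).overV) →ₗ[ℝ] (A i).Fib m where
  toFun a := (D i).qA ⟨m, v⟩ (a i ⟨m, v⟩)
  map_add' a b := map_add ((D i).qA ⟨m, v⟩) (a i ⟨m, v⟩) (b i ⟨m, v⟩)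
  map_smul' c a := map_smul ((D i).qA ⟨m, v⟩) c (a i ⟨m, v⟩)

theorem qAAt_apply (i : Fin n) (m : M) (v : V.Fib m) (a : GSec (fun i => (D i).overV)) :
    qAAt i m v a = (D i).qA ⟨m, v⟩ (a i ⟨m, v⟩) := rfl

variable [IsManifold I ∞ M]

/-- The linear sections of a family of double vector bundles. -/
abbrev linT (S : ∀ i, (D i).Lift) : ∀ i, FibreSections V (S i).fat (D i).overV :=
  fun i => (S i).linSections

/-- The core-linear sections of a family of double vector bundles. -/
abbrev coreLinT (S : ∀ i, (D i).Lift) :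
    ∀ i, FibreSections V (homVB V (D i).core.bundle) (D i).overV :=
  fun i => (S i).coreLinSections

/-- The projections `Â_i → A_i`. -/
abbrev fatFst (S : ∀ i, (D i).Lift) (i : Fin n) : VBHom (S i).fat (A i) :=
  SmoothVB.fst (A i) (homVB V (D i).core.bundle)

/-- The splittings `A_i → Â_i`. -/
abbrev fatInl (S : ∀ i, (D i).Lift) (i : Fin n) : VBHom (A i) (S i).fat :=
  SmoothVB.inl (A i) (homVB V (D i).core.bundle)

/-- The inclusions `Hom(V, C_i) → Â_i`. -/
abbrev fatInr (S : ∀ i, (D i).Lift) (i : Fin n) :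
    VBHom (homVB V (D i).core.bundle) (S i).fat :=
  SmoothVB.inr (A i) (homVB V (D i).core.bundle)

/-- The projections `Â_i → Hom(V, C_i)`. -/
abbrev fatSnd (S : ∀ i, (D i).Lift) (i : Fin n) :
    VBHom (S i).fat (homVB V (D i).core.bundle) :=
  SmoothVB.snd (A i) (homVB V (D i).core.bundle)

variable (S : ∀ i, (D i).Lift)

theorem isLinear_toGSec (s : GSec fun i => (S i).fat) (i : Fin n) :
    (D i).IsLinear (toGSec (linT S) s i) := ⟨_, (S i).isLinearOver_toSec (s i)⟩

theorem toGSec_linT_apply (s : GSec fun i => (S i).fat) (i : Fin n) (m : M) (v : V.Fib m) :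
    toGSec (linT S) s i ⟨m, v⟩ = (S i).lift v (s i m).1 +
      (D i).coreIncl v (Lift.coreAt (s i m) v) := rfl

theorem qA_toGSec (s : GSec fun i => (S i).fat) (i : Fin n) (m : M) (v : V.Fib m) :
    (D i).qA ⟨m, v⟩ (toGSec (linT S) s i ⟨m, v⟩) = (s i m).1 := (S i).qA_ev (s i m) v

theorem toGSec_coreLinT (s : GSec fun i => homVB V (D i).core.bundle) :
    toGSec (coreLinT S) s = toGSec (linT S) (mapGSec (fatInr S) s) := rfl

/-- The core sections obtained by evaluating linear sections over zero on a section of `V`. -/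
def evalCore (s : GSec fun i => (S i).fat) (e : V.Sec) : GSec (fun i => (D i).overV) :=
  fun i => (D i).coreSec ⟨_, fun m => SmoothVB.contMDiffAt_hom_apply
    (A := V) (B := (D i).core.bundle) (b := fun m : M => m) (φ := fun m => (s i m).2) (((fatSnd S i).mapSec (s i)).contMDiff m) (e.contMDiff m)⟩

variable [NeZero n] {L : LieNAlgebroid (fun i => (D i).overV)}

theorem br_mem_range_linT (hL : IsVBLieNAlgebroid D L) (k : ℕ)
    (s : Fin k → GSec fun i => (S i).fat) :
    L.br k (fun p => toGSec (linT S) (s p)) ∈ LinearMap.range (toGSec (linT S)) := by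
  have h := fun i => (S i).exists_toSec_eq
    (hL.br_linear k (fun p => toGSec (linT S) (s p)) (fun p i => isLinear_toGSec S (s p) i) i)
  choose t ht using h
  exact ⟨t, funext ht⟩

variable [FiniteDimensional ℝ E] [T2Space M]

/-- The brackets of linear sections, one of which projects to zero, project to zero. -/
theorem qA_br_eq_zero_of_ne (hL : IsVBLieNAlgebroid D L) {k : ℕ}
    (s : Fin k → GSec fun i => (S i).fat) (p₀ : Fin k) (hp : k = 2 → p₀.val = 1)
    (h0 : mapGSec (fatFst S) (s p₀) = 0) (i : Fin n) (m : M) (v : V.Fib m) :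
    qAAt i m v (L.br k fun p => toGSec (linT S) (s p)) = 0 := by
  obtain ⟨r, g, e, l, hg, hdec⟩ := V.exists_decomposition m
  let d : Fin k → GSec (fun i => (D i).overV) := fun p => toGSec (linT S) (s p)
  have hfst : ∀ i m, (s p₀ i m).1 = 0 := fun i m => congrArg (fun a : GSec A => a i m) h0
  have hd0 : ∀ i m (v : V.Fib m),
      d p₀ i ⟨m, v⟩ = (D i).coreIncl v (Lift.coreAt (s p₀ i m) v) := fun i m v => by
    refine (toGSec_linT_apply S (s p₀) i m v).trans ?_
    rw [hfst, show (S i).lift v 0 = 0 from map_zero ((S i).liftL v), zero_add]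
  -- Over zero, `d p₀` has the value `0_v +_A ψ(v)`. The base point `v` is kept while the argument
  -- of `ψ` is decomposed; each `ψ(e_j)` then gives a core section.
  have hd : d p₀ = GSec.fsmul (g.comp V.projMap) (d p₀) +
      ∑ j, GSec.fsmul (l j) (evalCore S (s p₀) (e j)) := by
    funext i
    refine ContMDiffSection.ext ?_
    rintro ⟨m, v⟩
    rw [Pi.add_apply, Finset.sum_apply, ContMDiffSection.coe_add, Pi.add_apply]
    have hs : (∑ j, GSec.fsmul (l j) (evalCore S (s p₀) (e j)) i) ⟨m, v⟩ =
        ∑ j, l j ⟨m, v⟩ • (D i).coreIncl v (Lift.coreAt (s p₀ i m) (e j m)) :=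
      map_sum ((D i).overV.evalSec ⟨m, v⟩) _ _
    have hg : GSec.fsmul (g.comp V.projMap) (d p₀) i ⟨m, v⟩ =
        g m • (D i).coreIncl v (Lift.coreAt (s p₀ i m) v) := congrArg (g m • ·) (hd0 i m v)
    rw [hs, hg, hd0, ← map_smul, ← map_smul]
    simp only [← map_smul]
    rw [← map_sum, ← map_sum, ← map_add, ← map_add, ← hdec]
  have hbr : L.br k d = L.br k (Function.update d p₀ (GSec.fsmul (g.comp V.projMap) (d p₀))) +
      ∑ j, L.br k (Function.update d p₀ (GSec.fsmul (l j) (evalCore S (s p₀) (e j)))) := by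
    rw [← MultilinearMap.map_update_sum, ← MultilinearMap.map_update_add, ← hd,
      Function.update_eq_self]
  change qAAt i m v (L.br k d) = 0
  rw [hbr, map_add, map_sum]
  -- As `g` vanishes on a neighbourhood of `m`, both the value of its pullback and the derivative
  -- term vanish at `(m, v)`.
  have h1 : qAAt i m v
      (L.br k (Function.update d p₀ (GSec.fsmul (g.comp V.projMap) (d p₀)))) = 0 := by
    obtain ⟨c, hc, h⟩ := L.exists_br_update_fsmul d p₀ hp (d p₀) (g.comp V.projMap) i ⟨m, v⟩
    have hg0 : g m = 0 := hg.self_of_nhds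
    have hgv : (g.comp V.projMap : V.Tot → ℝ) =ᶠ[𝓝 ⟨m, v⟩] 0 :=
      (V.projMap.contMDiff.continuous.tendsto (⟨m, v⟩ : V.Tot)).eventually hg
    have hgv0 : (g.comp V.projMap) (⟨m, v⟩ : V.Tot) = 0 := hg0
    rw [hc hgv, hgv0, zero_smul, zero_smul, add_zero] at h
    rw [qAAt_apply, h, map_zero]
  -- Both terms project to zero: the bracket with a core section is a core section, and the Leibniz
  -- correction is a multiple of the core section itself.
  have h2 : ∀ j, qAAt i m v (L.br k
      (Function.update d p₀ (GSec.fsmul (l j) (evalCore S (s p₀) (e j))))) = 0 := fun j => by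
    obtain ⟨c, -, h⟩ := L.exists_br_update_fsmul d p₀ hp (evalCore S (s p₀) (e j)) (l j) i ⟨m, v⟩
    have hcore : ∀ i, (D i).IsCore (evalCore S (s p₀) (e j) i) := fun i => isCore_coreSec _
    have hk : (D i).IsCore (L.br k (Function.update d p₀ (evalCore S (s p₀) (e j))) i) := by
      refine hL.br_core k _ p₀ (fun i => ?_) (fun p hp i => ?_) i
      · rw [Function.update_self]
        exact hcore i
      · rw [Function.update_of_ne hp]
        exact isLinear_toGSec S (s p) i
    rw [qAAt_apply, h, map_add, map_smul, map_smul, hk.qA_eq_zero, (hcore i).qA_eq_zero,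
      smul_zero, smul_zero, add_zero]
  rw [h1, Finset.sum_eq_zero fun j _ => h2 j, add_zero]

/-- The brackets of linear sections, one of which projects to zero, project to zero. -/
theorem qA_br_eq_zero (hL : IsVBLieNAlgebroid D L) {k : ℕ}
    (s : Fin k → GSec fun i => (S i).fat) (p₀ : Fin k)
    (h0 : mapGSec (fatFst S) (s p₀) = 0) (i : Fin n) (m : M) (v : V.Fib m) :
    qAAt i m v (L.br k fun p => toGSec (linT S) (s p)) = 0 := by
  by_cases hp : k = 2 → p₀.val = 1
  · exact qA_br_eq_zero_of_ne S hL s p₀ hp h0 i m v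
  push Not at hp
  obtain ⟨rfl, hp⟩ := hp
  have hp0 : p₀ = 0 := by
    have := p₀.isLt
    exact Fin.ext (by simp; omega)
  subst hp0
  -- The remaining case is the first slot of the 2-bracket. Skew symmetry is available for
  -- homogeneous entries only, so the entries are split into components before being swapped.
  have hs : (fun p => toGSec (linT S) (s p)) =
      fun p => ∑ j, toGSec (linT S) (Pi.single j (s p j)) := funext fun p => by
    rw [← map_sum, Finset.univ_sum_single]
  rw [hs, MultilinearMap.map_sum, map_sum]
  refine Finset.sum_eq_zero fun r _ => ?_
  have h1 := L.br_hom_eq_smul r (fun p => (linT S (r p)).toSec (s p (r p))) (Equiv.swap 0 1)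
    (fun p => Equiv.swap_apply_self _ _ _)
  obtain ⟨z, hz⟩ := h1
  have h2 : ∀ p, GSec.hom r (fun p => (linT S (r p)).toSec (s p (r p))) p =
      toGSec (linT S) (GSec.hom r (fun p => s p (r p)) p) := fun p =>
    (GSec.map_hom (fun i => (linT S i).toSec) r (fun p => s p (r p)) p).symm
  have h3 : (fun p => toGSec (linT S) (Pi.single (r p) (s p (r p)))) =
      GSec.hom r (fun p => (linT S (r p)).toSec (s p (r p))) := funext fun p => (h2 p).symm
  rw [h3, hz, map_zsmul]
  simp only [h2]
  rw [qA_br_eq_zero_of_ne S hL (fun p => GSec.hom r (fun p => s p (r p)) (Equiv.swap 0 1 p)) 1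
    (fun _ => rfl) ?_ i m v, smul_zero]
  rw [Equiv.swap_apply_right, GSec.map_hom]
  have h4 : (fatFst S (r 0)).mapSecL (s 0 (r 0)) = 0 := congrFun h0 (r 0)
  exact (congrArg (Pi.single (r 0)) h4).trans (Pi.single_zero _)

end VBLieN

/-! ### The Lie `n`-algebroids on `Â`, `A` and `Hom(V, C)`. -/

section Main

variable {E H : Type*} [NormedAddCommGroup E] [NormedSpace ℝ E] [TopologicalSpace H]
  {I : ModelWithCorners ℝ E H} {M : Type u} [TopologicalSpace M] [ChartedSpace H M]
  {n : ℕ} {V : SmoothVB I M} {A : Fin n → SmoothVB I M}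
  {D : ∀ i, DoubleVB V (A i)} [IsManifold I ∞ M] (S : ∀ i, (D i).Lift)

open LieNAlgebroid DoubleVB

theorem mapGSec_fatFst_eq (s : GSec fun i => (S i).fat) (i : Fin n) (m : M) (v : V.Fib m) :
    mapGSec (fatFst S) s i m = qAAt i m v (toGSec (linT S) s) := (qA_toGSec S s i m v).symm

variable [NeZero n] {L : LieNAlgebroid (fun i => (D i).overV)}

/-- Since `ρ_D` covers `ρ_A`, the projected vector depends only on the point of `A` below, and not
on `v`. -/
theorem mfderiv_anchor_ev {ρA : AnchorMap (A 0)} (hρ : IsLinearAnchor (D 0) L.anchor ρA) (m : M)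
    (x : (S 0).fat.Fib m) (v : V.Fib m) :
    mfderiv V.J I (fun v : V.Tot => v.proj) ⟨m, v⟩
      (L.anchor.toFun ⟨m, v⟩ ((linT S 0).ev m x v)) =
        (ρA.comp (fatFst S 0)).toFun m x := by
  have h := hρ.comm ⟨⟨m, v⟩, (S 0).ev m x v⟩
  rw [projA_mk] at h
  have h1 : (D 0).qA ⟨m, v⟩ ((S 0).ev m x v) = (fatFst S 0).toFun m x := (S 0).qA_ev x v
  exact TotalSpace.mk_inj.1 (h.trans (congrArg (fun a => ρA.totMap ⟨m, a⟩) h1))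

/-- The Lie `n`-algebroid of linear sections. -/
def fatLie (hL : IsVBLieNAlgebroid D L) {ρA : AnchorMap (A 0)}
    (hρ : IsLinearAnchor (D 0) L.anchor ρA) : LieNAlgebroid (fun i => (S i).fat) :=
  L.restrict (linT S) (br_mem_range_linT S hL) (ρA.comp (fatFst S 0)) (mfderiv_anchor_ev S hρ)

theorem toGSec_fatLie_br (hL : IsVBLieNAlgebroid D L) {ρA : AnchorMap (A 0)}
    (hρ : IsLinearAnchor (D 0) L.anchor ρA) (k : ℕ) (s : Fin k → GSec fun i => (S i).fat) :
    toGSec (linT S) ((fatLie S hL hρ).br k s) = L.br k (fun p => toGSec (linT S) (s p)) :=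
  L.toGSec_restrictBr _ (br_mem_range_linT S hL) k s

theorem isFatStructure_fatLie (hL : IsVBLieNAlgebroid D L) {ρA : AnchorMap (A 0)}
    (hρ : IsLinearAnchor (D 0) L.anchor ρA) :
    IsFatStructure D L (fun i => (S i).fatBundle) (fatLie S hL hρ) where
  anchor m b v := congrArg (TotalSpace.mk m) (mfderiv_anchor_ev S hρ m b v)
  bracket k s i := congrFun (toGSec_fatLie_br S hL hρ k s) i

variable [FiniteDimensional ℝ E] [T2Space M]

theorem mapGSec_fatLie_br_eq_zero (hL : IsVBLieNAlgebroid D L) {ρA : AnchorMap (A 0)}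
    (hρ : IsLinearAnchor (D 0) L.anchor ρA) {k : ℕ} (s : Fin k → GSec fun i => (S i).fat)
    (p₀ : Fin k) (h0 : mapGSec (fatFst S) (s p₀) = 0) :
    mapGSec (fatFst S) ((fatLie S hL hρ).br k s) = 0 := by
  funext i
  refine ContMDiffSection.ext fun m => ?_
  rw [mapGSec_fatFst_eq S _ i m 0, toGSec_fatLie_br]
  exact qA_br_eq_zero S hL s p₀ h0 i m 0

/-- The entries are replaced one at a time. By multilinearity each replacement changes the bracket
by one with an entry over zero, so the projection is unaffected. -/
theorem mapGSec_fatLie_br_congr (hL : IsVBLieNAlgebroid D L) {ρA : AnchorMap (A 0)}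
    (hρ : IsLinearAnchor (D 0) L.anchor ρA) {k : ℕ} {s s' : Fin k → GSec fun i => (S i).fat}
    (h : ∀ p, mapGSec (fatFst S) (s p) = mapGSec (fatFst S) (s' p)) :
    mapGSec (fatFst S) ((fatLie S hL hρ).br k s) =
      mapGSec (fatFst S) ((fatLie S hL hρ).br k s') := by
  have key : ∀ t : Finset (Fin k),
      mapGSec (fatFst S) ((fatLie S hL hρ).br k (t.piecewise s s')) =
        mapGSec (fatFst S) ((fatLie S hL hρ).br k s') := fun t => by
    induction t using Finset.induction_on with
    | empty => rw [Finset.piecewise_empty]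
    | insert p t hp ih =>
      rw [← ih, ← sub_eq_zero, ← map_sub, Finset.piecewise_insert]
      have h1 : t.piecewise s s' = Function.update (t.piecewise s s') p (s' p) := by
        rw [← Finset.piecewise_eq_of_notMem t s s' hp, Function.update_eq_self]
      conv_lhs => enter [2, 2]; rw [h1]
      rw [← MultilinearMap.map_update_sub]
      refine mapGSec_fatLie_br_eq_zero S hL hρ _ p ?_
      rw [Function.update_self, map_sub, h, sub_self]
  rw [← key Finset.univ, Finset.piecewise_univ]

/-- The Lie `n`-algebroid on the side bundle. -/
def sideLie (hL : IsVBLieNAlgebroid D L) {ρA : AnchorMap (A 0)}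
    (hρ : IsLinearAnchor (D 0) L.anchor ρA) : LieNAlgebroid A :=
  (fatLie S hL hρ).quotient (fatFst S) (fatInl S) (fun _ _ _ => rfl)
    (fun _ _ => mapGSec_fatLie_br_congr S hL hρ fun _ => rfl) ρA (fun _ _ => rfl)

theorem mapGSec_fatLie_br (hL : IsVBLieNAlgebroid D L) {ρA : AnchorMap (A 0)}
    (hρ : IsLinearAnchor (D 0) L.anchor ρA) (k : ℕ) (s : Fin k → GSec fun i => (S i).fat) :
    mapGSec (fatFst S) ((fatLie S hL hρ).br k s) =
      (sideLie S hL hρ).br k (fun p => mapGSec (fatFst S) (s p)) :=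
  mapGSec_fatLie_br_congr S hL hρ fun _ => rfl

theorem br_mem_range_coreLinT (hL : IsVBLieNAlgebroid D L) (k : ℕ)
    (s : Fin k → GSec fun i => homVB V (D i).core.bundle) :
    L.br k (fun p => toGSec (coreLinT S) (s p)) ∈ LinearMap.range (toGSec (coreLinT S)) := by
  -- The 0-bracket has no entry lying over zero; it vanishes for degree reasons, as an empty sum of
  -- degrees is never `j + 2`.
  rcases Nat.eq_zero_or_pos k with rfl | hk
  · refine ⟨0, funext fun i => ?_⟩
    rw [map_zero]
    have h := L.degree 0 Fin.elim0 (fun p => p.elim0) i (by simp)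
    exact h.symm.trans (congrArg (fun a => L.br 0 a i) (Subsingleton.elim _ _))
  obtain ⟨t, ht⟩ := br_mem_range_linT S hL k (fun p => mapGSec (fatInr S) (s p))
  have h0 : ∀ i m, (t i m).1 = 0 := fun i m => by
    rw [← qA_toGSec S t i m 0, ht]
    exact qA_br_eq_zero S hL (fun p => mapGSec (fatInr S) (s p)) ⟨0, hk⟩ rfl i m 0
  refine ⟨mapGSec (fatSnd S) t, Eq.trans ?_ ht⟩
  rw [toGSec_coreLinT]
  refine congrArg (toGSec (linT S)) (funext fun i => ContMDiffSection.ext fun m => ?_)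
  exact Prod.ext (h0 i m).symm rfl

/-- The Lie `n`-algebroid of core-linear sections. -/
def homLie (hL : IsVBLieNAlgebroid D L) {ρA : AnchorMap (A 0)}
    (hρ : IsLinearAnchor (D 0) L.anchor ρA) :
    LieNAlgebroid (fun i => homVB V (D i).core.bundle) :=
  L.restrict (coreLinT S) (br_mem_range_coreLinT S hL)
    ((ρA.comp (fatFst S 0)).comp (fatInr S 0))
    fun m x v => mfderiv_anchor_ev S hρ m ((fatInr S 0).toFun m x) v

/-- The side brackets are defined through chosen splittings, but every family of linear sections
comes from `Â`, and there the projection of a bracket depends only on the projections of the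
entries. -/
theorem isSideStructure_sideLie (hL : IsVBLieNAlgebroid D L) {ρA : AnchorMap (A 0)}
    (hρ : IsLinearAnchor (D 0) L.anchor ρA) : IsSideStructure D L (sideLie S hL hρ) where
  anchor := hρ
  bracket k d a h i := by
    have h1 : ∀ p i, ∃ s, (S i).linSections.toSec s = d p i := fun p i =>
      (S i).exists_toSec_eq ⟨_, h p i⟩
    choose s hs using h1
    have hd : d = fun p => toGSec (linT S) (s p) := funext fun p => funext fun i => (hs p i).symm
    have ha : a = fun p => mapGSec (fatFst S) (s p) := funext fun p => funext fun i => by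
      have h2 := h p i
      rw [← hs p i] at h2
      exact ((S i).eq_of_isLinearOver h2).symm
    rw [hd, ha, ← toGSec_fatLie_br S hL hρ, ← mapGSec_fatLie_br]
    exact (S i).isLinearOver_toSec _

theorem isLieNMorphism_fatFst (hL : IsVBLieNAlgebroid D L) {ρA : AnchorMap (A 0)}
    (hρ : IsLinearAnchor (D 0) L.anchor ρA) :
    IsLieNMorphism (fatLie S hL hρ) (sideLie S hL hρ) (fatFst S) where
  anchor _ _ := rfl
  bracket k s i := congrFun (mapGSec_fatLie_br S hL hρ k s) i

theorem isLieNMorphism_fatInr (hL : IsVBLieNAlgebroid D L) {ρA : AnchorMap (A 0)}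
    (hρ : IsLinearAnchor (D 0) L.anchor ρA) :
    IsLieNMorphism (homLie S hL hρ) (fatLie S hL hρ) (fatInr S) where
  anchor _ _ := rfl
  bracket k s i := by
    have h : mapGSec (fatInr S) ((homLie S hL hρ).br k s) =
        (fatLie S hL hρ).br k (fun p => mapGSec (fatInr S) (s p)) := by
      refine toGSec_injective (linT S) ?_
      rw [toGSec_fatLie_br]
      exact L.toGSec_restrictBr (coreLinT S) (br_mem_range_coreLinT S hL) k s
    exact congrFun h i

end Main

end

theorem mainTheorem12 {E H : Type*} [NormedAddCommGroup E] [NormedSpace ℝ E]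
    [FiniteDimensional ℝ E] [TopologicalSpace H] {I : ModelWithCorners ℝ E H} [I.Boundaryless]
    {M : Type u} [TopologicalSpace M] [ChartedSpace H M] [IsManifold I ∞ M] [T2Space M]
    [SigmaCompactSpace M] {n : ℕ} [NeZero n]
    (V : SmoothVB I M) (A : Fin n → SmoothVB I M) (D : ∀ i, DoubleVB V (A i))
    (L : LieNAlgebroid (fun i => (D i).overV)) (hL : IsVBLieNAlgebroid D L) :
    ∃ (C : ∀ i, (D i).CoreBundle) (B : ∀ i, (D i).FatBundle)
      (LA : LieNAlgebroid A)
      (LF : LieNAlgebroid (fun i => (B i).bundle))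
      (LH : LieNAlgebroid (fun i => homVB V (C i).bundle))
      (j : ∀ i, VBHom (homVB V (C i).bundle) (B i).bundle)
      (pr : ∀ i, VBHom (B i).bundle (A i)),
      IsSideStructure D L LA ∧
      IsFatStructure D L B LF ∧
      (∀ i, IsCoreLinearInclusion (C i) (B i) (j i)) ∧
      (∀ i, IsFatProjection (B i) (pr i)) ∧
      (∀ i, IsShortExact (j i) (pr i)) ∧
      IsLieNMorphism LH LF j ∧
      IsLieNMorphism LF LA pr := by
  obtain ⟨ρA, hρ⟩ := hL.anchor_linear
  -- The choice of lift does not affect the underlying bundle `A_i ⊕ Hom(V, C_i)`; it enters the fat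
  -- bundle through the evaluation of its elements as linear maps `V_m → D_i`.
  let S : ∀ i, (D i).Lift := fun i => (D i).nonempty_lift.some
  exact ⟨fun i => (D i).core, fun i => (S i).fatBundle, sideLie S hL hρ, fatLie S hL hρ,
    homLie S hL hρ, fatInr S, fatFst S, isSideStructure_sideLie S hL hρ,
    isFatStructure_fatLie S hL hρ, fun i => (S i).isCoreLinearInclusion,
    fun i => (S i).isFatProjection, fun i => SmoothVB.isShortExact_inr_fst _ _,
    isLieNMorphism_fatInr S hL hρ, isLieNMorphism_fatFst S hL hρ⟩
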